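/- Let $B$ be a symmetric positive definite real $d\times d$ matrix, $\nu\in\mathbb R^d$ a unit vector, $S=\{x\in\mathbb R^d:(x,\nu)=0\}$, $q\in\mathbb R$ with $|q|\le 1$, and $\alpha\in S$. Let $\pi_S$ be the orthogonal projection onto $S$, and write $x_\nu=(x,\nu)$, $x_S=\pi_Sx$, $N=B\nu$, $\sigma^2=(B\nu,\nu)$, $b=\pi_SB\nu$, and $B_S=(\pi_SB^{-1}\pi_S)^{-1}$ (an operator in $S$). For $t>0$ and $x,y\in\mathbb R^d$ put $$g^S(t,x,y)=[\det(2\pi tB_S)]^{-1/2}\exp\Big\{-\tfrac1{2t}\big(B_S^{-1}z,z\big)\Big\},\qquad z=y_S-x_S-\tfrac{y_\nu-x_\nu}{\sigma^2}\,b,$$ (the determinant is taken in $S$) and, with $\operatorname{sign}0=0$, $$G(t,x,y)=\frac1{\sqrt{2\pi t\sigma^2}}\Big[\exp\Big\{-\frac{(y_\nu-x_\nu)^2}{2t\sigma^2}\Big\}-\exp\Big\{-\frac{(|y_\nu|+|x_\nu|)^2}{2t\sigma^2}\Big\}\Big]g^S(t,x,y)$$ $$+\int_0^\infty(q\operatorname{sign}y_\nu+1)\frac{\sigma^2\theta+|x_\nu|+|y_\nu|}{\sqrt{2\pi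 t^3\sigma^2}}\exp\Big\{-\frac{(\sigma^2\theta+|x_\nu|+|y_\nu|)^2}{2t\sigma^2}\Big\}g^S(t,x+\alpha\theta,y)\,d\theta .$$ Then the $\theta$-integral converges absolutely, and $G$ is a transition probability density: for each $t>0$ it is measurable in $(x,y)$ and nonnegative, $\int_{\mathbb R^d}G(t,x,y)\,dy=1$ for all $x$, and the Chapman–Kolmogorov equation $\int_{\mathbb R^d} G(s,x,z)\int_AG(t,z,y)\,dy\,dz=\int_AG(s+t,x,y)\,dy$ holds for all $s,t>0$, $x\in\mathbb R^d$ and Borel $A\subseteq\mathbb R^d$. There is a Markov process in $\mathbb R^d$ with continuous paths and transition probability density $G$; that is, there are continuous-path random variables $(X_t)_{t\ge0}$ on a measurable space and probability measures $P_x$ on it, depending measurably on $x\in\mathbb R^d$, with $P_x(X_0=x)=1$ and $P_x(X_{s+t}\in A\mid X_r,\,r\le s)=\int_AG(t,X_s,y)\,dy$ $P_x$-almost surely for all $x\in\mathbb R^d$, $s\ge0$, $t>0$ and Borel $A$. Moreover, for every bounded continuous $\varphi:\mathbb R^d\to\mathbb R$ the function $$u(t,x)=\int_{\mathbb R^d}\varphi(y)G(t,x,y)\,dy,\qquad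 t>0,\ x\in\mathbb R^d,$$ has the following properties. 1. For $t>0$ and $x\notin S$, $u$ is twice continuously differentiable in $x$ near $x$, differentiable in $t$, and $\frac{\partial u}{\partial t}=\frac12\operatorname{Tr}(BD^2u)$. 2. $\lim_{t\downarrow0}u(t,x)=\varphi(x)$ for all $x\in\mathbb R^d$. 3. For $t>0$ and $x\in S$, $\lim_{\varepsilon\downarrow0}u(t,x+\varepsilon\nu)=\lim_{\varepsilon\downarrow0}u(t,x-\varepsilon\nu)=u(t,x)$. 4. For $t>0$ and $x\in S$ the limits $\nabla u(t,x\pm)=\lim_{\varepsilon\downarrow0}\nabla u(t,x\pm\varepsilon\nu)$ exist, $u(t,\cdot)$ has at $x$ a derivative $(\alpha,\nabla u)$ along $\alpha$, which equals $(\alpha,\nabla u(t,x+))$ and $(\alpha,\nabla u(t,x-))$, and with $\frac{\partial u(t,x\pm)}{\partial N}=(N,\nabla u(t,x\pm))$, $$\frac{1+q}2\frac{\partial u(t,x+)}{\partial N}-\frac{1-q}2\frac{\partial u(t,x-)}{\partial N}+(\alpha,\nabla u)=0 .$$ -/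

import Mathlib

open MeasureTheory ProbabilityTheory Filter Topology
open scoped NNReal BoundedContinuousFunction RealInnerProductSpace

noncomputable section

namespace Membrane

/-- The Euclidean space `ℝ^d`. -/
abbrev E (d : ℕ) : Type := EuclideanSpace ℝ (Fin d)

/-- The hyperplane `S = {x | (x, ν) = 0}` orthogonal to `ν`. -/
abbrev S {d : ℕ} (ν : E d) : Submodule ℝ (E d) := (ℝ ∙ ν)ᗮ

/-- The orthogonal projection `π_S` of `ℝ^d` onto `S`, with values in `S`. -/
def proj {d : ℕ} (ν : E d) : E d →ₗ[ℝ] S ν :=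
  ((S ν).orthogonalProjectionOnto : E d →L[ℝ] S ν)

/-- The conormal vector `N = Bν`. -/
def conormal {d : ℕ} (B : Matrix (Fin d) (Fin d) ℝ) (ν : E d) : E d :=
  B.toEuclideanLin ν

/-- `σ² = (Bν, ν)`. -/
def sigmaSq {d : ℕ} (B : Matrix (Fin d) (Fin d) ℝ) (ν : E d) : ℝ :=
  ⟪conormal B ν, ν⟫

/-- `b = π_S B ν`. -/
def tangentPart {d : ℕ} (B : Matrix (Fin d) (Fin d) ℝ) (ν : E d) : S ν :=
  proj ν (conormal B ν)

/-- `π_S B⁻¹ π_S` as an operator in `S`. -/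
def compressedInv {d : ℕ} (B : Matrix (Fin d) (Fin d) ℝ) (ν : E d) : Module.End ℝ (S ν) :=
  proj ν ∘ₗ B⁻¹.toEuclideanLin ∘ₗ (S ν).subtype

/-- `B_S = (π_S B⁻¹ π_S)⁻¹` as an operator in `S`. -/
def BS {d : ℕ} (B : Matrix (Fin d) (Fin d) ℝ) (ν : E d) : Module.End ℝ (S ν) :=
  Ring.inverse (compressedInv B ν)

/-- The Gaussian density `[det (2πtB_S)]^{-1/2} exp(-(B_S⁻¹ z, z) / (2t))` with
`z = y_S - x_S - ((y_ν - x_ν) / σ²) b`. The determinant is the one of an operator in `S`. -/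
def gS {d : ℕ} (B : Matrix (Fin d) (Fin d) ℝ) (ν : E d) (t : ℝ) (x y : E d) : ℝ :=
  let z : S ν :=
    proj ν y - proj ν x - ((⟪y, ν⟫ - ⟪x, ν⟫) / sigmaSq B ν) • tangentPart B ν
  (√(LinearMap.det ((2 * Real.pi * t) • BS B ν)))⁻¹ *
    Real.exp (-(1 / (2 * t)) * ⟪Ring.inverse (BS B ν) z, z⟫)

/-- The integrand of the `θ`-integral in the kernel `G`. -/
def passageIntegrand {d : ℕ} (B : Matrix (Fin d) (Fin d) ℝ) (ν : E d) (q : ℝ) (α : E d)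
    (t : ℝ) (x y : E d) (θ : ℝ) : ℝ :=
  (q * Real.sign ⟪y, ν⟫ + 1) *
    ((sigmaSq B ν * θ + |⟪x, ν⟫| + |⟪y, ν⟫|) / √(2 * Real.pi * t ^ 3 * sigmaSq B ν)) *
    Real.exp (-((sigmaSq B ν * θ + |⟪x, ν⟫| + |⟪y, ν⟫|) ^ 2 / (2 * t * sigmaSq B ν))) *
    gS B ν t (x + θ • α) y

/-- The kernel `G(t, x, y)`. -/
def G {d : ℕ} (B : Matrix (Fin d) (Fin d) ℝ) (ν : E d) (q : ℝ) (α : E d)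
    (t : ℝ) (x y : E d) : ℝ :=
  1 / √(2 * Real.pi * t * sigmaSq B ν) *
      (Real.exp (-((⟪y, ν⟫ - ⟪x, ν⟫) ^ 2 / (2 * t * sigmaSq B ν))) -
        Real.exp (-((|⟪y, ν⟫| + |⟪x, ν⟫|) ^ 2 / (2 * t * sigmaSq B ν)))) *
      gS B ν t x y +
    ∫ θ in Set.Ioi (0 : ℝ), passageIntegrand B ν q α t x y θ

/-- `u(t, x, φ) = ∫ φ(y) G(t, x, y) dy`. -/
def u {d : ℕ} (B : Matrix (Fin d) (Fin d) ℝ) (ν : E d) (q : ℝ) (α : E d)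
    (φ : E d →ᵇ ℝ) (t : ℝ) (x : E d) : ℝ :=
  ∫ y, φ y * G B ν q α t x y

/-- `p(t, x, y)`, `t > 0`, is a (time-homogeneous) transition probability density with respect
to Lebesgue measure. -/
structure IsTransitionDensity {d : ℕ} (p : ℝ → E d → E d → ℝ) : Prop where
  measurable : ∀ t, 0 < t → Measurable (Function.uncurry (p t))
  nonneg : ∀ t, 0 < t → ∀ x y, 0 ≤ p t x y
  integrable : ∀ t, 0 < t → ∀ x, Integrable (p t x)
  integral_eq_one : ∀ t, 0 < t → ∀ x, ∫ y, p t x y = 1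
  chapman_kolmogorov : ∀ s t, 0 < s → 0 < t → ∀ x, ∀ A : Set (E d), MeasurableSet A →
    ∫ z, p s x z * (∫ y in A, p t z y) = ∫ y in A, p (s + t) x y

/-- The `σ`-algebra generated by `X r`, `r ≤ s`. -/
abbrev past {d : ℕ} {Ω : Type} (X : ℝ≥0 → Ω → E d) (s : ℝ≥0) : MeasurableSpace Ω :=
  ⨆ r : ℝ≥0, ⨆ _ : r ≤ s, MeasurableSpace.comap (X r) inferInstance

/-- `(X, (P x)_x)` is a continuous Markov process in `ℝ^d` with transition probability density
`p`: under `P x` it starts from `x`, and given the past up to time `s` the law of `X (s + t)` has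
density `p t (X s)`. -/
structure IsContinuousMarkovProcess {d : ℕ} {Ω : Type} [MeasurableSpace Ω]
    (X : ℝ≥0 → Ω → E d) (P : Kernel (E d) Ω) (p : ℝ → E d → E d → ℝ) : Prop where
  isMarkovKernel : IsMarkovKernel P
  measurable : ∀ t, Measurable (X t)
  continuous_paths : ∀ ω, Continuous fun t => X t ω
  start : ∀ x, ∀ᵐ ω ∂(P x), X 0 ω = x
  markov : ∀ (x : E d) (s t : ℝ≥0), 0 < t → ∀ A : Set (E d), MeasurableSet A →
    (P x)[(X (s + t) ⁻¹' A).indicator (fun _ => (1 : ℝ)) | past X s]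
      =ᵐ[P x] fun ω => ∫ y in A, p t (X s ω) y

/-- The matrix `D²f` of second partial derivatives of `f` at `x`. -/
def hessian {d : ℕ} (f : E d → ℝ) (x : E d) : Matrix (Fin d) (Fin d) ℝ :=
  Matrix.of fun i j =>
    fderiv ℝ (fun z => fderiv ℝ f z (EuclideanSpace.single j 1)) x (EuclideanSpace.single i 1)

/-- `v(t, x)` solves the conjugation problem with initial data `φ`. -/
structure SolvesConjugationProblem {d : ℕ} (B : Matrix (Fin d) (Fin d) ℝ) (ν : E d) (q : ℝ)
    (α : E d) (φ : E d → ℝ) (v : ℝ → E d → ℝ) : Prop where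
  /-- The heat equation off `S`, in the classical sense. -/
  heat : ∀ t, 0 < t → ∀ x, x ∉ S ν → ContDiffAt ℝ 2 (v t) x ∧
    HasDerivAt (fun s => v s x) (1 / 2 * (B * hessian (v t) x).trace) t
  /-- The initial condition. -/
  initial : ∀ x, Tendsto (fun t => v t x) (𝓝[>] 0) (𝓝 (φ x))
  /-- The limits of `v t` at `x ∈ S` from both sides exist and agree (with the value there). -/
  continuity : ∀ t, 0 < t → ∀ x ∈ S ν,
    Tendsto (fun ε : ℝ => v t (x + ε • ν)) (𝓝[>] 0) (𝓝 (v t x)) ∧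
    Tendsto (fun ε : ℝ => v t (x - ε • ν)) (𝓝[>] 0) (𝓝 (v t x))
  /-- The one-sided limits `gp`, `gm` of the gradient at `x ∈ S` exist, their components along
  the tangent vector `α` agree with the derivative `a` of `v t` along `α` at `x`, and the oblique
  conjugation condition holds. -/
  conjugation : ∀ t, 0 < t → ∀ x ∈ S ν, ∃ (gp gm : E d) (a : ℝ),
    Tendsto (fun ε : ℝ => gradient (v t) (x + ε • ν)) (𝓝[>] 0) (𝓝 gp) ∧
    Tendsto (fun ε : ℝ => gradient (v t) (x - ε • ν)) (𝓝[>] 0) (𝓝 gm) ∧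
    HasLineDerivAt ℝ (v t) a x α ∧ ⟪α, gp⟫ = a ∧ ⟪α, gm⟫ = a ∧
    (1 + q) / 2 * ⟪conormal B ν, gp⟫ - (1 - q) / 2 * ⟪conormal B ν, gm⟫ + a = 0

end Membrane

end

/-! Put A = B⁻¹, so that AN = ν. The form (Av, v) is then the orthogonal sum of a normal part along
N and a part on S, hence the Gaussian density of covariance tB is a one-dimensional normal density
times g^S, and it is invariant under the reflection R along N with fixed space S. In these terms G
is the free density, minus its image, plus (q sign y_ν + 1) times the integral over θ > 0 of the
first passage density at X - Y + θβ. Here β = N + α, the points X and Y are x and y folded along N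
onto opposite sides of S, and the passage density is -∂_N of the Gaussian (`G_eq_kernel`). All
claims are proved for this `kernel`.

Mass. The weights of y and Ry add up to 2, and at fixed θ the drift θα is a tangential translation
of the half-space, so for the total mass α may be replaced by 0; there the θ-integral telescopes to
the image term, which cancels (`integral_kernel`).

Chapman–Kolmogorov. Let D be the half-space density with absorption and E = D + 2 `oblique` the one
with oblique reflection. On one side of S the kernel is D plus a weight times (E - D)/2; across S
only the second term is present. It therefore suffices that D and E are semigroups. For D this is
oddness under R. Differentiation of D in its second variable along β gives D', with E(x, z) the
integral of D'(x + θβ, z) over θ > 0 and ∂_β E = -D' in the first variable. Integration by parts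
along β, in which D kills the boundary term, gives D'E = DD', which is D' at time s + t; integrating
along the ray gives EE = E (`setIntegral_reflected_mul_reflected`, `integral_kernel_mul_kernel`).

Conjugation problem. On each closed half-space u coincides with a function that is C² everywhere, a
superposition of translates of Gaussians and passage densities, all of which solve the heat
equation. The other side is the same problem with ν, N, q replaced by their negatives (`flip`). On S
the θ-integral telescopes under ∂_β, so that ∂_{N+α}u(x+) = (1 - q)I and ∂_{-N+α}u(x-) = -(1 + q)I
with one common I; the convex combination with weights (1 ± q)/2 is the required condition
(`fderiv_halfSolution_beta`, `solution_conjugation`). The initial condition comes from Gaussian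
scaling.

Process. The kernel has a Gaussian upper bound, so fourth moments of increments are O(t²), and it is
jointly continuous in time and starting point after integration against bounded continuous
functions. Chains on the grids of step 2⁻ⁿ are coupled consistently through conditional laws,
Chebyshev and Borel–Cantelli make their increments geometrically small, and the limit path inherits
the Markov property (`exists_isContinuousMarkovProcess`). -/

noncomputable section

namespace Membrane

/-! ### Superpositions of translates of a Gaussian-dominated function -/

section Superposition

variable {d : ℕ}

lemma integrable_exp_neg_mul_sq_norm {ε : ℝ} (hε : 0 < ε) :
    Integrable fun v : E d => Real.exp (-ε * ‖v‖ ^ 2) := by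
  -- A non-integrable function has integral 0 by convention, while the closed form of this Gaussian
  -- integral is positive.
  by_contra h
  have h1 := integral_undef h
  rw [GaussianFourier.integral_rexp_neg_mul_sq_norm hε] at h1
  have : 0 < (Real.pi / ε) ^ ((Module.finrank ℝ (E d) : ℝ) / 2) := by positivity
  linarith

/-- From ‖ξ‖² / 2 ≤ ‖x - ξ‖² + R². Half of the decay rate is given up to obtain a bound in ξ alone,
uniform for x in a ball, as dominated convergence requires. -/
lemma exp_neg_mul_sq_norm_sub_le {ε R : ℝ} (hε : 0 < ε) {x ξ : E d} (hx : ‖x‖ ≤ R) :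
    Real.exp (-ε * ‖x - ξ‖ ^ 2) ≤ Real.exp (ε * R ^ 2) * Real.exp (-(ε / 2) * ‖ξ‖ ^ 2) := by
  rw [← Real.exp_add, Real.exp_le_exp]
  have h1 : ‖ξ‖ ≤ ‖x - ξ‖ + R := by
    have := norm_sub_norm_le ξ x
    rw [norm_sub_rev] at this
    linarith
  have h2 : ‖ξ‖ ^ 2 ≤ (‖x - ξ‖ + R) ^ 2 := pow_le_pow_left₀ (norm_nonneg _) h1 2
  nlinarith [sq_nonneg (‖x - ξ‖ - R)]

variable {Y V : Type*} [NormedAddCommGroup V] [NormedSpace ℝ V] {ξ : Y → E d} {w : Y → ℝ}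
  {C₀ C ε : ℝ}

lemma norm_superposition_le (hwb : ∀ η, |w η| ≤ C₀) (hε : 0 < ε) {p : E d → V}
    (hb : ∀ v, ‖p v‖ ≤ C * Real.exp (-ε * ‖v‖ ^ 2)) {R : ℝ} {x : E d} (hx : ‖x‖ ≤ R) (η : Y) :
    ‖w η • p (x - ξ η)‖ ≤
      C₀ * (C * Real.exp (ε * R ^ 2)) * Real.exp (-(ε / 2) * ‖ξ η‖ ^ 2) := by
  have hC : 0 ≤ C := by
    have := (norm_nonneg _).trans (hb 0)
    simpa using this
  have hC₀ : 0 ≤ C₀ := (abs_nonneg _).trans (hwb η)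
  rw [norm_smul, Real.norm_eq_abs, mul_assoc, mul_assoc]
  exact mul_le_mul (hwb η) ((hb _).trans
    (mul_le_mul_of_nonneg_left (exp_neg_mul_sq_norm_sub_le hε hx) hC)) (norm_nonneg _) hC₀

variable [MeasurableSpace Y] {μ : Measure Y}

lemma integrable_superposition (hξ : Measurable ξ) (hw : Measurable w) (hwb : ∀ η, |w η| ≤ C₀)
    (hint : ∀ ε > 0, Integrable (fun η => Real.exp (-ε * ‖ξ η‖ ^ 2)) μ) {p : E d → V}
    (hp : Continuous p) (hε : 0 < ε) (hb : ∀ v, ‖p v‖ ≤ C * Real.exp (-ε * ‖v‖ ^ 2)) (x : E d) :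
    Integrable (fun η => w η • p (x - ξ η)) μ :=
  ((hint (ε / 2) (by positivity)).const_mul _).mono'
    (hw.aestronglyMeasurable.smul
      (hp.comp_stronglyMeasurable (measurable_const.sub hξ).stronglyMeasurable).aestronglyMeasurable)
    (ae_of_all _ fun η => norm_superposition_le hwb hε hb le_rfl η)

lemma continuous_superposition (hξ : Measurable ξ) (hw : Measurable w) (hwb : ∀ η, |w η| ≤ C₀)
    (hint : ∀ ε > 0, Integrable (fun η => Real.exp (-ε * ‖ξ η‖ ^ 2)) μ) {p : E d → V}
    (hp : Continuous p) (hε : 0 < ε) (hb : ∀ v, ‖p v‖ ≤ C * Real.exp (-ε * ‖v‖ ^ 2)) :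
    Continuous fun x => ∫ η, w η • p (x - ξ η) ∂μ := by
  rw [continuous_iff_continuousAt]
  intro x₀
  refine continuousAt_of_dominated (bound := fun η =>
    C₀ * (C * Real.exp (ε * (‖x₀‖ + 1) ^ 2)) * Real.exp (-(ε / 2) * ‖ξ η‖ ^ 2)) ?_ ?_ ?_ ?_
  · exact Eventually.of_forall fun x =>
      (integrable_superposition hξ hw hwb hint hp hε hb x).aestronglyMeasurable
  · filter_upwards [Metric.ball_mem_nhds x₀ one_pos] with x hx
    refine ae_of_all _ fun η => norm_superposition_le hwb hε hb ?_ η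
    have := norm_sub_norm_le x x₀
    rw [Metric.mem_ball, dist_eq_norm] at hx
    linarith
  · exact (hint _ (by positivity)).const_mul _
  · exact ae_of_all _ fun η => by fun_prop

/-- Stated for an abstract shift ξ and weight w because three instances are needed: the shifts y,
`foldNeg y` and `foldNeg y - θβ`, the last over pairs (y, θ). Only integrability of Gaussians of ξ
enters. -/
lemma hasFDerivAt_superposition (hξ : Measurable ξ) (hw : Measurable w) (hwb : ∀ η, |w η| ≤ C₀)
    (hint : ∀ ε > 0, Integrable (fun η => Real.exp (-ε * ‖ξ η‖ ^ 2)) μ)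
    {p : E d → V} {p' : E d → E d →L[ℝ] V}
    (hp : ∀ v, HasFDerivAt p (p' v) v) (hp' : Continuous p') (hε : 0 < ε)
    (hb : ∀ v, ‖p v‖ ≤ C * Real.exp (-ε * ‖v‖ ^ 2))
    (hb' : ∀ v, ‖p' v‖ ≤ C * Real.exp (-ε * ‖v‖ ^ 2)) (x₀ : E d) :
    HasFDerivAt (fun x => ∫ η, w η • p (x - ξ η) ∂μ) (∫ η, w η • p' (x₀ - ξ η) ∂μ) x₀ := by
  have hpc : Continuous p := continuous_iff_continuousAt.2 fun v => (hp v).continuousAt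
  refine hasFDerivAt_integral_of_dominated_of_fderiv_le (s := Metric.ball x₀ 1)
    (bound := fun η => C₀ * (C * Real.exp (ε * (‖x₀‖ + 1) ^ 2)) * Real.exp (-(ε / 2) * ‖ξ η‖ ^ 2))
    (F' := fun x η => w η • p' (x - ξ η)) (Metric.ball_mem_nhds x₀ one_pos) ?_ ?_ ?_ ?_ ?_ ?_
  · exact Eventually.of_forall fun x =>
      (integrable_superposition hξ hw hwb hint hpc hε hb x).aestronglyMeasurable
  · exact integrable_superposition hξ hw hwb hint hpc hε hb x₀
  · exact (integrable_superposition hξ hw hwb hint hp' hε hb' x₀).aestronglyMeasurable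
  · refine ae_of_all _ fun η x hx => norm_superposition_le hwb hε hb' ?_ η
    have := norm_sub_norm_le x x₀
    rw [Metric.mem_ball, dist_eq_norm] at hx
    linarith
  · exact (hint _ (by positivity)).const_mul _
  · refine ae_of_all _ fun η x _ => ?_
    exact ((hp (x - ξ η)).comp x ((hasFDerivAt_id x).sub_const (ξ η))).const_smul (w η)

end Superposition

/-! ### The Gaussian kernel -/

/-- The data of the problem in terms of the inverse diffusion operator `A`, the normal `ν`, the
conormal `N = A⁻¹ ν`, the tangent vector `α` and the asymmetry parameter `q`. -/
structure Setup (d : ℕ) where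
  A : E d →L[ℝ] E d
  symm : ∀ x y, ⟪A x, y⟫ = ⟪x, A y⟫
  lam : ℝ
  lam_pos : 0 < lam
  coercive : ∀ v, lam * ‖v‖ ^ 2 ≤ ⟪A v, v⟫
  ν : E d
  N : E d
  A_N : A N = ν
  sig_pos : 0 < ⟪N, ν⟫
  α : E d
  α_tangent : ⟪α, ν⟫ = 0
  q : ℝ
  abs_q_le : |q| ≤ 1

namespace Setup

variable {d : ℕ} (M : Setup d)

/-- The quadratic form of `A`. -/
def quad (v : E d) : ℝ := ⟪M.A v, v⟫

/-- The variance `σ²` in the normal direction. -/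
def sig : ℝ := ⟪M.N, M.ν⟫

/-- The normalizing constant of the Gaussian density. -/
def gaussConst : ℝ := (∫ v : E d, Real.exp (-(M.quad v / 2)))⁻¹

/-- The Gaussian density with covariance operator `t A⁻¹`. -/
def gauss (t : ℝ) (v : E d) : ℝ :=
  M.gaussConst * (√t ^ d)⁻¹ * Real.exp (-(M.quad v / (2 * t)))

/-- The derivative of the Gaussian density along `w`. -/
def gaussDeriv (t : ℝ) (w v : E d) : ℝ := -(⟪M.A v, w⟫ / t) * M.gauss t v

/-- The first passage density weighted with the tangential Gaussian density. -/
def passage (t : ℝ) (v : E d) : ℝ := ⟪v, M.ν⟫ / t * M.gauss t v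

lemma sig_pos' : 0 < M.sig := M.sig_pos

lemma quad_nonneg (v : E d) : 0 ≤ M.quad v :=
  (mul_nonneg M.lam_pos.le (sq_nonneg _)).trans (M.coercive v)

lemma inner_A_N (v : E d) : ⟪M.A v, M.N⟫ = ⟪v, M.ν⟫ := by rw [M.symm, M.A_N]

lemma quad_add (v w : E d) : M.quad (v + w) = M.quad v + 2 * ⟪M.A v, w⟫ + M.quad w := by
  simp only [quad, map_add, inner_add_left, inner_add_right]
  have : ⟪M.A w, v⟫ = ⟪M.A v, w⟫ := by rw [M.symm, real_inner_comm]
  rw [this]; ring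

lemma quad_smul (c : ℝ) (v : E d) : M.quad (c • v) = c ^ 2 * M.quad v := by
  simp only [quad, map_smul, real_inner_smul_left, real_inner_smul_right]; ring

lemma quad_neg (v : E d) : M.quad (-v) = M.quad v := by simp [quad]

@[fun_prop]
lemma continuous_quad : Continuous M.quad := by unfold quad; fun_prop

lemma integrable_exp_quad {c : ℝ} (hc : 0 < c) :
    Integrable fun v : E d => Real.exp (-(M.quad v / c)) := by
  refine (integrable_exp_neg_mul_sq_norm (d := d) (ε := M.lam / c)
    (div_pos M.lam_pos hc)).mono' (by fun_prop) (ae_of_all _ fun v => ?_)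
  rw [Real.norm_eq_abs, Real.abs_exp, Real.exp_le_exp, neg_mul, neg_le_neg_iff, div_mul_eq_mul_div]
  exact div_le_div_of_nonneg_right (M.coercive v) hc.le

lemma integral_exp_quad_pos : 0 < ∫ v : E d, Real.exp (-(M.quad v / 2)) :=
  integral_exp_pos (M.integrable_exp_quad two_pos)

lemma gaussConst_pos : 0 < M.gaussConst := inv_pos.2 M.integral_exp_quad_pos

lemma gauss_pos {t : ℝ} (ht : 0 < t) (v : E d) : 0 < M.gauss t v := by
  have := M.gaussConst_pos
  unfold gauss; positivity

lemma gauss_neg (t : ℝ) (v : E d) : M.gauss t (-v) = M.gauss t v := by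
  simp only [gauss, quad_neg]

lemma gauss_sub_comm (t : ℝ) (v w : E d) : M.gauss t (v - w) = M.gauss t (w - v) := by
  rw [← gauss_neg, neg_sub]

@[fun_prop]
lemma continuous_gauss (t : ℝ) : Continuous (M.gauss t) := by unfold gauss; fun_prop

/-- Substitution v = √t w. As the constant is defined by the integral at t = 1, the total mass is 1
without any determinant; the determinant is computed only when the kernel is compared with `G`. -/
lemma integral_exp_quad {t : ℝ} (ht : 0 < t) :
    ∫ v : E d, Real.exp (-(M.quad v / (2 * t))) = √t ^ d * M.gaussConst⁻¹ := by
  have h := Measure.integral_comp_smul (volume : Measure (E d))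
    (fun v => Real.exp (-(M.quad v / 2))) (√t)⁻¹
  have ht' : 0 < √t := Real.sqrt_pos.2 ht
  have e : ∀ v, Real.exp (-(M.quad ((√t)⁻¹ • v) / 2)) = Real.exp (-(M.quad v / (2 * t))) := by
    intro v
    rw [quad_smul, inv_pow, Real.sq_sqrt ht.le]
    congr 2; field_simp
  simp only [e] at h
  rw [h, finrank_euclideanSpace_fin, gaussConst, inv_inv, smul_eq_mul, inv_pow, inv_inv,
    abs_of_pos (by positivity)]

lemma integrable_gauss {t : ℝ} (ht : 0 < t) : Integrable (M.gauss t) :=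
  (M.integrable_exp_quad (by positivity)).const_mul _

lemma integral_gauss {t : ℝ} (ht : 0 < t) : ∫ v, M.gauss t v = 1 := by
  unfold gauss
  rw [integral_const_mul, M.integral_exp_quad ht]
  have := M.gaussConst_pos
  have ht' : 0 < √t := Real.sqrt_pos.2 ht
  field_simp

/-- Completing the square: the second factor is the bridge density, with variance parameter st/(s +
t) and mean t/(s + t) · v. Integrating it out gives the semigroup property. -/
lemma gauss_mul_gauss {s t : ℝ} (hs : 0 < s) (ht : 0 < t) (v z : E d) :
    M.gauss s (v - z) * M.gauss t z =
      M.gauss (s + t) v * M.gauss (s * t / (s + t)) (z - (t / (s + t)) • v) := by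
  have hst : 0 < s + t := by positivity
  have h1 : √s * √t = √(s + t) * √(s * t / (s + t)) := by
    rw [← Real.sqrt_mul hs.le, ← Real.sqrt_mul hst.le]; congr 1; field_simp
  have h2 : M.quad (v - z) / (2 * s) + M.quad z / (2 * t) = M.quad v / (2 * (s + t)) +
      M.quad (z - (t / (s + t)) • v) / (2 * (s * t / (s + t))) := by
    rw [sub_eq_add_neg v, quad_add, sub_eq_add_neg z, quad_add, quad_neg, ← neg_smul, quad_smul]
    have : ⟪M.A z, v⟫ = ⟪M.A v, z⟫ := by rw [M.symm, real_inner_comm]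
    simp only [inner_neg_right, real_inner_smul_right, this]
    field_simp
    ring
  have h3 := congrArg (fun x => (x ^ d)⁻¹) h1
  simp only [mul_pow, mul_inv] at h3
  unfold gauss
  calc _ = M.gaussConst * M.gaussConst * ((√s ^ d)⁻¹ * (√t ^ d)⁻¹) *
        (Real.exp (-(M.quad (v - z) / (2 * s))) * Real.exp (-(M.quad z / (2 * t)))) := by ring
    _ = M.gaussConst * M.gaussConst * ((√(s + t) ^ d)⁻¹ * (√(s * t / (s + t)) ^ d)⁻¹) *
        (Real.exp (-(M.quad v / (2 * (s + t)))) *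
          Real.exp (-(M.quad (z - (t / (s + t)) • v) / (2 * (s * t / (s + t)))))) := by
        rw [h3, ← Real.exp_add, ← Real.exp_add, ← neg_add, ← neg_add, h2]
    _ = _ := by ring

lemma integrable_gauss_mul_gauss {s t : ℝ} (hs : 0 < s) (ht : 0 < t) (x y : E d) :
    Integrable fun z => M.gauss s (x - z) * M.gauss t (z - y) := by
  have h : ∀ z, M.gauss s (x - z) * M.gauss t (z - y) = M.gauss (s + t) (x - y) *
      M.gauss (s * t / (s + t)) (z - (y + (t / (s + t)) • (x - y))) := by
    intro z
    have := M.gauss_mul_gauss hs ht (x - y) (z - y)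
    rwa [sub_sub_sub_cancel_right, sub_sub] at this
  simp only [h]
  exact ((M.integrable_gauss (by positivity)).comp_sub_right _).const_mul _

/-- The semigroup property of the Gaussian densities. -/
lemma integral_gauss_mul_gauss {s t : ℝ} (hs : 0 < s) (ht : 0 < t) (x y : E d) :
    ∫ z, M.gauss s (x - z) * M.gauss t (z - y) = M.gauss (s + t) (x - y) := by
  have h : ∀ z, M.gauss s (x - z) * M.gauss t (z - y) = M.gauss (s + t) (x - y) *
      M.gauss (s * t / (s + t)) (z - (y + (t / (s + t)) • (x - y))) := by
    intro z
    have := M.gauss_mul_gauss hs ht (x - y) (z - y)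
    rwa [sub_sub_sub_cancel_right, sub_sub] at this
  simp only [h]
  rw [integral_const_mul, integral_sub_right_eq_self (M.gauss (s * t / (s + t))),
    M.integral_gauss (by positivity), mul_one]

lemma hasFDerivAt_quad (v : E d) : HasFDerivAt M.quad ((2 : ℝ) • innerSL ℝ (M.A v)) v := by
  have h := (M.A.hasFDerivAt (x := v)).inner ℝ (hasFDerivAt_id v)
  refine h.congr_fderiv ?_
  ext w
  simp only [ContinuousLinearMap.comp_apply, ContinuousLinearMap.prod_apply, fderivInnerCLM_apply,
    _root_.smul_apply, innerSL_apply_apply, smul_eq_mul, id, ContinuousLinearMap.id_apply]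
  have : ⟪M.A w, v⟫ = ⟪M.A v, w⟫ := by rw [M.symm, real_inner_comm]
  rw [this]; ring

lemma hasFDerivAt_gauss (t : ℝ) (v : E d) :
    HasFDerivAt (M.gauss t) (-(M.gauss t v / t) • innerSL ℝ (M.A v)) v := by
  have h := (((M.hasFDerivAt_quad v).mul_const (2 * t)⁻¹).neg.exp).const_mul
    (M.gaussConst * (√t ^ d)⁻¹)
  refine (h.congr_fderiv ?_).congr_of_eventuallyEq ?_
  · ext w
    simp only [gauss, _root_.smul_apply, _root_.neg_apply, Pi.neg_apply,
      innerSL_apply_apply, smul_eq_mul, div_eq_mul_inv, mul_inv]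
    ring
  · exact Eventually.of_forall fun z => by simp only [gauss, div_eq_mul_inv, Pi.neg_apply]

/-- The derivative of the Gaussian density along a line. -/
lemma hasDerivAt_gauss_line (t : ℝ) (v w : E d) (τ : ℝ) :
    HasDerivAt (fun τ : ℝ => M.gauss t (v + τ • w)) (M.gaussDeriv t w (v + τ • w)) τ := by
  have h := (M.hasFDerivAt_gauss t (v + τ • w)).comp_hasDerivAt τ
    (((hasDerivAt_id τ).smul_const w).const_add v)
  refine h.congr_deriv ?_
  simp only [gaussDeriv, one_smul, _root_.smul_apply, innerSL_apply_apply, smul_eq_mul]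
  ring

/-- Because AN = ν, the factor v_ν / t is exactly the logarithmic derivative along N up to sign.
This is what makes integrals of the passage density along N telescope. -/
lemma passage_eq_neg_gaussDeriv (t : ℝ) (v : E d) : M.passage t v = -M.gaussDeriv t M.N v := by
  simp [passage, gaussDeriv, inner_A_N]

end Setup

/-! ### Polynomials times Gaussians: derivatives, bounds and the heat equation -/

lemma one_add_pow_mul_exp_neg_le (k : ℕ) {ε r : ℝ} (hε : 0 < ε) (hr : 0 ≤ r) :
    (1 + r) ^ k * Real.exp (-ε * r ^ 2) ≤
      Real.exp (k ^ 2 / (2 * ε)) * Real.exp (-(ε / 2) * r ^ 2) := by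
  have h1 : (1 + r) ^ k ≤ Real.exp (k * r) := by
    rw [Real.exp_nat_mul]
    exact pow_le_pow_left₀ (by positivity) (by linarith [Real.add_one_le_exp r]) k
  refine (mul_le_mul_of_nonneg_right h1 (Real.exp_nonneg _)).trans ?_
  rw [← Real.exp_add, ← Real.exp_add, Real.exp_le_exp]
  -- Half of the quadratic decay absorbs the linear exponent k r coming from (1 + r)^k ≤ exp(k r).
  have h2 : k ^ 2 / (2 * ε) + ε / 2 * r ^ 2 - k * r = (k - ε * r) ^ 2 / (2 * ε) := by
    field_simp; ring
  have h3 : 0 ≤ (k - ε * r) ^ 2 / (2 * ε) := by positivity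
  linarith

lemma toEuclideanLin_coord {d : ℕ} (B : Matrix (Fin d) (Fin d) ℝ) (x : E d) (i : Fin d) :
    B.toEuclideanLin x i = ∑ j, B i j * x j := rfl

namespace Setup

variable {d : ℕ} (M : Setup d)

lemma gauss_le {t : ℝ} (ht : 0 < t) (v : E d) :
    M.gauss t v ≤ M.gaussConst * (√t ^ d)⁻¹ * Real.exp (-(M.lam / (2 * t)) * ‖v‖ ^ 2) := by
  have := M.gaussConst_pos
  refine mul_le_mul_of_nonneg_left ?_ (by positivity)
  rw [Real.exp_le_exp, neg_mul, neg_le_neg_iff, div_mul_eq_mul_div]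
  exact div_le_div_of_nonneg_right (M.coercive v) (by positivity)

/-- A Gaussian bound for polynomials times the Gaussian density, uniform in time on compacts. -/
lemma exists_pow_mul_gauss_le (k : ℕ) {t₁ t₂ : ℝ} (h₁ : 0 < t₁) (h₂ : 0 < t₂) :
    ∃ C > 0, ∃ ε > 0, ∀ t, t₁ ≤ t → t ≤ t₂ → ∀ v : E d,
      (1 + ‖v‖) ^ k * M.gauss t v ≤ C * Real.exp (-ε * ‖v‖ ^ 2) := by
  have hκ := M.gaussConst_pos
  have hl := M.lam_pos
  set ε₀ := M.lam / (2 * t₂) with hε₀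
  have hε₀' : 0 < ε₀ := by positivity
  have ht₁ : 0 < √t₁ := Real.sqrt_pos.2 h₁
  refine ⟨M.gaussConst * (√t₁ ^ d)⁻¹ * Real.exp (k ^ 2 / (2 * ε₀)), by positivity, ε₀ / 2,
    by positivity, fun t h1 h2 v => ?_⟩
  have ht : 0 < t := h₁.trans_le h1
  have h3 : M.gauss t v ≤ M.gaussConst * (√t₁ ^ d)⁻¹ * Real.exp (-ε₀ * ‖v‖ ^ 2) := by
    refine (M.gauss_le ht v).trans ?_
    have e1 : (√t ^ d)⁻¹ ≤ (√t₁ ^ d)⁻¹ :=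
      inv_anti₀ (by positivity) (pow_le_pow_left₀ ht₁.le (Real.sqrt_le_sqrt h1) d)
    have e2 : ε₀ ≤ M.lam / (2 * t) := by rw [hε₀]; gcongr
    gcongr
  calc (1 + ‖v‖) ^ k * M.gauss t v
      ≤ (1 + ‖v‖) ^ k * (M.gaussConst * (√t₁ ^ d)⁻¹ * Real.exp (-ε₀ * ‖v‖ ^ 2)) := by gcongr
    _ = M.gaussConst * (√t₁ ^ d)⁻¹ * ((1 + ‖v‖) ^ k * Real.exp (-ε₀ * ‖v‖ ^ 2)) := by ring
    _ ≤ M.gaussConst * (√t₁ ^ d)⁻¹ *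
        (Real.exp (k ^ 2 / (2 * ε₀)) * Real.exp (-(ε₀ / 2) * ‖v‖ ^ 2)) := by
        exact mul_le_mul_of_nonneg_left (one_add_pow_mul_exp_neg_le k hε₀' (norm_nonneg v))
          (by positivity)
    _ = _ := by ring

/-- The combination `a Γ + b Λ` of the Gaussian density and the passage density. -/
def mix (a b t : ℝ) (v : E d) : ℝ := (a + b * ⟪v, M.ν⟫ / t) * M.gauss t v

/-- The polynomial prefactor of the derivative of `mix` along `w`. -/
def mixPoly (a b t : ℝ) (w v : E d) : ℝ :=
  b / t * ⟪M.ν, w⟫ - (a + b * ⟪v, M.ν⟫ / t) / t * ⟪M.A v, w⟫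

/-- The derivative of `mix`. -/
def mixD (a b t : ℝ) (v : E d) : E d →L[ℝ] ℝ :=
  M.gauss t v • ((b / t) • innerSL ℝ M.ν - ((a + b * ⟪v, M.ν⟫ / t) / t) • innerSL ℝ (M.A v))

/-- The derivative of `mixD · w`. -/
def mixDD (a b t : ℝ) (w v : E d) : E d →L[ℝ] ℝ :=
  M.gauss t v • (-(b / t ^ 2 * ⟪M.A v, w⟫) • innerSL ℝ M.ν -
    ((a + b * ⟪v, M.ν⟫ / t) / t) • innerSL ℝ (M.A w) -
    (M.mixPoly a b t w v / t) • innerSL ℝ (M.A v))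

/-- The time derivative of `mix`. -/
def mixT (a b t : ℝ) (v : E d) : ℝ :=
  (-(b * ⟪v, M.ν⟫ / t ^ 2) +
    (a + b * ⟪v, M.ν⟫ / t) * (M.quad v / (2 * t ^ 2) - d / (2 * t))) * M.gauss t v

variable (a b : ℝ)

/-- The parameters (1, 0) and (0, 1) are the only ones used later; `mix` lets the Gaussian and the
passage density share their derivative formulas and bounds. -/
lemma mix_one_zero (t : ℝ) : M.mix 1 0 t = M.gauss t := by ext v; simp [mix]

lemma mix_zero_one (t : ℝ) : M.mix 0 1 t = M.passage t := by ext v; simp [mix, passage]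

lemma mixD_apply (t : ℝ) (v w : E d) :
    M.mixD a b t v w = M.mixPoly a b t w v * M.gauss t v := by
  simp [mixD, mixPoly]; ring

@[fun_prop]
lemma continuous_mix (t : ℝ) : Continuous (M.mix a b t) := by unfold mix; fun_prop

@[fun_prop]
lemma continuous_mixPoly (t : ℝ) (w : E d) : Continuous (M.mixPoly a b t w) := by
  unfold mixPoly; fun_prop

@[fun_prop]
lemma continuous_mixD (t : ℝ) : Continuous (M.mixD a b t) := by unfold mixD; fun_prop

@[fun_prop]
lemma continuous_mixDD (t : ℝ) (w : E d) : Continuous (M.mixDD a b t w) := by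
  unfold mixDD; fun_prop

@[fun_prop]
lemma continuous_mixT (t : ℝ) : Continuous (M.mixT a b t) := by unfold mixT; fun_prop

@[fun_prop]
lemma continuous_passage (t : ℝ) : Continuous (M.passage t) := by unfold passage; fun_prop

/-- The Gaussian has logarithmic derivative -Av/t, so differentiation preserves the shape
"polynomial times Gaussian". -/
lemma hasFDerivAt_mul_gauss (t : ℝ) {f : E d → ℝ} {f' : E d →L[ℝ] ℝ} {v : E d}
    (hf : HasFDerivAt f f' v) : HasFDerivAt (fun z => f z * M.gauss t z)
      (M.gauss t v • (f' - (f v / t) • innerSL ℝ (M.A v))) v := by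
  refine (hf.mul (M.hasFDerivAt_gauss t v)).congr_fderiv ?_
  ext w
  simp only [_root_.smul_apply, _root_.sub_apply, _root_.add_apply, innerSL_apply_apply, smul_eq_mul]
  ring

lemma hasFDerivAt_prefactor (t : ℝ) (v : E d) :
    HasFDerivAt (fun z : E d => a + b * ⟪z, M.ν⟫ / t) ((b / t) • innerSL ℝ M.ν) v := by
  have h := ((((innerSL ℝ M.ν).hasFDerivAt (x := v)).const_mul (b / t)).const_add a)
  refine h.congr_of_eventuallyEq (Eventually.of_forall fun z => ?_)
  simp only [innerSL_apply_apply, real_inner_comm z]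
  ring

lemma hasFDerivAt_mix (t : ℝ) (v : E d) : HasFDerivAt (M.mix a b t) (M.mixD a b t v) v :=
  M.hasFDerivAt_mul_gauss t (M.hasFDerivAt_prefactor a b t v)

lemma hasFDerivAt_mixD_apply (t : ℝ) (w v : E d) :
    HasFDerivAt (fun z => M.mixD a b t z w) (M.mixDD a b t w v) v := by
  have h1 : HasFDerivAt (fun z => ⟪M.A z, w⟫) (innerSL ℝ (M.A w)) v := by
    refine ((innerSL ℝ (M.A w)).hasFDerivAt (x := v)).congr_of_eventuallyEq
      (Eventually.of_forall fun z => ?_)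
    change ⟪M.A z, w⟫ = ⟪M.A w, z⟫
    rw [M.symm z, real_inner_comm]
  have h2 : HasFDerivAt (M.mixPoly a b t w) (-(b / t ^ 2 * ⟪M.A v, w⟫) • innerSL ℝ M.ν -
      ((a + b * ⟪v, M.ν⟫ / t) / t) • innerSL ℝ (M.A w)) v := by
    have h := (((M.hasFDerivAt_prefactor a b t v).mul_const t⁻¹).mul h1).const_sub
      (b / t * ⟪M.ν, w⟫)
    refine (h.congr_fderiv ?_).congr_of_eventuallyEq (Eventually.of_forall fun z => ?_)
    · ext u
      simp only [_root_.smul_apply, _root_.sub_apply, _root_.add_apply, _root_.neg_apply,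
        innerSL_apply_apply, smul_eq_mul]
      ring
    · simp only [mixPoly, Pi.mul_apply, div_eq_mul_inv]
  have h3 := M.hasFDerivAt_mul_gauss t h2
  simp only [mixD_apply]
  exact h3

lemma hasDerivAt_mix_time {t : ℝ} (ht : 0 < t) (v : E d) :
    HasDerivAt (fun s => M.mix a b s v) (M.mixT a b t v) t := by
  have ht' : √t ≠ 0 := (Real.sqrt_pos.2 ht).ne'
  have h1 : HasDerivAt (fun s : ℝ => a + b * ⟪v, M.ν⟫ / s) (-(b * ⟪v, M.ν⟫ / t ^ 2)) t := by
    have := ((hasDerivAt_inv ht.ne').const_mul (b * ⟪v, M.ν⟫)).const_add a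
    refine this.congr_deriv ?_
    field_simp
  have h2 : HasDerivAt (fun s : ℝ => (√s ^ d)⁻¹) (-(d / (2 * t)) * (√t ^ d)⁻¹) t := by
    have := ((Real.hasDerivAt_sqrt ht.ne').pow d).inv (pow_ne_zero d ht')
    refine this.congr_deriv ?_
    -- The exponent d - 1 in the power rule is truncated at d = 0, hence the separate case.
    rcases d with _ | n
    · simp
    · have : t = √t ^ 2 := (Real.sq_sqrt ht.le).symm
      simp only [Nat.add_sub_cancel, Pi.pow_apply]
      rw [show (2 : ℝ) * t = 2 * √t ^ 2 by rw [← this]]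
      field_simp
      ring
  have h3 : HasDerivAt (fun s : ℝ => Real.exp (-(M.quad v / (2 * s))))
      (Real.exp (-(M.quad v / (2 * t))) * (M.quad v / (2 * t ^ 2))) t := by
    have := ((hasDerivAt_inv ht.ne').const_mul (M.quad v / 2)).neg.exp
    refine (this.congr_deriv ?_).congr_of_eventuallyEq (Eventually.of_forall fun s => ?_)
    · simp only [Pi.neg_apply]
      congr 1
      · congr 1; field_simp
      · field_simp
    · simp only [Pi.neg_apply]
      congr 1; rw [mul_comm 2 s, ← div_div, div_right_comm, div_eq_mul_inv (M.quad v / 2)]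
  have h4 := h1.mul ((h2.const_mul M.gaussConst).mul h3)
  refine h4.congr_deriv ?_
  simp only [mixT, gauss, Pi.mul_apply]
  ring

/-- The heat equation for `mix`. -/
lemma trace_mixDD (B : Matrix (Fin d) (Fin d) ℝ) (hBA : ∀ v, B.toEuclideanLin (M.A v) = v)
    {t : ℝ} (ht : 0 < t) (v : E d) :
    1 / 2 * ∑ i, ∑ j, B i j * M.mixDD a b t (EuclideanSpace.single i 1) v
      (EuclideanSpace.single j 1) = M.mixT a b t v := by
  have hN : B.toEuclideanLin M.ν = M.N := by rw [← M.A_N, hBA]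
  -- Contracting B with a rank-one matrix gives an inner product. The second derivative of `mix`
  -- consists of the pairs (Av, ν), (ν, Av), (Av, Av) and of the matrix A itself.
  have key : ∀ x y : E d, ∑ i, ∑ j, B i j * (y i * x j) = ⟪y, B.toEuclideanLin x⟫ := by
    intro x y
    rw [PiLp.inner_apply]
    refine Finset.sum_congr rfl fun i _ => ?_
    rw [toEuclideanLin_coord]
    simp only [RCLike.inner_apply, conj_trivial]
    rw [Finset.sum_mul]
    exact Finset.sum_congr rfl fun j _ => by ring
  -- The trace of BA is d; this produces the term d/(2t) of the time derivative.
  have htr : ∑ i, ∑ j, B i j * M.A (EuclideanSpace.single i 1) j = d := by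
    have : ∀ i, ∑ j, B i j * M.A (EuclideanSpace.single i 1) j = 1 := by
      intro i
      have h := congrArg (fun z : E d => z i) (hBA (EuclideanSpace.single i 1))
      simpa [toEuclideanLin_coord] using h
    simp [this]
  have e1 := key M.ν (M.A v)
  have e2 := key (M.A v) M.ν
  have e3 := key (M.A v) (M.A v)
  rw [hN, inner_A_N] at e1
  rw [hBA] at e2 e3
  rw [real_inner_comm] at e2
  have expand : ∀ i j, B i j * M.mixDD a b t (EuclideanSpace.single i 1) v
      (EuclideanSpace.single j 1) = M.gauss t v * (-(b / t ^ 2) * (B i j * (M.A v i * M.ν j)) -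
        (a + b * ⟪v, M.ν⟫ / t) / t * (B i j * M.A (EuclideanSpace.single i 1) j) -
        b / t ^ 2 * (B i j * (M.ν i * M.A v j)) +
        (a + b * ⟪v, M.ν⟫ / t) / t ^ 2 * (B i j * (M.A v i * M.A v j))) := by
    intro i j
    simp only [mixDD, mixPoly, _root_.smul_apply, _root_.sub_apply, innerSL_apply_apply, smul_eq_mul,
      EuclideanSpace.inner_single_right, conj_trivial, one_mul]
    field_simp
    ring
  simp only [expand, ← Finset.mul_sum, Finset.sum_add_distrib, Finset.sum_sub_distrib]
  rw [e1, e2, e3, htr, mixT]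
  change 1 / 2 * (M.gauss t v * (_ - _ - _ + _ * M.quad v)) = _
  field_simp
  ring

lemma norm_inner_nu_le (v : E d) : |⟪v, M.ν⟫| ≤ ‖M.ν‖ * ‖v‖ :=
  (abs_real_inner_le_norm _ _).trans_eq (mul_comm _ _)

set_option maxHeartbeats 1000000 in
/-- Gaussian bounds for `mix` and its derivatives, uniform in time on compacts. -/
lemma exists_mix_bounds {t₁ t₂ : ℝ} (h₁ : 0 < t₁) (h₂ : 0 < t₂) (w : E d) :
    ∃ C > 0, ∃ ε > 0, ∀ t, t₁ ≤ t → t ≤ t₂ → ∀ v : E d,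
      ‖M.mix a b t v‖ ≤ C * Real.exp (-ε * ‖v‖ ^ 2) ∧
      ‖M.mixD a b t v‖ ≤ C * Real.exp (-ε * ‖v‖ ^ 2) ∧
      ‖M.mixD a b t v w‖ ≤ C * Real.exp (-ε * ‖v‖ ^ 2) ∧
      ‖M.mixDD a b t w v‖ ≤ C * Real.exp (-ε * ‖v‖ ^ 2) ∧
      ‖M.mixT a b t v‖ ≤ C * Real.exp (-ε * ‖v‖ ^ 2) := by
  -- Degree 3 suffices: the second space derivative multiplies a quadratic `mixPoly` by Av, and the
  -- time derivative multiplies an affine factor by the quadratic form.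
  obtain ⟨C, hC, ε, hε, h⟩ := M.exists_pow_mul_gauss_le 3 h₁ h₂
  set T := t₁⁻¹ with hT
  have hTp : 0 < T := by positivity
  set n := ‖M.ν‖
  set m := ‖M.A‖
  -- With r = 1 + ‖v‖ and 1/t ≤ T, the polynomial prefactors are at most c r, K₁ r², K₁‖w‖ r², K₂ r³
  -- and K₃ r³ respectively; K exceeds all these constants, and the final 1 makes it positive.
  set c := |a| + |b| * n * T with hc
  have hn : 0 ≤ n := norm_nonneg _
  have hm : 0 ≤ m := norm_nonneg _
  have hcp : 0 ≤ c := by positivity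
  set K₁ := |b| * T * n + c * T * m
  set K₂ := |b| * T ^ 2 * (m * ‖w‖) * n + c * T * (m * ‖w‖) + K₁ * ‖w‖ * T * m
  set K₃ := |b| * n * T ^ 2 + c * (m * T ^ 2 + d * T)
  set K := c + K₁ + K₁ * ‖w‖ + K₂ + K₃ + 1
  have p1 : 0 ≤ K₁ := by positivity
  have p2 : 0 ≤ K₂ := by positivity
  have p3 : 0 ≤ K₃ := by positivity
  have p4 : 0 ≤ K₁ * ‖w‖ := by positivity
  refine ⟨K * C, by positivity, ε, hε, fun t ht1 ht2 v => ?_⟩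
  have ht : 0 < t := h₁.trans_le ht1
  have hg := (M.gauss_pos ht v).le
  have hti : t⁻¹ ≤ T := inv_anti₀ h₁ ht1
  have hti0 : 0 ≤ t⁻¹ := by positivity
  set r := 1 + ‖v‖ with hr
  have hr1 : 1 ≤ r := by rw [hr]; linarith [norm_nonneg v]
  have hvr : ‖v‖ ≤ r := by rw [hr]; linarith
  have hr12 : r ≤ r ^ 2 := by nlinarith
  have hr23 : r ^ 2 ≤ r ^ 3 := by nlinarith [sq_nonneg r]
  have hr0 : 0 ≤ r := by linarith
  have hAv : ‖M.A v‖ ≤ m * r := (M.A.le_opNorm v).trans (by gcongr)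
  have hν : |⟪v, M.ν⟫| ≤ n * r := (M.norm_inner_nu_le v).trans (by gcongr)
  have hpre : |a + b * ⟪v, M.ν⟫ / t| ≤ c * r := by
    calc |a + b * ⟪v, M.ν⟫ / t| ≤ |a| + |b| * |⟪v, M.ν⟫| * t⁻¹ := by
          refine (abs_add_le _ _).trans_eq ?_
          rw [abs_div, abs_mul, abs_of_pos ht, div_eq_mul_inv]
      _ ≤ |a| * r + |b| * (n * r) * T := by
          gcongr
          exact le_mul_of_one_le_right (abs_nonneg a) hr1
      _ = c * r := by rw [hc]; ring
  have hpre' : |(a + b * ⟪v, M.ν⟫ / t) / t| ≤ c * T * r := by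
    rw [abs_div, abs_of_pos ht, div_eq_mul_inv]
    calc _ ≤ (c * r) * T := by gcongr
      _ = _ := by ring
  have hbt : |b / t| ≤ |b| * T := by
    rw [abs_div, abs_of_pos ht, div_eq_mul_inv]; gcongr
  have hAvw : |⟪M.A v, w⟫| ≤ m * ‖w‖ * r :=
    (abs_real_inner_le_norm _ _).trans (by
      calc _ ≤ m * r * ‖w‖ := by gcongr
        _ = _ := by ring)
  have close : ∀ X κ : ℝ, 0 ≤ κ → κ ≤ K → X ≤ κ * r ^ 3 * M.gauss t v →
      X ≤ K * C * Real.exp (-ε * ‖v‖ ^ 2) := by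
    intro X κ h0 h1 h2
    calc X ≤ κ * (r ^ 3 * M.gauss t v) := by rw [← mul_assoc]; exact h2
      _ ≤ K * (C * Real.exp (-ε * ‖v‖ ^ 2)) := by
          have := h t ht1 ht2 v
          gcongr
      _ = _ := by ring
  have hpoly : |M.mixPoly a b t w v| ≤ K₁ * ‖w‖ * r ^ 2 := by
    unfold mixPoly
    calc _ ≤ |b / t| * |⟪M.ν, w⟫| + |(a + b * ⟪v, M.ν⟫ / t) / t| * |⟪M.A v, w⟫| := by
          refine (abs_sub _ _).trans_eq ?_
          rw [abs_mul, abs_mul]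
      _ ≤ |b| * T * (n * ‖w‖) + c * T * r * (m * ‖w‖ * r) := by
          gcongr
          exact abs_real_inner_le_norm _ _
      _ ≤ |b| * T * (n * ‖w‖) * r ^ 2 + c * T * r * (m * ‖w‖ * r) := by
          have := le_mul_of_one_le_right (by positivity : 0 ≤ |b| * T * (n * ‖w‖))
            (by linarith : 1 ≤ r ^ 2)
          linarith
      _ = _ := by ring
  have hD : ‖M.mixD a b t v‖ ≤ K₁ * r ^ 2 * M.gauss t v := by
    rw [mixD, norm_smul, Real.norm_eq_abs, abs_of_nonneg hg, mul_comm]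
    refine mul_le_mul_of_nonneg_right ?_ hg
    calc _ ≤ |b / t| * n + |(a + b * ⟪v, M.ν⟫ / t) / t| * ‖M.A v‖ := by
          refine (norm_sub_le _ _).trans_eq ?_
          rw [norm_smul, norm_smul, innerSL_apply_norm, innerSL_apply_norm, Real.norm_eq_abs,
            Real.norm_eq_abs]
      _ ≤ |b| * T * n + c * T * r * (m * r) := by gcongr
      _ ≤ |b| * T * n * r ^ 2 + c * T * r * (m * r) := by
          have := le_mul_of_one_le_right (by positivity : 0 ≤ |b| * T * n)
            (by linarith : 1 ≤ r ^ 2)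
          linarith
      _ = _ := by ring
  refine ⟨?_, ?_, ?_, ?_, ?_⟩
  · refine close _ c hcp (by linarith) ?_
    rw [mix, norm_mul, Real.norm_eq_abs, Real.norm_eq_abs, abs_of_nonneg hg]
    gcongr
    exact hpre.trans (by gcongr; linarith)
  · refine close _ K₁ p1 (by linarith) (hD.trans ?_)
    gcongr
  · refine close _ (K₁ * ‖w‖) p4 (by linarith) ?_
    rw [mixD_apply, norm_mul, Real.norm_eq_abs, Real.norm_eq_abs, abs_of_nonneg hg]
    gcongr
    exact hpoly.trans (by gcongr)
  · refine close _ K₂ p2 (by linarith) ?_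
    rw [mixDD, norm_smul, Real.norm_eq_abs, abs_of_nonneg hg, mul_comm]
    refine mul_le_mul_of_nonneg_right ?_ hg
    calc _ ≤ |b / t ^ 2 * ⟪M.A v, w⟫| * n + |(a + b * ⟪v, M.ν⟫ / t) / t| * ‖M.A w‖ +
          |M.mixPoly a b t w v / t| * ‖M.A v‖ := by
          refine (norm_sub_le _ _).trans (add_le_add ((norm_sub_le _ _).trans_eq ?_) (le_of_eq ?_))
          · rw [norm_smul, norm_smul, innerSL_apply_norm, innerSL_apply_norm, Real.norm_eq_abs,
              Real.norm_eq_abs, abs_neg]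
          · rw [norm_smul, innerSL_apply_norm, Real.norm_eq_abs]
      _ ≤ |b| * T ^ 2 * (m * ‖w‖ * r) * n + c * T * r * (m * ‖w‖) +
          K₁ * ‖w‖ * r ^ 2 * T * (m * r) := by
          have e1 : |b / t ^ 2 * ⟪M.A v, w⟫| ≤ |b| * T ^ 2 * (m * ‖w‖ * r) := by
            rw [abs_mul, abs_div, abs_of_pos (pow_pos ht 2), div_eq_mul_inv, ← inv_pow]
            gcongr
          have e2 : |M.mixPoly a b t w v / t| ≤ K₁ * ‖w‖ * r ^ 2 * T := by
            rw [abs_div, abs_of_pos ht, div_eq_mul_inv]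
            gcongr
          have e3 : ‖M.A w‖ ≤ m * ‖w‖ := M.A.le_opNorm w
          gcongr
      _ = (|b| * T ^ 2 * (m * ‖w‖) * n + c * T * (m * ‖w‖)) * r + K₁ * ‖w‖ * T * m * r ^ 3 := by
          ring
      _ ≤ (|b| * T ^ 2 * (m * ‖w‖) * n + c * T * (m * ‖w‖)) * r ^ 3 + K₁ * ‖w‖ * T * m * r ^ 3 := by
          gcongr; linarith
      _ = _ := by ring
  · refine close _ K₃ p3 (by linarith) ?_
    rw [mixT, norm_mul, Real.norm_eq_abs, Real.norm_eq_abs, abs_of_nonneg hg]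
    refine mul_le_mul_of_nonneg_right ?_ hg
    have hq : |M.quad v| ≤ m * r ^ 2 := by
      refine (abs_real_inner_le_norm _ _).trans ?_
      calc _ ≤ m * r * r := by gcongr
        _ = _ := by ring
    calc _ ≤ |b * ⟪v, M.ν⟫ / t ^ 2| + |a + b * ⟪v, M.ν⟫ / t| *
          (|M.quad v / (2 * t ^ 2)| + |(d : ℝ) / (2 * t)|) := by
          refine (abs_add_le _ _).trans ?_
          rw [abs_neg, abs_mul (a + _)]
          gcongr
          exact abs_sub _ _
      _ ≤ |b| * (n * r) * T ^ 2 + c * r * (m * r ^ 2 * T ^ 2 + d * T) := by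
          have e1 : |b * ⟪v, M.ν⟫ / t ^ 2| ≤ |b| * (n * r) * T ^ 2 := by
            rw [abs_div, abs_mul, abs_of_pos (pow_pos ht 2), div_eq_mul_inv, ← inv_pow]
            gcongr
          have e2 : |M.quad v / (2 * t ^ 2)| ≤ m * r ^ 2 * T ^ 2 := by
            rw [abs_div, abs_of_pos (by positivity : 0 < 2 * t ^ 2), div_eq_mul_inv, mul_inv,
              ← inv_pow]
            have : (2 : ℝ)⁻¹ * t⁻¹ ^ 2 ≤ T ^ 2 := by
              have : t⁻¹ ^ 2 ≤ T ^ 2 := by gcongr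
              nlinarith [sq_nonneg t⁻¹]
            gcongr
          have e3 : |(d : ℝ) / (2 * t)| ≤ d * T := by
            rw [abs_div, abs_of_pos (by positivity : 0 < 2 * t), div_eq_mul_inv, mul_inv,
              abs_of_nonneg (Nat.cast_nonneg d)]
            have : (2 : ℝ)⁻¹ * t⁻¹ ≤ T := by nlinarith
            gcongr
          gcongr
      _ ≤ |b| * (n * r ^ 3) * T ^ 2 + c * r * (m * r ^ 2 * T ^ 2 + d * T * r ^ 2) := by
          have : (d : ℝ) * T ≤ d * T * r ^ 2 :=
            le_mul_of_one_le_right (by positivity) (by linarith)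
          gcongr
          linarith
      _ = _ := by ring

/-! ### Differentiation under the integral and the heat equation for superpositions -/

section Superposition

variable {Y : Type*} [MeasurableSpace Y] {μ : Measure Y} {ξ : Y → E d} {w : Y → ℝ} {C₀ : ℝ} (a b : ℝ)

lemma integrable_mix_superposition (hξ : Measurable ξ) (hw : Measurable w)
    (hwb : ∀ η, |w η| ≤ C₀)
    (hint : ∀ ε > 0, Integrable (fun η => Real.exp (-ε * ‖ξ η‖ ^ 2)) μ) {t : ℝ} (ht : 0 < t)
    (x : E d) : Integrable (fun η => w η * M.mix a b t (x - ξ η)) μ := by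
  obtain ⟨C, -, ε, hε, h⟩ := M.exists_mix_bounds a b ht ht 0
  exact integrable_superposition hξ hw hwb hint (M.continuous_mix a b t) hε
    (fun v => (h t le_rfl le_rfl v).1) x

lemma hasFDerivAt_mix_superposition (hξ : Measurable ξ) (hw : Measurable w)
    (hwb : ∀ η, |w η| ≤ C₀)
    (hint : ∀ ε > 0, Integrable (fun η => Real.exp (-ε * ‖ξ η‖ ^ 2)) μ) {t : ℝ} (ht : 0 < t)
    (x : E d) : HasFDerivAt (fun x => ∫ η, w η * M.mix a b t (x - ξ η) ∂μ)
      (∫ η, w η • M.mixD a b t (x - ξ η) ∂μ) x := by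
  obtain ⟨C, -, ε, hε, h⟩ := M.exists_mix_bounds a b ht ht 0
  exact hasFDerivAt_superposition hξ hw hwb hint (fun v => M.hasFDerivAt_mix a b t v)
    (M.continuous_mixD a b t) hε (fun v => (h t le_rfl le_rfl v).1)
    (fun v => (h t le_rfl le_rfl v).2.1) x

lemma fderiv_mix_superposition_apply (hξ : Measurable ξ) (hw : Measurable w)
    (hwb : ∀ η, |w η| ≤ C₀)
    (hint : ∀ ε > 0, Integrable (fun η => Real.exp (-ε * ‖ξ η‖ ^ 2)) μ) {t : ℝ} (ht : 0 < t)
    (x e : E d) : fderiv ℝ (fun x => ∫ η, w η * M.mix a b t (x - ξ η) ∂μ) x e =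
      ∫ η, w η * M.mixD a b t (x - ξ η) e ∂μ := by
  obtain ⟨C, -, ε, hε, h⟩ := M.exists_mix_bounds a b ht ht 0
  rw [(M.hasFDerivAt_mix_superposition a b hξ hw hwb hint ht x).fderiv,
    ContinuousLinearMap.integral_apply]
  · rfl
  · exact integrable_superposition hξ hw hwb hint (M.continuous_mixD a b t) hε
      (fun v => (h t le_rfl le_rfl v).2.1) x

lemma hasFDerivAt_mixD_superposition (hξ : Measurable ξ) (hw : Measurable w)
    (hwb : ∀ η, |w η| ≤ C₀)
    (hint : ∀ ε > 0, Integrable (fun η => Real.exp (-ε * ‖ξ η‖ ^ 2)) μ) {t : ℝ} (ht : 0 < t)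
    (e x : E d) : HasFDerivAt (fun x => ∫ η, w η * M.mixD a b t (x - ξ η) e ∂μ)
      (∫ η, w η • M.mixDD a b t e (x - ξ η) ∂μ) x := by
  obtain ⟨C, -, ε, hε, h⟩ := M.exists_mix_bounds a b ht ht e
  exact hasFDerivAt_superposition hξ hw hwb hint (fun v => M.hasFDerivAt_mixD_apply a b t e v)
    (M.continuous_mixDD a b t e) hε (fun v => (h t le_rfl le_rfl v).2.2.1)
    (fun v => (h t le_rfl le_rfl v).2.2.2.1) x

lemma contDiff_mix_superposition (hξ : Measurable ξ) (hw : Measurable w)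
    (hwb : ∀ η, |w η| ≤ C₀)
    (hint : ∀ ε > 0, Integrable (fun η => Real.exp (-ε * ‖ξ η‖ ^ 2)) μ) {t : ℝ} (ht : 0 < t) :
    ContDiff ℝ 2 (fun x => ∫ η, w η * M.mix a b t (x - ξ η) ∂μ) := by
  rw [show (2 : WithTop ℕ∞) = 1 + 1 by norm_num, contDiff_succ_iff_fderiv_apply]
  refine ⟨fun x => (M.hasFDerivAt_mix_superposition a b hξ hw hwb hint ht x).differentiableAt,
    by simp, fun e => ?_⟩
  simp only [M.fderiv_mix_superposition_apply a b hξ hw hwb hint ht]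
  rw [contDiff_one_iff_hasFDerivAt]
  obtain ⟨C, -, ε, hε, h⟩ := M.exists_mix_bounds a b ht ht e
  exact ⟨_, continuous_superposition hξ hw hwb hint (M.continuous_mixDD a b t e) hε
    (fun v => (h t le_rfl le_rfl v).2.2.2.1),
    M.hasFDerivAt_mixD_superposition a b hξ hw hwb hint ht e⟩

lemma trace_hessian_mix_superposition (B : Matrix (Fin d) (Fin d) ℝ)
    (hBA : ∀ v, B.toEuclideanLin (M.A v) = v) (hξ : Measurable ξ) (hw : Measurable w)
    (hwb : ∀ η, |w η| ≤ C₀)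
    (hint : ∀ ε > 0, Integrable (fun η => Real.exp (-ε * ‖ξ η‖ ^ 2)) μ) {t : ℝ} (ht : 0 < t)
    (x : E d) :
    1 / 2 * (B * hessian (fun x => ∫ η, w η * M.mix a b t (x - ξ η) ∂μ) x).trace =
      ∫ η, w η * M.mixT a b t (x - ξ η) ∂μ := by
  have hi : ∀ e, Integrable (fun η => w η • M.mixDD a b t e (x - ξ η)) μ := by
    intro e
    obtain ⟨C, -, ε, hε, h⟩ := M.exists_mix_bounds a b ht ht e
    exact integrable_superposition hξ hw hwb hint (M.continuous_mixDD a b t e) hε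
      (fun v => (h t le_rfl le_rfl v).2.2.2.1) x
  have hH : ∀ i j, hessian (fun x => ∫ η, w η * M.mix a b t (x - ξ η) ∂μ) x j i =
      ∫ η, w η * M.mixDD a b t (EuclideanSpace.single i 1) (x - ξ η)
        (EuclideanSpace.single j 1) ∂μ := by
    intro i j
    simp only [hessian, Matrix.of_apply, M.fderiv_mix_superposition_apply a b hξ hw hwb hint ht]
    rw [(M.hasFDerivAt_mixD_superposition a b hξ hw hwb hint ht _ x).fderiv,
      ContinuousLinearMap.integral_apply (hi _)]
    rfl
  have hi' : ∀ i j, Integrable (fun η => w η * M.mixDD a b t (EuclideanSpace.single i 1) (x - ξ η)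
        (EuclideanSpace.single j 1)) μ := fun i j =>
    (hi (EuclideanSpace.single i 1)).apply_continuousLinearMap (EuclideanSpace.single j 1)
  simp only [Matrix.trace, Matrix.diag_apply, Matrix.mul_apply, hH, ← integral_const_mul]
  simp only [← M.trace_mixDD a b B hBA ht]
  have e : ∀ η, w η * (1 / 2 * ∑ i, ∑ j, B i j *
      M.mixDD a b t (EuclideanSpace.single i 1) (x - ξ η) (EuclideanSpace.single j 1)) =
      1 / 2 * ∑ i, ∑ j, B i j * (w η *
      M.mixDD a b t (EuclideanSpace.single i 1) (x - ξ η) (EuclideanSpace.single j 1)) := by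
    intro η
    simp only [Finset.mul_sum]
    exact Finset.sum_congr rfl fun i _ => Finset.sum_congr rfl fun j _ => by ring
  simp only [e]
  rw [integral_const_mul]
  congr 1
  refine Eq.trans ?_ (integral_finsetSum Finset.univ fun i _ =>
    integrable_finsetSum Finset.univ fun j _ => (hi' i j).const_mul (B i j)).symm
  exact Finset.sum_congr rfl fun i _ =>
    (integral_finsetSum Finset.univ fun j _ => (hi' i j).const_mul (B i j)).symm

lemma hasDerivAt_mix_superposition_time (hξ : Measurable ξ) (hw : Measurable w)
    (hwb : ∀ η, |w η| ≤ C₀)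
    (hint : ∀ ε > 0, Integrable (fun η => Real.exp (-ε * ‖ξ η‖ ^ 2)) μ) {t : ℝ} (ht : 0 < t)
    (x : E d) : HasDerivAt (fun s => ∫ η, w η * M.mix a b s (x - ξ η) ∂μ)
      (∫ η, w η * M.mixT a b t (x - ξ η) ∂μ) t := by
  -- The time derivative must be dominated on a neighbourhood of t; (t/2, 2t) is used throughout.
  obtain ⟨C, -, ε, hε, h⟩ := M.exists_mix_bounds a b (half_pos ht) (by linarith : 0 < 2 * t) 0
  refine (hasDerivAt_integral_of_dominated_loc_of_deriv_le (s := Set.Ioo (t / 2) (2 * t))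
    (bound := fun η => C₀ * (C * Real.exp (ε * ‖x‖ ^ 2)) * Real.exp (-(ε / 2) * ‖ξ η‖ ^ 2))
    (F' := fun s η => w η * M.mixT a b s (x - ξ η))
    (Ioo_mem_nhds (by linarith) (by linarith)) ?_ ?_ ?_ ?_ ?_ ?_).2
  · filter_upwards [Ioi_mem_nhds ht] with s hs
    exact (M.integrable_mix_superposition a b hξ hw hwb hint hs x).aestronglyMeasurable
  · exact M.integrable_mix_superposition a b hξ hw hwb hint ht x
  · exact hw.aestronglyMeasurable.mul ((M.continuous_mixT a b t).comp_stronglyMeasurable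
      (measurable_const.sub hξ).stronglyMeasurable).aestronglyMeasurable
  · refine ae_of_all _ fun η s hs => ?_
    exact norm_superposition_le (p := M.mixT a b s) hwb hε
      (fun v => (h s hs.1.le hs.2.le v).2.2.2.2) le_rfl η
  · exact (hint _ (by positivity)).const_mul _
  · refine ae_of_all _ fun η s hs => ?_
    exact (M.hasDerivAt_mix_time a b ((half_pos ht).trans hs.1) _).const_mul _

end Superposition

/-! ### Folding along the membrane -/

/-- The direction `N + α` of the oblique derivative. -/
def beta : E d := M.N + M.α

/-- The fold onto the half-space `0 ≤ (x, ν)` along `N`. -/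
def fold (x : E d) : E d := x + ((|⟪x, M.ν⟫| - ⟪x, M.ν⟫) / M.sig) • M.N

/-- The fold onto the half-space `(x, ν) ≤ 0` along `N`. -/
def foldNeg (x : E d) : E d := x - ((|⟪x, M.ν⟫| + ⟪x, M.ν⟫) / M.sig) • M.N

/-- The reflection along `N` with respect to the hyperplane orthogonal to `ν`. -/
def refl (x : E d) : E d := x - (2 * ⟪x, M.ν⟫ / M.sig) • M.N

lemma inner_N : ⟪M.N, M.ν⟫ = M.sig := rfl

lemma inner_beta : ⟪M.beta, M.ν⟫ = M.sig := by
  rw [beta, inner_add_left, M.α_tangent, inner_N, add_zero]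

lemma inner_fold (x : E d) : ⟪M.fold x, M.ν⟫ = |⟪x, M.ν⟫| := by
  have := M.sig_pos'.ne'
  rw [fold, inner_add_left, real_inner_smul_left, inner_N, div_mul_cancel₀ _ this]; ring

lemma inner_foldNeg (x : E d) : ⟪M.foldNeg x, M.ν⟫ = -|⟪x, M.ν⟫| := by
  have := M.sig_pos'.ne'
  rw [foldNeg, inner_sub_left, real_inner_smul_left, inner_N, div_mul_cancel₀ _ this]; ring

lemma inner_refl (x : E d) : ⟪M.refl x, M.ν⟫ = -⟪x, M.ν⟫ := by
  have := M.sig_pos'.ne'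
  rw [refl, inner_sub_left, real_inner_smul_left, inner_N, div_mul_cancel₀ _ this]; ring

lemma fold_of_nonneg {x : E d} (hx : 0 ≤ ⟪x, M.ν⟫) : M.fold x = x := by
  simp [fold, abs_of_nonneg hx]

lemma fold_of_nonpos {x : E d} (hx : ⟪x, M.ν⟫ ≤ 0) : M.fold x = M.refl x := by
  rw [fold, refl, abs_of_nonpos hx, sub_eq_add_neg x, ← neg_smul]; congr 2; ring

lemma foldNeg_of_nonneg {x : E d} (hx : 0 ≤ ⟪x, M.ν⟫) : M.foldNeg x = M.refl x := by
  rw [foldNeg, refl, abs_of_nonneg hx]; congr 3; ring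

lemma foldNeg_of_nonpos {x : E d} (hx : ⟪x, M.ν⟫ ≤ 0) : M.foldNeg x = x := by
  simp [foldNeg, abs_of_nonpos hx]

@[fun_prop]
lemma continuous_fold : Continuous M.fold := by unfold fold; fun_prop

@[fun_prop]
lemma continuous_foldNeg : Continuous M.foldNeg := by unfold foldNeg; fun_prop

@[fun_prop]
lemma continuous_refl : Continuous M.refl := by unfold refl; fun_prop

/-- The normal component of the vector is |x_ν| + |y_ν| + σ²θ, a sum of nonnegative terms, so its
norm controls each of them. The difference y - x is minus that vector plus multiples of β and N
whose coefficients are of this size. -/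
lemma exists_fold_bound : ∃ K > 0, ∀ (x y : E d) (θ : ℝ), 0 ≤ θ →
    ‖y - x‖ ≤ K * ‖M.fold x - M.foldNeg y + θ • M.beta‖ ∧
      θ ≤ K * ‖M.fold x - M.foldNeg y + θ • M.beta‖ := by
  have hs := M.sig_pos'
  set n := ‖M.ν‖
  refine ⟨1 + n * ‖M.beta‖ / M.sig + 2 * n * ‖M.N‖ / M.sig + n / M.sig, by positivity,
    fun x y θ hθ => ?_⟩
  set v := M.fold x - M.foldNeg y + θ • M.beta with hv
  have h1 : |⟪x, M.ν⟫| + |⟪y, M.ν⟫| + M.sig * θ ≤ n * ‖v‖ := by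
    have : ⟪v, M.ν⟫ = |⟪x, M.ν⟫| + |⟪y, M.ν⟫| + M.sig * θ := by
      rw [hv, inner_add_left, inner_sub_left, inner_fold, inner_foldNeg, real_inner_smul_left,
        inner_beta]
      ring
    rw [← this]
    exact (le_abs_self _).trans (M.norm_inner_nu_le v)
  have hx0 := abs_nonneg ⟪x, M.ν⟫
  have hy0 := abs_nonneg ⟪y, M.ν⟫
  have hθs : 0 ≤ M.sig * θ := by positivity
  have hθ' : θ ≤ n / M.sig * ‖v‖ := by
    rw [div_mul_eq_mul_div, le_div_iff₀ hs]; linarith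
  have hxy : y - x = -v + θ • M.beta + ((|⟪x, M.ν⟫| - ⟪x, M.ν⟫ + (|⟪y, M.ν⟫| + ⟪y, M.ν⟫)) / M.sig) •
      M.N := by
    rw [hv, fold, foldNeg, add_div, add_smul]; module
  have h2 : |⟪x, M.ν⟫| - ⟪x, M.ν⟫ + (|⟪y, M.ν⟫| + ⟪y, M.ν⟫) ≤ 2 * (n * ‖v‖) := by
    have := neg_abs_le ⟪x, M.ν⟫
    have := le_abs_self ⟪y, M.ν⟫
    linarith
  have h3 : 0 ≤ |⟪x, M.ν⟫| - ⟪x, M.ν⟫ + (|⟪y, M.ν⟫| + ⟪y, M.ν⟫) := by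
    have := le_abs_self ⟪x, M.ν⟫
    have := neg_abs_le ⟪y, M.ν⟫
    linarith
  have p1 : 0 ≤ n * ‖M.beta‖ / M.sig * ‖v‖ := by positivity
  have p2 : 0 ≤ 2 * n * ‖M.N‖ / M.sig * ‖v‖ := by positivity
  have p3 : 0 ≤ n / M.sig * ‖v‖ := by positivity
  have p4 := norm_nonneg v
  constructor
  · have : ‖y - x‖ ≤ ‖v‖ + n / M.sig * ‖v‖ * ‖M.beta‖ + 2 * (n * ‖v‖) / M.sig * ‖M.N‖ := by
      rw [hxy]
      refine (norm_add₃_le).trans ?_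
      rw [norm_neg, norm_smul, norm_smul, Real.norm_of_nonneg hθ,
        Real.norm_of_nonneg (div_nonneg h3 hs.le)]
      gcongr
    calc _ ≤ _ := this
      _ = (1 + n * ‖M.beta‖ / M.sig + 2 * n * ‖M.N‖ / M.sig) * ‖v‖ := by ring
      _ ≤ _ := mul_le_mul_of_nonneg_right (by linarith [show 0 ≤ n / M.sig by positivity]) p4
  · calc _ ≤ _ := hθ'
      _ ≤ _ := by
        refine mul_le_mul_of_nonneg_right ?_ p4
        linarith [show 0 ≤ n * ‖M.beta‖ / M.sig by positivity,
          show 0 ≤ 2 * n * ‖M.N‖ / M.sig by positivity]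

/-- Separates the decay into a Gaussian in y - x and one in θ. This product form is what makes the
θ-integral converge and Fubini applicable. -/
lemma exists_exp_fold_le : ∃ c > 0, ∀ (ε : ℝ), 0 ≤ ε → ∀ (x y : E d) (θ : ℝ), 0 ≤ θ →
    Real.exp (-ε * ‖M.fold x - M.foldNeg y + θ • M.beta‖ ^ 2) ≤
      Real.exp (-(c * ε) * ‖y - x‖ ^ 2) * Real.exp (-(c * ε) * θ ^ 2) := by
  obtain ⟨K, hK, h⟩ := M.exists_fold_bound
  refine ⟨1 / (2 * K ^ 2), by positivity, fun ε hε x y θ hθ => ?_⟩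
  obtain ⟨h1, h2⟩ := h x y θ hθ
  rw [← Real.exp_add, Real.exp_le_exp]
  set r := ‖M.fold x - M.foldNeg y + θ • M.beta‖
  have e1 : ‖y - x‖ ^ 2 ≤ K ^ 2 * r ^ 2 := by
    rw [← mul_pow]; exact pow_le_pow_left₀ (norm_nonneg _) h1 2
  have e2 : θ ^ 2 ≤ K ^ 2 * r ^ 2 := by
    rw [← mul_pow]; exact pow_le_pow_left₀ hθ h2 2
  have e3 : 1 / (2 * K ^ 2) * (‖y - x‖ ^ 2 + θ ^ 2) ≤ r ^ 2 := by
    rw [one_div, inv_mul_le_iff₀ (by positivity)]; linarith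
  nlinarith

@[simp]
lemma fold_zero : M.fold 0 = 0 := by simp [fold]

lemma integrable_exp_foldNeg {ε : ℝ} (hε : 0 < ε) :
    Integrable fun y => Real.exp (-ε * ‖M.foldNeg y‖ ^ 2) := by
  obtain ⟨c, hc, h⟩ := M.exists_exp_fold_le
  refine (integrable_exp_neg_mul_sq_norm (mul_pos hc hε)).mono' (by fun_prop)
    (ae_of_all _ fun y => ?_)
  simpa using h ε hε.le 0 y 0 le_rfl

/-- Lebesgue measure on pairs of a point and a positive local time. -/
def pairMeasure (d : ℕ) : Measure (E d × ℝ) :=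
  (volume : Measure (E d)).prod ((volume : Measure ℝ).restrict (Set.Ioi 0))

lemma integrable_exp_foldNeg_pair {ε : ℝ} (hε : 0 < ε) :
    Integrable (fun η : E d × ℝ => Real.exp (-ε * ‖M.foldNeg η.1 - η.2 • M.beta‖ ^ 2))
      (pairMeasure d) := by
  obtain ⟨c, hc, h⟩ := M.exists_exp_fold_le
  have h1 := (integrable_exp_neg_mul_sq_norm (d := d) (mul_pos hc hε)).mul_prod
    ((integrable_exp_neg_mul_sq (mul_pos hc hε)).restrict (s := Set.Ioi 0))
  refine h1.mono' (by fun_prop) ?_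
  have hae : ∀ᵐ η ∂(pairMeasure d), η.2 ∈ Set.Ioi (0 : ℝ) :=
    Measure.quasiMeasurePreserving_snd.ae (ae_restrict_mem measurableSet_Ioi)
  filter_upwards [hae] with η hη
  have := h ε hε.le 0 η.1 η.2 (le_of_lt hη)
  rw [Real.norm_of_nonneg (Real.exp_nonneg _)]
  rw [fold_zero, zero_sub, sub_zero, ← norm_neg, neg_add, neg_neg, ← sub_eq_add_neg] at this
  exact this

end Setup

lemma measurable_sign : Measurable Real.sign := by
  unfold Real.sign
  exact Measurable.ite measurableSet_Iio measurable_const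
    (Measurable.ite measurableSet_Ioi measurable_const measurable_const)

lemma abs_sign_le_one (r : ℝ) : |Real.sign r| ≤ 1 := by
  rcases Real.sign_apply_eq r with h | h | h <;> simp [h]

namespace Setup

variable {d : ℕ} (M : Setup d)

/-! ### Reflection -/

/-- The component of `v` along the membrane in the decomposition along `N`. -/
def tang (v : E d) : E d := v - (⟪v, M.ν⟫ / M.sig) • M.N

/-- N is A-orthogonal to S because AN = ν, and its A-norm squared is σ². This is the factorisation
of the Gaussian into a normal and a tangential density. -/
lemma quad_eq_tang (v : E d) : M.quad v = ⟪v, M.ν⟫ ^ 2 / M.sig + M.quad (M.tang v) := by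
  have hs := M.sig_pos'.ne'
  have hN : M.quad M.N = M.sig := by rw [quad, M.A_N, real_inner_comm, inner_N]
  rw [tang, sub_eq_add_neg, ← neg_smul, quad_add, quad_smul, real_inner_smul_right, inner_A_N, hN]
  field_simp
  ring

lemma gauss_eq_tang (t : ℝ) (v : E d) : M.gauss t v = M.gaussConst * (√t ^ d)⁻¹ *
    Real.exp (-((⟪v, M.ν⟫ ^ 2 / M.sig + M.quad (M.tang v)) / (2 * t))) := by
  rw [gauss, quad_eq_tang]

lemma tang_add (v w : E d) : M.tang (v + w) = M.tang v + M.tang w := by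
  rw [tang, tang, tang, inner_add_left, add_div, add_smul]; abel

lemma tang_sub (v w : E d) : M.tang (v - w) = M.tang v - M.tang w := by
  rw [tang, tang, tang, inner_sub_left, sub_div, sub_smul]; abel

lemma tang_smul (c : ℝ) (v : E d) : M.tang (c • v) = c • M.tang v := by
  rw [tang, tang, real_inner_smul_left, smul_sub, smul_smul, mul_div_assoc]

lemma tang_N : M.tang M.N = 0 := by
  rw [tang, inner_N, div_self M.sig_pos'.ne', one_smul, sub_self]

lemma tang_fold (v : E d) : M.tang (M.fold v) = M.tang v := by
  rw [fold, tang_add, tang_smul, tang_N, smul_zero, add_zero]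

lemma tang_foldNeg (v : E d) : M.tang (M.foldNeg v) = M.tang v := by
  rw [foldNeg, tang_sub, tang_smul, tang_N, smul_zero, sub_zero]

lemma tang_refl (v : E d) : M.tang (M.refl v) = M.tang v := by
  rw [refl, tang_sub, tang_smul, tang_N, smul_zero, sub_zero]

lemma gauss_congr (t : ℝ) {v w : E d} (h : ⟪v, M.ν⟫ ^ 2 = ⟪w, M.ν⟫ ^ 2)
    (h' : M.tang v = M.tang w) : M.gauss t v = M.gauss t w := by
  rw [gauss_eq_tang, gauss_eq_tang, h, h']

lemma refl_add (v w : E d) : M.refl (v + w) = M.refl v + M.refl w := by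
  simp only [refl, inner_add_left, mul_add, add_div, add_smul]; abel

lemma refl_sub (v w : E d) : M.refl (v - w) = M.refl v - M.refl w := by
  simp only [refl, inner_sub_left, mul_sub, sub_div, sub_smul]; abel

lemma refl_smul (c : ℝ) (v : E d) : M.refl (c • v) = c • M.refl v := by
  simp only [refl, real_inner_smul_left, smul_sub, smul_smul]; congr 2; ring

lemma refl_refl (v : E d) : M.refl (M.refl v) = v := by
  rw [refl, inner_refl, refl]
  module

lemma refl_N : M.refl M.N = -M.N := by
  rw [refl, inner_N, mul_div_assoc, div_self M.sig_pos'.ne']; module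

lemma refl_of_tangent {v : E d} (hv : ⟪v, M.ν⟫ = 0) : M.refl v = v := by simp [refl, hv]

lemma gauss_refl (t : ℝ) (v : E d) : M.gauss t (M.refl v) = M.gauss t v :=
  M.gauss_congr t (by rw [inner_refl, neg_sq]) (M.tang_refl v)

lemma inner_A_refl (v w : E d) : ⟪M.A (M.refl v), w⟫ = ⟪M.A v, M.refl w⟫ := by
  simp only [refl, map_sub, map_smul, M.A_N, inner_sub_right,
    real_inner_smul_right, inner_A_N, real_inner_comm w]
  ring

lemma gaussDeriv_refl (t : ℝ) (w v : E d) :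
    M.gaussDeriv t w (M.refl v) = M.gaussDeriv t (M.refl w) v := by
  rw [gaussDeriv, gaussDeriv, gauss_refl, inner_A_refl]

/-- The folded point lies in the upper half-space, where `foldNeg` acts as the reflection; folding
first does not change the value of `foldNeg`. -/
lemma refl_fold (v : E d) : M.refl (M.fold v) = M.foldNeg v := by
  rw [← M.foldNeg_of_nonneg (x := M.fold v) (by rw [inner_fold]; positivity)]
  rcases le_total 0 ⟪v, M.ν⟫ with h | h
  · rw [M.fold_of_nonneg h]
  · rw [M.fold_of_nonpos h, M.foldNeg_of_nonneg (by rw [inner_refl]; linarith), refl_refl,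
      M.foldNeg_of_nonpos h]

/-! ### The transition kernel -/

/-- The passage density integrated over the local time. -/
def oblique (t : ℝ) (v : E d) : ℝ := ∫ θ in Set.Ioi (0 : ℝ), M.passage t (v + θ • M.beta)

/-- The transition density. -/
def kernel (t : ℝ) (x y : E d) : ℝ :=
  M.gauss t (y - x) - M.gauss t (M.fold x - M.foldNeg y) +
    (M.q * Real.sign ⟪y, M.ν⟫ + 1) * M.oblique t (M.fold x - M.foldNeg y)

/-- The smooth extension of the transition density from the half-space `0 ≤ (x, ν)`. -/
def halfKernel (t : ℝ) (x y : E d) : ℝ :=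
  M.gauss t (x - y) - M.gauss t (x - M.foldNeg y) +
    (M.q * Real.sign ⟪y, M.ν⟫ + 1) * M.oblique t (x - M.foldNeg y)

/-- The problem seen from the other side of the membrane. -/
def flip : Setup d where
  A := M.A
  symm := M.symm
  lam := M.lam
  lam_pos := M.lam_pos
  coercive := M.coercive
  ν := -M.ν
  N := -M.N
  A_N := by rw [map_neg, M.A_N]
  sig_pos := by rw [inner_neg_neg]; exact M.sig_pos
  α := M.α
  α_tangent := by rw [inner_neg_right, M.α_tangent, neg_zero]
  q := -M.q
  abs_q_le := by rw [abs_neg]; exact M.abs_q_le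

lemma flip_gauss (t : ℝ) (v : E d) : M.flip.gauss t v = M.gauss t v := rfl

lemma flip_sig : M.flip.sig = M.sig := by
  change ⟪-M.N, -M.ν⟫ = ⟪M.N, M.ν⟫
  exact inner_neg_neg _ _

lemma flip_foldNeg (y : E d) : M.flip.foldNeg y = M.fold y := by
  rw [foldNeg, fold, flip_sig]
  change y - ((|⟪y, -M.ν⟫| + ⟪y, -M.ν⟫) / M.sig) • -M.N = _
  rw [inner_neg_right, abs_neg, smul_neg, sub_neg_eq_add, ← sub_eq_add_neg]

lemma flip_passage (t : ℝ) (v : E d) : M.flip.passage t v = M.passage t (M.refl v) := by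
  rw [passage, passage, inner_refl, gauss_refl, flip_gauss]
  change ⟪v, -M.ν⟫ / t * _ = _
  rw [inner_neg_right]

lemma flip_beta : M.flip.beta = M.refl M.beta := by
  rw [beta, beta, refl_add, refl_N, M.refl_of_tangent M.α_tangent]
  rfl

lemma flip_oblique (t : ℝ) (v : E d) : M.flip.oblique t v = M.oblique t (M.refl v) := by
  unfold oblique
  simp only [flip_passage, flip_beta, refl_add, refl_smul, refl_refl]

lemma refl_foldNeg (y : E d) : M.refl (M.foldNeg y) = M.fold y := by
  rw [← refl_fold, refl_refl]

lemma kernel_eq_halfKernel {x : E d} (hx : 0 ≤ ⟪x, M.ν⟫) (t : ℝ) (y : E d) :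
    M.kernel t x y = M.halfKernel t x y := by
  rw [kernel, halfKernel, M.fold_of_nonneg hx, gauss_sub_comm]

/-- The Gaussian is invariant under the reflection, which carries β to the oblique direction of the
flipped problem. Both q and sign y_ν change sign, so the weight is the same. Facts on the lower side
thus follow from those on the upper side. -/
lemma kernel_eq_flip_halfKernel {x : E d} (hx : ⟪x, M.ν⟫ ≤ 0) (t : ℝ) (y : E d) :
    M.kernel t x y = M.flip.halfKernel t x y := by
  rw [kernel, halfKernel, M.fold_of_nonpos hx, gauss_sub_comm, flip_gauss, flip_gauss,
    flip_oblique, flip_foldNeg, refl_sub, ← refl_foldNeg M y, refl_refl, ← M.gauss_refl t (M.refl x - _),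
    refl_sub, refl_refl]
  change _ = _ + (-M.q * Real.sign ⟪y, -M.ν⟫ + 1) * _
  rw [inner_neg_right, Real.sign_neg, neg_mul_neg]

/-! ### Bounds and continuity -/

lemma beta_ne_zero : M.beta ≠ 0 := by
  intro h
  have := M.inner_beta
  rw [h, inner_zero_left] at this
  exact M.sig_pos'.ne this

lemma integrable_exp_smul_beta {ε : ℝ} (hε : 0 < ε) :
    Integrable (fun θ : ℝ => Real.exp (-ε * ‖-(θ • M.beta)‖ ^ 2)) := by
  have hb := norm_pos_iff.2 M.beta_ne_zero
  refine (integrable_exp_neg_mul_sq (b := ε * ‖M.beta‖ ^ 2) (by positivity)).congr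
    (ae_of_all _ fun θ => ?_)
  simp only [norm_neg, norm_smul, mul_pow, Real.norm_eq_abs, sq_abs]
  congr 1; ring

lemma exists_passage_bound {t₁ t₂ : ℝ} (h₁ : 0 < t₁) (h₂ : 0 < t₂) :
    ∃ C > 0, ∃ ε > 0, ∀ t, t₁ ≤ t → t ≤ t₂ → ∀ v : E d,
      ‖M.passage t v‖ ≤ C * Real.exp (-ε * ‖v‖ ^ 2) := by
  obtain ⟨C, hC, ε, hε, h⟩ := M.exists_mix_bounds 0 1 h₁ h₂ 0
  exact ⟨C, hC, ε, hε, fun t ht1 ht2 v => by rw [← mix_zero_one]; exact (h t ht1 ht2 v).1⟩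

lemma integrable_passage_line {t : ℝ} (ht : 0 < t) (v : E d) :
    Integrable (fun θ : ℝ => M.passage t (v + θ • M.beta)) := by
  obtain ⟨C, -, ε, hε, h⟩ := M.exists_passage_bound ht ht
  have := integrable_superposition (μ := (volume : Measure ℝ)) (ξ := fun θ : ℝ => -(θ • M.beta))
    (w := fun _ => 1) (C₀ := 1) (by fun_prop) measurable_const (by simp)
    (fun ε hε => M.integrable_exp_smul_beta hε) (M.continuous_passage t) hε (h t le_rfl le_rfl) v
  simpa using this

lemma continuousAt_gauss {t : ℝ} (ht : 0 < t) (v : E d) :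
    ContinuousAt (fun p : ℝ × E d => M.gauss p.1 p.2) (t, v) := by
  have ht' : √t ^ d ≠ 0 := by positivity
  have h1 : ContinuousAt (fun p : ℝ × E d => (√p.1 ^ d)⁻¹) (t, v) :=
    ContinuousAt.inv₀ (by fun_prop) ht'
  have h2 : ContinuousAt (fun p : ℝ × E d => M.quad p.2 / (2 * p.1)) (t, v) :=
    ContinuousAt.div (by fun_prop) (by fun_prop) (by simpa using ht.ne')
  unfold gauss
  exact (continuousAt_const.mul h1).mul h2.neg.rexp

lemma continuousAt_passage {t : ℝ} (ht : 0 < t) (v : E d) :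
    ContinuousAt (fun p : ℝ × E d => M.passage p.1 p.2) (t, v) :=
  ContinuousAt.mul (ContinuousAt.div (by fun_prop) (by fun_prop) ht.ne') (M.continuousAt_gauss ht v)

lemma continuousAt_oblique {t : ℝ} (ht : 0 < t) (v : E d) :
    ContinuousAt (fun p : ℝ × E d => M.oblique p.1 p.2) (t, v) := by
  obtain ⟨C, hC, ε, hε, h⟩ := M.exists_passage_bound (half_pos ht) (by linarith : 0 < 2 * t)
  refine continuousAt_of_dominated (bound := fun θ : ℝ => C * (Real.exp (ε * (‖v‖ + 1) ^ 2) *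
    Real.exp (-(ε / 2) * ‖-(θ • M.beta)‖ ^ 2))) ?_ ?_ ?_ ?_
  · exact Eventually.of_forall fun p => Continuous.aestronglyMeasurable (by fun_prop)
  · have hn : Set.Ioo (t / 2) (2 * t) ×ˢ Metric.ball v 1 ∈ 𝓝 (t, v) :=
      prod_mem_nhds (Ioo_mem_nhds (by linarith) (by linarith)) (Metric.ball_mem_nhds v one_pos)
    filter_upwards [hn] with p hp
    refine ae_of_all _ fun θ => ?_
    refine (h p.1 hp.1.1.le hp.1.2.le _).trans (mul_le_mul_of_nonneg_left ?_ hC.le)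
    have hx : ‖p.2‖ ≤ ‖v‖ + 1 := by
      have h1 := norm_sub_norm_le p.2 v
      have h2 := hp.2
      rw [Metric.mem_ball, dist_eq_norm] at h2
      linarith
    simpa using exp_neg_mul_sq_norm_sub_le (ξ := -(θ • M.beta)) hε hx
  · exact (((M.integrable_exp_smul_beta (half_pos hε)).const_mul _).const_mul _).restrict
  · refine ae_of_all _ fun θ => ?_
    exact ContinuousAt.comp (g := fun p : ℝ × E d => M.passage p.1 p.2)
      (f := fun p : ℝ × E d => (p.1, p.2 + θ • M.beta)) (M.continuousAt_passage ht _) (by fun_prop)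

lemma continuous_oblique {t : ℝ} (ht : 0 < t) : Continuous (M.oblique t) :=
  continuous_iff_continuousAt.2 fun v =>
    ContinuousAt.comp (g := fun p : ℝ × E d => M.oblique p.1 p.2) (f := fun v => (t, v))
      (M.continuousAt_oblique ht v) (by fun_prop)

/-- Joint continuity of the transition density in time and the starting point. -/
lemma continuousAt_kernel {t : ℝ} (ht : 0 < t) (x y : E d) :
    ContinuousAt (fun p : ℝ × E d => M.kernel p.1 p.2 y) (t, x) := by
  unfold kernel
  refine ContinuousAt.add (ContinuousAt.sub ?_ ?_) (continuousAt_const.mul ?_)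
  · exact ContinuousAt.comp (g := fun p : ℝ × E d => M.gauss p.1 p.2)
      (f := fun p : ℝ × E d => (p.1, y - p.2)) (M.continuousAt_gauss ht _) (by fun_prop)
  · exact ContinuousAt.comp (g := fun p : ℝ × E d => M.gauss p.1 p.2)
      (f := fun p : ℝ × E d => (p.1, M.fold p.2 - M.foldNeg y)) (M.continuousAt_gauss ht _)
      (by fun_prop)
  · exact ContinuousAt.comp (g := fun p : ℝ × E d => M.oblique p.1 p.2)
      (f := fun p : ℝ × E d => (p.1, M.fold p.2 - M.foldNeg y)) (M.continuousAt_oblique ht _)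
      (by fun_prop)

lemma measurable_kernel {t : ℝ} (ht : 0 < t) : Measurable (Function.uncurry (M.kernel t)) := by
  have h := M.continuous_oblique ht
  have h1 : Measurable fun p : E d × E d => Real.sign ⟪p.2, M.ν⟫ :=
    measurable_sign.comp (by fun_prop)
  have h2 : Measurable fun p : E d × E d => M.oblique t (M.fold p.1 - M.foldNeg p.2) :=
    (h.comp (by fun_prop)).measurable
  have h3 : Measurable fun p : E d × E d =>
      M.gauss t (p.2 - p.1) - M.gauss t (M.fold p.1 - M.foldNeg p.2) :=
    Continuous.measurable (by fun_prop)
  exact h3.add (((h1.const_mul M.q).add_const 1).mul h2)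

lemma inner_fold_sub_foldNeg_add (x y : E d) (θ : ℝ) :
    ⟪M.fold x - M.foldNeg y + θ • M.beta, M.ν⟫ = |⟪x, M.ν⟫| + |⟪y, M.ν⟫| + M.sig * θ := by
  rw [inner_add_left, inner_sub_left, inner_fold, inner_foldNeg, real_inner_smul_left, inner_beta]
  ring

lemma passage_nonneg {t : ℝ} (ht : 0 < t) {v : E d} (hv : 0 ≤ ⟪v, M.ν⟫) : 0 ≤ M.passage t v :=
  mul_nonneg (div_nonneg hv ht.le) (M.gauss_pos ht v).le

lemma oblique_nonneg {t : ℝ} (ht : 0 < t) {v : E d} (hv : 0 ≤ ⟪v, M.ν⟫) : 0 ≤ M.oblique t v := by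
  refine setIntegral_nonneg measurableSet_Ioi fun θ hθ => M.passage_nonneg ht ?_
  rw [inner_add_left, real_inner_smul_left, inner_beta]
  exact add_nonneg hv (mul_nonneg (le_of_lt hθ) M.sig_pos'.le)

lemma inner_fold_sub_foldNeg_nonneg (x y : E d) : 0 ≤ ⟪M.fold x - M.foldNeg y, M.ν⟫ := by
  rw [inner_sub_left, inner_fold, inner_foldNeg, sub_neg_eq_add]; positivity

lemma abs_weight_le (r : ℝ) : |M.q * Real.sign r| ≤ 1 := by
  rw [abs_mul]
  exact mul_le_one₀ M.abs_q_le (abs_nonneg _) (abs_sign_le_one r)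

lemma weight_nonneg (r : ℝ) : 0 ≤ M.q * Real.sign r + 1 := by
  linarith [neg_abs_le (M.q * Real.sign r), M.abs_weight_le r]

lemma weight_le (r : ℝ) : M.q * Real.sign r + 1 ≤ 2 := by
  linarith [le_abs_self (M.q * Real.sign r), M.abs_weight_le r]

/-- Folding leaves the tangential part alone and replaces |x_ν - y_ν| by the larger |x_ν| + |y_ν|.
The absorbed part of the kernel is therefore nonnegative. -/
lemma gauss_fold_le {t : ℝ} (ht : 0 < t) (x y : E d) :
    M.gauss t (M.fold x - M.foldNeg y) ≤ M.gauss t (y - x) := by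
  have hκ := M.gaussConst_pos
  have hs := M.sig_pos'
  rw [M.gauss_sub_comm t y x, gauss_eq_tang, gauss_eq_tang, tang_sub, tang_sub, tang_fold,
    tang_foldNeg]
  have h : ⟪x - y, M.ν⟫ ^ 2 ≤ ⟪M.fold x - M.foldNeg y, M.ν⟫ ^ 2 := by
    rw [inner_sub_left, inner_sub_left, inner_fold, inner_foldNeg, sub_neg_eq_add, sq_le_sq,
      abs_of_nonneg (by positivity : 0 ≤ |⟪x, M.ν⟫| + |⟪y, M.ν⟫|)]
    exact abs_sub _ _
  gcongr

lemma kernel_nonneg {t : ℝ} (ht : 0 < t) (x y : E d) : 0 ≤ M.kernel t x y :=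
  add_nonneg (sub_nonneg.2 (M.gauss_fold_le ht x y))
    (mul_nonneg (M.weight_nonneg _) (M.oblique_nonneg ht (M.inner_fold_sub_foldNeg_nonneg x y)))

/-- In the scale r = ‖v‖/√t the factor v_ν/t costs one (√t)⁻¹ beyond the Gaussian normalisation. The
later integral over θ of exp(-cθ²/t) gives the √t back. -/
lemma exists_passage_le : ∃ C > 0, ∀ t : ℝ, 0 < t → ∀ v : E d,
    M.passage t v ≤ C * (√t)⁻¹ * (√t ^ d)⁻¹ * Real.exp (-(M.lam / 4 / t) * ‖v‖ ^ 2) := by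
  have hl := M.lam_pos
  have hκ := M.gaussConst_pos
  refine ⟨(‖M.ν‖ * Real.exp (1 / M.lam) + 1) * M.gaussConst, by positivity, fun t ht v => ?_⟩
  have ht' : 0 < √t := Real.sqrt_pos.2 ht
  have hsq : √t ^ 2 = t := Real.sq_sqrt ht.le
  set r := ‖v‖ / √t with hr
  have hr0 : 0 ≤ r := by positivity
  have h1 := one_add_pow_mul_exp_neg_le 1 (ε := M.lam / 2) (by positivity) hr0
  have e1 : ((1 : ℕ) : ℝ) ^ 2 / (2 * (M.lam / 2)) = 1 / M.lam := by push_cast; field_simp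
  have e2 : M.lam / (2 * t) * ‖v‖ ^ 2 = M.lam / 2 * r ^ 2 := by
    rw [hr, div_pow, hsq]; field_simp
  have e3 : M.lam / 2 / 2 * r ^ 2 = M.lam / 4 / t * ‖v‖ ^ 2 := by
    rw [hr, div_pow, hsq]; field_simp; ring
  rw [e1, pow_one, neg_mul, neg_mul, e3] at h1
  have h2 : ⟪v, M.ν⟫ / t ≤ ‖M.ν‖ * (√t)⁻¹ * (1 + r) := by
    calc ⟪v, M.ν⟫ / t ≤ ‖M.ν‖ * ‖v‖ / t := by
          gcongr; exact (le_abs_self _).trans (M.norm_inner_nu_le v)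
      _ = ‖M.ν‖ * (√t)⁻¹ * r := by
          rw [hr]; nth_rewrite 1 [← hsq]; field_simp
      _ ≤ _ := by gcongr; linarith
  have h3 := M.gauss_le ht v
  rw [neg_mul, e2] at h3
  calc M.passage t v ≤ ‖M.ν‖ * (√t)⁻¹ * (1 + r) *
        (M.gaussConst * (√t ^ d)⁻¹ * Real.exp (-(M.lam / 2 * r ^ 2))) := by
        unfold passage
        exact mul_le_mul h2 h3 (M.gauss_pos ht v).le (by positivity)
    _ = ‖M.ν‖ * (√t)⁻¹ * (M.gaussConst * (√t ^ d)⁻¹) *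
        ((1 + r) * Real.exp (-(M.lam / 2 * r ^ 2))) := by ring
    _ ≤ ‖M.ν‖ * (√t)⁻¹ * (M.gaussConst * (√t ^ d)⁻¹) *
        (Real.exp (1 / M.lam) * Real.exp (-(M.lam / 4 / t * ‖v‖ ^ 2))) := by
        exact mul_le_mul_of_nonneg_left h1 (by positivity)
    _ = (‖M.ν‖ * Real.exp (1 / M.lam)) * M.gaussConst * (√t)⁻¹ * (√t ^ d)⁻¹ *
        Real.exp (-(M.lam / 4 / t) * ‖v‖ ^ 2) := by rw [neg_mul]; ring
    _ ≤ _ := by gcongr; linarith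

/-- The Gaussian upper bound of the transition density. -/
lemma exists_kernel_le : ∃ C > 0, ∃ c > 0, ∀ t : ℝ, 0 < t → ∀ x y : E d,
    M.kernel t x y ≤ C * (√t ^ d)⁻¹ * Real.exp (-(c / t) * ‖y - x‖ ^ 2) := by
  have hl := M.lam_pos
  have hκ := M.gaussConst_pos
  obtain ⟨C, hC, hp⟩ := M.exists_passage_le
  obtain ⟨c, hc, hf⟩ := M.exists_exp_fold_le
  set c₁ := c * (M.lam / 4) with hc₁
  have hc₁p : 0 < c₁ := by positivity
  refine ⟨M.gaussConst + 2 * (C * √(Real.pi / c₁)), by positivity, min c₁ (M.lam / 2),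
    by positivity, fun t ht x y => ?_⟩
  have ht' : 0 < √t := Real.sqrt_pos.2 ht
  have ho : M.oblique t (M.fold x - M.foldNeg y) ≤
      C * √(Real.pi / c₁) * (√t ^ d)⁻¹ * Real.exp (-(c₁ / t) * ‖y - x‖ ^ 2) := by
    have hgi : Integrable (fun θ : ℝ => C * (√t)⁻¹ * (√t ^ d)⁻¹ *
        (Real.exp (-(c₁ / t) * ‖y - x‖ ^ 2) * Real.exp (-(c₁ / t) * θ ^ 2))) :=
      ((integrable_exp_neg_mul_sq (by positivity)).const_mul _).const_mul _
    calc M.oblique t (M.fold x - M.foldNeg y)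
        ≤ ∫ θ in Set.Ioi (0 : ℝ), C * (√t)⁻¹ * (√t ^ d)⁻¹ *
            (Real.exp (-(c₁ / t) * ‖y - x‖ ^ 2) * Real.exp (-(c₁ / t) * θ ^ 2)) := by
          refine setIntegral_mono_on (M.integrable_passage_line ht _).integrableOn
            hgi.integrableOn measurableSet_Ioi fun θ hθ => (hp t ht _).trans ?_
          refine mul_le_mul_of_nonneg_left ?_ (by positivity)
          have := hf (M.lam / 4 / t) (by positivity) x y θ (le_of_lt hθ)
          rwa [← mul_div_assoc] at this
      _ = C * (√t)⁻¹ * (√t ^ d)⁻¹ * (Real.exp (-(c₁ / t) * ‖y - x‖ ^ 2) *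
            (√(Real.pi / (c₁ / t)) / 2)) := by
          rw [integral_const_mul, integral_const_mul, integral_gaussian_Ioi]
      _ ≤ C * (√t)⁻¹ * (√t ^ d)⁻¹ * (Real.exp (-(c₁ / t) * ‖y - x‖ ^ 2) *
            √(Real.pi / (c₁ / t))) := by
          gcongr; linarith [Real.sqrt_nonneg (Real.pi / (c₁ / t))]
      _ = _ := by
          have : √(Real.pi / (c₁ / t)) = √(Real.pi / c₁) * √t := by
            rw [← Real.sqrt_mul (by positivity)]; congr 1; field_simp
          rw [this]; field_simp
  have hg := M.gauss_le ht (y - x)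
  have hw : (M.q * Real.sign ⟪y, M.ν⟫ + 1) * M.oblique t (M.fold x - M.foldNeg y) ≤
      2 * (C * √(Real.pi / c₁) * (√t ^ d)⁻¹ * Real.exp (-(c₁ / t) * ‖y - x‖ ^ 2)) :=
    mul_le_mul (M.weight_le _) ho (M.oblique_nonneg ht (M.inner_fold_sub_foldNeg_nonneg x y))
      (by norm_num)
  have hpos := (M.gauss_pos ht (M.fold x - M.foldNeg y)).le
  have e1 : Real.exp (-(c₁ / t) * ‖y - x‖ ^ 2) ≤
      Real.exp (-(min c₁ (M.lam / 2) / t) * ‖y - x‖ ^ 2) := by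
    gcongr; exact min_le_left _ _
  have e2 : Real.exp (-(M.lam / (2 * t)) * ‖y - x‖ ^ 2) ≤
      Real.exp (-(min c₁ (M.lam / 2) / t) * ‖y - x‖ ^ 2) := by
    rw [← div_div]
    gcongr; exact min_le_right _ _
  set X := Real.exp (-(min c₁ (M.lam / 2) / t) * ‖y - x‖ ^ 2)
  calc M.kernel t x y ≤ M.gaussConst * (√t ^ d)⁻¹ * Real.exp (-(M.lam / (2 * t)) * ‖y - x‖ ^ 2) +
        2 * (C * √(Real.pi / c₁) * (√t ^ d)⁻¹ * Real.exp (-(c₁ / t) * ‖y - x‖ ^ 2)) := by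
        unfold kernel; linarith
    _ ≤ M.gaussConst * (√t ^ d)⁻¹ * X + 2 * (C * √(Real.pi / c₁) * (√t ^ d)⁻¹ * X) := by gcongr
    _ = _ := by ring

lemma integrable_kernel {t : ℝ} (ht : 0 < t) (x : E d) : Integrable (M.kernel t x) := by
  obtain ⟨C, hC, c, hc, h⟩ := M.exists_kernel_le
  refine (((integrable_exp_neg_mul_sq_norm (d := d) (ε := c / t) (by positivity)).comp_sub_right
    x).const_mul (C * (√t ^ d)⁻¹)).mono'
    ((M.measurable_kernel ht).comp measurable_prodMk_left).aestronglyMeasurable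
    (ae_of_all _ fun y => ?_)
  rw [Real.norm_of_nonneg (M.kernel_nonneg ht x y)]
  exact h t ht x y

/-! ### Integration over half-spaces -/

/-- The half-space `0 < (z, ν)`. -/
def upper : Set (E d) := {z | 0 < ⟪z, M.ν⟫}

lemma measurableSet_upper : MeasurableSet M.upper :=
  (isOpen_lt continuous_const (by fun_prop)).measurableSet

lemma mem_S_iff (z : E d) : z ∈ S M.ν ↔ ⟪z, M.ν⟫ = 0 :=
  Submodule.mem_orthogonal_singleton_iff_inner_left

lemma ae_inner_ne_zero : ∀ᵐ z : E d, ⟪z, M.ν⟫ ≠ 0 := by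
  have h : volume ((S M.ν : Submodule ℝ (E d)) : Set (E d)) = 0 := by
    refine Measure.addHaar_submodule _ _ fun h => ?_
    have : M.N ∈ S M.ν := h ▸ Submodule.mem_top
    rw [mem_S_iff] at this
    exact M.sig_pos.ne' this
  have h' := measure_eq_zero_iff_ae_notMem.1 h
  filter_upwards [h'] with z hz hz'
  exact hz ((M.mem_S_iff z).2 hz')

/-- The reflection as a linear map. -/
def reflLin : E d →ₗ[ℝ] E d where
  toFun := M.refl
  map_add' := M.refl_add
  map_smul' := M.refl_smul

/-- An involution has determinant ±1, although the reflection along N need not be orthogonal. -/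
lemma measurePreserving_refl : MeasurePreserving M.refl := by
  have h1 : M.reflLin ∘ₗ M.reflLin = LinearMap.id := LinearMap.ext M.refl_refl
  have h2 : LinearMap.det M.reflLin * LinearMap.det M.reflLin = 1 := by
    rw [← LinearMap.det_comp, h1, LinearMap.det_id]
  have h3 : |(LinearMap.det M.reflLin)⁻¹| = 1 := by
    rcases mul_self_eq_one_iff.1 h2 with h | h <;> simp [h]
  refine ⟨M.continuous_refl.measurable, ?_⟩
  have := Measure.map_linearMap_addHaar_eq_smul_addHaar (volume : Measure (E d))
    (f := M.reflLin) (left_ne_zero_of_mul_eq_one h2)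
  rw [h3, ENNReal.ofReal_one, one_smul] at this
  exact this

/-- The reflection as a measurable equivalence. -/
def reflEquiv : E d ≃ᵐ E d where
  toFun := M.refl
  invFun := M.refl
  left_inv := M.refl_refl
  right_inv := M.refl_refl
  measurable_toFun := M.continuous_refl.measurable
  measurable_invFun := M.continuous_refl.measurable

lemma integrable_comp_refl {f : E d → ℝ} (hf : Integrable f) :
    Integrable fun z => f (M.refl z) :=
  M.measurePreserving_refl.integrable_comp_of_integrable hf

/-- Splitting an integral into the two half-spaces. -/
lemma integral_eq_setIntegral_upper {f : E d → ℝ} (hf : Integrable f) :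
    ∫ z, f z = ∫ z in M.upper, (f z + f (M.refl z)) := by
  rw [integral_add hf.integrableOn (M.integrable_comp_refl hf).integrableOn,
    ← integral_add_compl M.measurableSet_upper hf]
  congr 1
  have h1 := M.measurePreserving_refl.setIntegral_preimage_emb M.reflEquiv.measurableEmbedding f
    M.upperᶜ
  rw [← h1]
  -- The reflection maps the upper half-space onto the complement up to the hyperplane, which is a
  -- null set.
  refine setIntegral_congr_set ?_
  filter_upwards [M.ae_inner_ne_zero] with z hz
  refine propext (Iff.symm ?_)
  change 0 < ⟪z, M.ν⟫ ↔ ¬ (0 < ⟪M.refl z, M.ν⟫)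
  rw [inner_refl, not_lt, neg_nonpos]
  exact ⟨le_of_lt, fun h => lt_of_le_of_ne h hz.symm⟩

/-- Integrals over the half-space are invariant under tangential translations. -/
lemma setIntegral_upper_add (f : E d → ℝ) {w : E d} (hw : ⟪w, M.ν⟫ = 0) :
    ∫ z in M.upper, f (z + w) = ∫ z in M.upper, f z := by
  rw [← integral_indicator M.measurableSet_upper, ← integral_indicator M.measurableSet_upper,
    ← integral_add_right_eq_self (M.upper.indicator f) w]
  congr 1
  ext z
  by_cases hz : z ∈ M.upper
  · have hz' : z + w ∈ M.upper := by
      change 0 < ⟪z + w, M.ν⟫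
      rwa [inner_add_left, hw, add_zero]
    rw [Set.indicator_of_mem hz, Set.indicator_of_mem hz']
  · have hz' : z + w ∉ M.upper := by
      change ¬ 0 < ⟪z + w, M.ν⟫
      rwa [inner_add_left, hw, add_zero]
    rw [Set.indicator_of_notMem hz, Set.indicator_of_notMem hz']

/-- Coordinates adapted to the membrane and the oblique direction. -/
def obliqueCoord : (S M.ν × ℝ) ≃L[ℝ] E d :=
  LinearEquiv.toContinuousLinearEquiv
    { toFun := fun p => (p.1 : E d) + p.2 • M.beta
      map_add' := fun p p' => by
        simp only [Prod.fst_add, Prod.snd_add, Submodule.coe_add, add_smul]; abel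
      map_smul' := fun c p => by
        simp only [Prod.smul_fst, Prod.smul_snd, Submodule.coe_smul, smul_add, smul_smul,
          smul_eq_mul, RingHom.id_apply]
      invFun := fun z => (⟨z - (⟪z, M.ν⟫ / M.sig) • M.beta, by
        rw [mem_S_iff, inner_sub_left, real_inner_smul_left, inner_beta,
          div_mul_cancel₀ _ M.sig_pos'.ne', sub_self]⟩, ⟪z, M.ν⟫ / M.sig)
      left_inv := fun p => by
        have h : ⟪(p.1 : E d), M.ν⟫ = 0 := (M.mem_S_iff _).1 p.1.2
        have h' : ⟪(p.1 : E d) + p.2 • M.beta, M.ν⟫ / M.sig = p.2 := by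
          rw [inner_add_left, h, real_inner_smul_left, inner_beta, zero_add,
            mul_div_assoc, div_self M.sig_pos'.ne', mul_one]
        ext1
        · ext1
          simp only [h', add_sub_cancel_right]
        · exact h'
      right_inv := fun z => by simp }

lemma obliqueCoord_apply (p : S M.ν × ℝ) : M.obliqueCoord p = (p.1 : E d) + p.2 • M.beta := rfl

/-- The integral over the half-space of a derivative along the oblique direction, for a function
vanishing on the membrane. -/
lemma setIntegral_upper_deriv_eq_zero {F F' : E d → ℝ}
    (hF : ∀ (z : E d) (τ : ℝ), HasDerivAt (fun τ : ℝ => F (z + τ • M.beta))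
      (F' (z + τ • M.beta)) τ)
    (h0 : ∀ z, ⟪z, M.ν⟫ = 0 → F z = 0)
    (hlim : ∀ z, ⟪z, M.ν⟫ = 0 → Tendsto (fun τ : ℝ => F (z + τ • M.beta)) atTop (𝓝 0))
    (hint : IntegrableOn F' M.upper) : ∫ z in M.upper, F' z = 0 := by
  -- The image of the product measure under linear coordinates is a Haar measure, hence a multiple
  -- of Lebesgue measure. The Jacobian is irrelevant since the integral to be computed is 0.
  set μ := Measure.map M.obliqueCoord ((volume : Measure (S M.ν)).prod (volume : Measure ℝ))
    with hμ
  have hc : (volume : Measure (E d)) =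
      ((Measure.addHaarScalarFactor volume μ : ℝ≥0) : ENNReal) • μ :=
    Measure.isAddLeftInvariant_eq_smul volume μ
  have hc0 : ((Measure.addHaarScalarFactor volume μ : ℝ≥0) : ENNReal) ≠ 0 := by
    exact_mod_cast (Measure.addHaarScalarFactor_pos_of_isAddHaarMeasure volume μ).ne'
  have hct : ((Measure.addHaarScalarFactor volume μ : ℝ≥0) : ENNReal) ≠ ⊤ := ENNReal.coe_ne_top
  have hemb : MeasurableEmbedding M.obliqueCoord :=
    M.obliqueCoord.toHomeomorph.measurableEmbedding
  rw [← integrable_indicator_iff M.measurableSet_upper, hc] at hint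
  rw [← integral_indicator M.measurableSet_upper, hc, integral_smul_measure,
    hemb.integral_map]
  have hint' : Integrable (fun p => M.upper.indicator F' (M.obliqueCoord p))
      ((volume : Measure (S M.ν)).prod (volume : Measure ℝ)) := by
    have := (integrable_smul_measure hc0 hct).1 hint
    exact hemb.integrable_map_iff.1 this
  rw [integral_prod _ hint']
  -- On almost every ray in direction β the fundamental theorem of calculus applies; F vanishes at
  -- the foot of the ray and at infinity.
  have hz : ∀ᵐ w : S M.ν, ∫ τ : ℝ, M.upper.indicator F' (M.obliqueCoord (w, τ)) = 0 := by
    filter_upwards [hint'.prod_right_ae] with w hw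
    have hw0 : ⟪(w : E d), M.ν⟫ = 0 := (M.mem_S_iff _).1 w.2
    have e : ∀ τ : ℝ, M.upper.indicator F' (M.obliqueCoord (w, τ)) =
        (Set.Ioi (0 : ℝ)).indicator (fun τ => F' ((w : E d) + τ • M.beta)) τ := by
      intro τ
      have : (M.obliqueCoord (w, τ) ∈ M.upper) ↔ τ ∈ Set.Ioi (0 : ℝ) := by
        rw [obliqueCoord_apply]
        simp only [upper, Set.mem_ofPred_eq, inner_add_left, hw0, real_inner_smul_left, inner_beta,
          zero_add, Set.mem_Ioi]
        exact mul_pos_iff_of_pos_right M.sig_pos'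
      by_cases hτ : τ ∈ Set.Ioi (0 : ℝ)
      · rw [Set.indicator_of_mem (this.2 hτ), Set.indicator_of_mem hτ, obliqueCoord_apply]
      · rw [Set.indicator_of_notMem (fun h => hτ (this.1 h)), Set.indicator_of_notMem hτ]
    simp only [e] at hw ⊢
    rw [integral_indicator measurableSet_Ioi]
    rw [integrable_indicator_iff measurableSet_Ioi] at hw
    rw [integral_Ioi_of_hasDerivAt_of_tendsto' (fun τ _ => hF w τ) hw (hlim w hw0)]
    simp [h0 _ hw0]
  rw [integral_congr_ae hz]
  simp

/-! ### Conservation of mass -/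

/-- The same problem with conormal reflection. -/
def straight : Setup d := { M with α := 0, α_tangent := inner_zero_left _ }

lemma integrable_passage_pair {t : ℝ} (ht : 0 < t) (x : E d) :
    Integrable (fun η : E d × ℝ => M.passage t (x - M.foldNeg η.1 + η.2 • M.beta))
      (pairMeasure d) := by
  have := M.integrable_mix_superposition 0 1 (μ := pairMeasure d) (w := fun _ => 1) (C₀ := 1)
    (ξ := fun η : E d × ℝ => M.foldNeg η.1 - η.2 • M.beta)
    (Continuous.measurable (by fun_prop)) measurable_const (by simp)
    (fun ε hε => M.integrable_exp_foldNeg_pair hε) ht x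
  simpa [mix_zero_one, sub_sub_eq_add_sub, sub_add_eq_add_sub] using this

lemma tendsto_norm_add_smul_beta (v : E d) :
    Tendsto (fun θ : ℝ => ‖v + θ • M.beta‖) atTop atTop := by
  have hb := norm_pos_iff.2 M.beta_ne_zero
  refine tendsto_atTop_mono (f := fun θ : ℝ => θ * ‖M.beta‖ - ‖v‖) (fun θ => ?_) ?_
  · have h1 : ‖θ • M.beta‖ ≤ ‖v + θ • M.beta‖ + ‖v‖ := by
      calc ‖θ • M.beta‖ = ‖(v + θ • M.beta) - v‖ := by rw [add_sub_cancel_left]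
        _ ≤ _ := norm_sub_le _ _
    rw [norm_smul, Real.norm_eq_abs] at h1
    nlinarith [le_abs_self θ]
  · exact tendsto_atTop_add_const_right _ _ (tendsto_id.atTop_mul_const hb)

lemma tendsto_gauss_line {t : ℝ} (ht : 0 < t) (v : E d) :
    Tendsto (fun θ : ℝ => M.gauss t (v + θ • M.beta)) atTop (𝓝 0) := by
  have hl := M.lam_pos
  have h1 : Tendsto (fun θ : ℝ => M.gaussConst * (√t ^ d)⁻¹ *
      Real.exp (-(M.lam / (2 * t) * ‖v + θ • M.beta‖ ^ 2))) atTop (𝓝 0) := by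
    rw [show (0 : ℝ) = M.gaussConst * (√t ^ d)⁻¹ * 0 by simp]
    refine Tendsto.const_mul _ (Real.tendsto_exp_neg_atTop_nhds_zero.comp ?_)
    exact Tendsto.const_mul_atTop (by positivity)
      ((tendsto_pow_atTop two_ne_zero).comp (M.tendsto_norm_add_smul_beta v))
  refine squeeze_zero (fun θ => (M.gauss_pos ht _).le) (fun θ => ?_) h1
  rw [← neg_mul]
  exact M.gauss_le ht _

/-- For α = 0 the ray runs along N, where the passage density is minus the derivative of the
Gaussian, so the integral telescopes. -/
lemma straight_oblique {t : ℝ} (ht : 0 < t) (v : E d) : M.straight.oblique t v = M.gauss t v := by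
  have hb : M.straight.beta = M.N := add_zero _
  have h1 : ∀ τ ∈ Set.Ici (0 : ℝ), HasDerivAt (fun τ : ℝ => M.gauss t (v + τ • M.N))
      (-M.passage t (v + τ • M.N)) τ := by
    intro τ _
    rw [passage_eq_neg_gaussDeriv, neg_neg]
    exact M.hasDerivAt_gauss_line t v M.N τ
  have h2 : Integrable (fun τ : ℝ => M.passage t (v + τ • M.N)) := by
    have := M.straight.integrable_passage_line ht v
    rw [hb] at this
    exact this
  have h3 := M.straight.tendsto_gauss_line ht v
  rw [hb] at h3
  have h4 := integral_Ioi_of_hasDerivAt_of_tendsto' h1 h2.neg.integrableOn h3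
  rw [integral_neg, zero_sub, neg_inj, zero_smul, add_zero] at h4
  rw [oblique, hb]
  exact h4

/-- By Fubini the half-space is integrated first, at fixed θ. There the drift θα is a tangential
translation, under which the half-space integral is invariant, so α may be replaced by 0. -/
lemma setIntegral_upper_oblique {t : ℝ} (ht : 0 < t) (x : E d) :
    ∫ y in M.upper, M.oblique t (x - M.refl y) = ∫ y in M.upper, M.gauss t (x - M.refl y) := by
  have swap : ∀ L : Setup d, ∫ y in L.upper, L.oblique t (x - L.refl y) =
      ∫ θ in Set.Ioi (0 : ℝ), ∫ y in L.upper, L.passage t (x - L.refl y + θ • L.beta) := by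
    intro L
    have h1 : ∀ y ∈ L.upper, L.oblique t (x - L.refl y) =
        ∫ θ in Set.Ioi (0 : ℝ), L.passage t (x - L.foldNeg y + θ • L.beta) := by
      intro y hy
      rw [L.foldNeg_of_nonneg (le_of_lt hy)]; rfl
    rw [setIntegral_congr_fun L.measurableSet_upper h1, integral_integral_swap]
    · refine integral_congr_ae (ae_of_all _ fun θ => ?_)
      refine setIntegral_congr_fun L.measurableSet_upper fun y hy => ?_
      rw [L.foldNeg_of_nonneg (le_of_lt hy)]
    · refine (L.integrable_passage_pair ht x).mono_measure ?_
      exact Measure.prod_mono Measure.restrict_le_self le_rfl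
  rw [swap M]
  have h0 : ∫ y in M.upper, M.gauss t (x - M.refl y) =
      ∫ y in M.straight.upper, M.straight.oblique t (x - M.straight.refl y) := by
    simp only [straight_oblique M ht]; rfl
  rw [h0, swap M.straight]
  refine integral_congr_ae (ae_of_all _ fun θ => ?_)
  have h2 := M.setIntegral_upper_add (fun y => M.passage t (x - M.refl y + θ • M.beta))
    (w := θ • M.α) (by rw [real_inner_smul_left, M.α_tangent, mul_zero])
  simp only
  rw [← h2]
  have hb : M.straight.beta = M.N := add_zero _
  rw [hb]
  refine setIntegral_congr_fun M.measurableSet_upper fun y _ => ?_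
  change _ = M.passage t (x - M.refl y + θ • M.N)
  congr 1
  rw [refl_add, refl_smul, M.refl_of_tangent M.α_tangent, beta]
  module

lemma sign_of_mem_upper {y : E d} (hy : y ∈ M.upper) : Real.sign ⟪y, M.ν⟫ = 1 :=
  Real.sign_of_pos hy

lemma foldNeg_refl (y : E d) : M.foldNeg (M.refl y) = M.foldNeg y := by
  rcases le_total 0 ⟪y, M.ν⟫ with h | h
  · rw [M.foldNeg_of_nonneg h, M.foldNeg_of_nonpos (by rw [inner_refl]; linarith)]
  · rw [M.foldNeg_of_nonpos h, M.foldNeg_of_nonneg (by rw [inner_refl]; linarith), refl_refl]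

/-- Adding the values at y and at its reflection turns the weights 1 + q and 1 - q into 2, and the
two image terms cancel the doubled oblique term on the half-space. What remains is the mass of the
free Gaussian. -/
lemma integral_kernel {t : ℝ} (ht : 0 < t) (x : E d) : ∫ y, M.kernel t x y = 1 := by
  have hg : Integrable fun y => M.gauss t (y - x) := (M.integrable_gauss ht).comp_sub_right x
  have hg' : IntegrableOn (fun y => M.gauss t (M.fold x - M.refl y)) M.upper :=
    (M.integrable_comp_refl ((M.integrable_gauss ht).comp_sub_left (M.fold x))).integrableOn
  have ho' : IntegrableOn (fun y => M.oblique t (M.fold x - M.refl y)) M.upper := by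
    have h1 := (M.integrable_passage_pair ht (M.fold x)).integral_prod_left
    refine h1.integrableOn.congr_fun (fun y hy => ?_) M.measurableSet_upper
    simp only
    rw [M.foldNeg_of_nonneg (le_of_lt hy)]; rfl
  have hsum : ∀ y ∈ M.upper, M.kernel t x y + M.kernel t x (M.refl y) =
      (M.gauss t (y - x) + M.gauss t (M.refl y - x)) +
        (2 * M.oblique t (M.fold x - M.refl y) - 2 * M.gauss t (M.fold x - M.refl y)) := by
    intro y hy
    rw [kernel, kernel, foldNeg_refl, inner_refl, Real.sign_neg, M.sign_of_mem_upper hy,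
      M.foldNeg_of_nonneg (le_of_lt hy)]
    ring
  rw [M.integral_eq_setIntegral_upper (M.integrable_kernel ht x),
    setIntegral_congr_fun M.measurableSet_upper hsum, integral_add, integral_sub,
    integral_const_mul, integral_const_mul, M.setIntegral_upper_oblique ht, sub_self, add_zero,
    ← M.integral_eq_setIntegral_upper hg, integral_sub_right_eq_self (M.gauss t),
    M.integral_gauss ht]
  · exact ho'.const_mul 2
  · exact hg'.const_mul 2
  · exact hg.integrableOn.add (M.integrable_comp_refl hg).integrableOn
  · exact (ho'.const_mul 2).sub (hg'.const_mul 2)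

/-! ### The Chapman-Kolmogorov equation -/

/-- The Gaussian density absorbed at the membrane. -/
def absorbed (t : ℝ) (x z : E d) : ℝ := M.gauss t (x - z) - M.gauss t (x - M.refl z)

/-- The derivative of `absorbed` in the second variable along the oblique direction. -/
def absorbedDeriv (t : ℝ) (x z : E d) : ℝ :=
  -M.gaussDeriv t M.beta (x - z) - M.gaussDeriv t (M.N - M.α) (x - M.refl z)

/-- The Gaussian density with oblique reflection at the membrane. -/
def reflected (t : ℝ) (x z : E d) : ℝ := M.absorbed t x z + 2 * M.oblique t (x - M.refl z)

lemma gaussDeriv_add_dir (t : ℝ) (w w' v : E d) :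
    M.gaussDeriv t (w + w') v = M.gaussDeriv t w v + M.gaussDeriv t w' v := by
  simp only [gaussDeriv, inner_add_right]; ring

lemma gaussDeriv_neg_dir (t : ℝ) (w v : E d) :
    M.gaussDeriv t (-w) v = -M.gaussDeriv t w v := by
  simp only [gaussDeriv, inner_neg_right]; ring

lemma gaussDeriv_sub_dir (t : ℝ) (w w' v : E d) :
    M.gaussDeriv t (w - w') v = M.gaussDeriv t w v - M.gaussDeriv t w' v := by
  rw [sub_eq_add_neg, gaussDeriv_add_dir, gaussDeriv_neg_dir, sub_eq_add_neg]

lemma gaussDeriv_neg (t : ℝ) (w v : E d) : M.gaussDeriv t w (-v) = -M.gaussDeriv t w v := by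
  simp only [gaussDeriv, gauss_neg, map_neg, inner_neg_left]; ring

lemma gaussDeriv_sub_comm (t : ℝ) (w v v' : E d) :
    M.gaussDeriv t w (v - v') = -M.gaussDeriv t w (v' - v) := by
  rw [← gaussDeriv_neg, neg_sub]

lemma mixD_one_zero (t : ℝ) (w v : E d) : M.mixD 1 0 t v w = M.gaussDeriv t w v := by
  rw [mixD_apply, mixPoly, gaussDeriv]; ring

@[fun_prop]
lemma continuous_gaussDeriv (t : ℝ) (w : E d) : Continuous (M.gaussDeriv t w) := by
  unfold gaussDeriv; fun_prop

lemma exists_gaussDeriv_le {t : ℝ} (ht : 0 < t) (w : E d) : ∃ C > 0, ∃ ε > 0, ∀ v : E d,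
    |M.gaussDeriv t w v| ≤ C * Real.exp (-ε * ‖v‖ ^ 2) := by
  obtain ⟨C, hC, ε, hε, h⟩ := M.exists_mix_bounds 1 0 ht ht w
  exact ⟨C, hC, ε, hε, fun v => by
    rw [← mixD_one_zero]; exact (h t le_rfl le_rfl v).2.2.1⟩

lemma integrable_gaussDeriv {t : ℝ} (ht : 0 < t) (w : E d) : Integrable (M.gaussDeriv t w) := by
  obtain ⟨C, hC, ε, hε, h⟩ := M.exists_gaussDeriv_le ht w
  exact ((integrable_exp_neg_mul_sq_norm hε).const_mul C).mono'
    (M.continuous_gaussDeriv t w).aestronglyMeasurable (ae_of_all _ h)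

lemma gauss_le_const {t : ℝ} (ht : 0 < t) (v : E d) :
    M.gauss t v ≤ M.gaussConst * (√t ^ d)⁻¹ := by
  have hκ := M.gaussConst_pos
  refine mul_le_of_le_one_right (by positivity) (Real.exp_le_one_iff.2 ?_)
  have := M.quad_nonneg v
  rw [neg_nonpos]; positivity

/-- The semigroup identity differentiated in y along w. The integral is read as a superposition with
weight z ↦ `gauss s (x - z)` and shift z, so differentiation under the integral is already
available. -/
lemma integral_gauss_mul_gaussDeriv {s t : ℝ} (hs : 0 < s) (ht : 0 < t) (w x y : E d) :
    ∫ z, M.gauss s (x - z) * M.gaussDeriv t w (z - y) = M.gaussDeriv (s + t) w (x - y) := by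
  have hst : 0 < s + t := by positivity
  have hint : ∀ ε > 0, Integrable (fun z : E d => Real.exp (-ε * ‖(id z : E d)‖ ^ 2)) :=
    fun ε hε => integrable_exp_neg_mul_sq_norm hε
  have hw : Measurable fun z => M.gauss s (x - z) := Continuous.measurable (by fun_prop)
  have hwb : ∀ z, |M.gauss s (x - z)| ≤ M.gaussConst * (√s ^ d)⁻¹ := fun z => by
    rw [abs_of_pos (M.gauss_pos hs _)]; exact M.gauss_le_const hs _
  have h1 := M.fderiv_mix_superposition_apply 1 0 measurable_id hw hwb hint ht y w
  have h2 : (fun y => ∫ z, M.gauss s (x - z) * M.mix 1 0 t (y - id z)) =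
      fun y => M.gauss (s + t) (y - x) := by
    ext y
    simp only [mix_one_zero, id, M.gauss_sub_comm t y]
    rw [M.integral_gauss_mul_gauss hs ht, gauss_sub_comm]
  rw [h2] at h1
  have h3 := ((M.hasFDerivAt_mix 1 0 (s + t) (y - x)).comp y ((hasFDerivAt_id y).sub_const x)).fderiv
  rw [mix_one_zero] at h3
  have h4 : fderiv ℝ (fun y => M.gauss (s + t) (y - x)) y w = M.gaussDeriv (s + t) w (y - x) := by
    rw [← mixD_one_zero]
    exact congrArg (fun L : E d →L[ℝ] ℝ => L w) h3
  rw [h4] at h1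
  simp only [mixD_one_zero, id] at h1
  rw [gaussDeriv_sub_comm, h1, ← integral_neg]
  congr 1
  ext z
  rw [gaussDeriv_sub_comm]; ring

lemma absorbed_refl_left (t : ℝ) (z y : E d) :
    M.absorbed t (M.refl z) y = -M.absorbed t z y := by
  rw [absorbed, absorbed, ← M.gauss_refl t (M.refl z - y), ← M.gauss_refl t (M.refl z - M.refl y),
    refl_sub, refl_sub, refl_refl, refl_refl]
  ring

lemma refl_beta : M.refl M.beta = -(M.N - M.α) := by
  rw [beta, refl_add, refl_N, M.refl_of_tangent M.α_tangent]; abel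

/-- Differentiation acts on the second variable, so the oddness of the absorbed density in the first
one survives. -/
lemma absorbedDeriv_refl_left (t : ℝ) (z y : E d) :
    M.absorbedDeriv t (M.refl z) y = -M.absorbedDeriv t z y := by
  have h1 : M.gaussDeriv t M.beta (M.refl z - y) = -M.gaussDeriv t (M.N - M.α) (z - M.refl y) := by
    rw [← gaussDeriv_neg_dir, ← refl_beta, ← M.gaussDeriv_refl, refl_sub, refl_refl]
  have h2 : M.gaussDeriv t (M.N - M.α) (M.refl z - M.refl y) = -M.gaussDeriv t M.beta (z - y) := by
    rw [← refl_sub, gaussDeriv_refl, ← neg_neg (M.N - M.α), ← refl_beta, ← gaussDeriv_neg_dir]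
    congr 1
    rw [← neg_one_smul ℝ, refl_smul, refl_refl, neg_one_smul]
  rw [absorbedDeriv, absorbedDeriv, h1, h2]
  ring

/-- Absorption turns integrals against odd functions into Gaussian integrals. -/
lemma setIntegral_absorbed_mul {s : ℝ} (hs : 0 < s) (x : E d) {g : E d → ℝ}
    (hodd : ∀ z, g (M.refl z) = -g z) (hg : Integrable g) :
    ∫ z in M.upper, M.absorbed s x z * g z = ∫ z, M.gauss s (x - z) * g z := by
  have hi : Integrable fun z => M.gauss s (x - z) * g z := by
    refine hg.bdd_mul (c := M.gaussConst * (√s ^ d)⁻¹)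
      (Continuous.aestronglyMeasurable (by fun_prop)) (ae_of_all _ fun z => ?_)
    rw [Real.norm_of_nonneg (M.gauss_pos hs _).le]
    exact M.gauss_le_const hs _
  rw [M.integral_eq_setIntegral_upper hi]
  refine setIntegral_congr_fun M.measurableSet_upper fun z _ => ?_
  simp only [absorbed, hodd]
  ring

lemma setIntegral_absorbed_mul_absorbed {s t : ℝ} (hs : 0 < s) (ht : 0 < t) (x y : E d) :
    ∫ z in M.upper, M.absorbed s x z * M.absorbed t z y = M.absorbed (s + t) x y := by
  rw [M.setIntegral_absorbed_mul hs x (M.absorbed_refl_left t · y)]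
  · simp only [absorbed, mul_sub]
    rw [integral_sub (M.integrable_gauss_mul_gauss hs ht x y)
      (M.integrable_gauss_mul_gauss hs ht x _), M.integral_gauss_mul_gauss hs ht,
      M.integral_gauss_mul_gauss hs ht]
  · exact ((M.integrable_gauss ht).comp_sub_right y).sub ((M.integrable_gauss ht).comp_sub_right _)

lemma integrable_gauss_mul_gaussDeriv {s t : ℝ} (hs : 0 < s) (ht : 0 < t) (w x y : E d) :
    Integrable fun z => M.gauss s (x - z) * M.gaussDeriv t w (z - y) := by
  refine ((M.integrable_gaussDeriv ht w).comp_sub_right y).bdd_mul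
    (c := M.gaussConst * (√s ^ d)⁻¹)
    (Continuous.aestronglyMeasurable (by fun_prop)) (ae_of_all _ fun z => ?_)
  rw [Real.norm_of_nonneg (M.gauss_pos hs _).le]
  exact M.gauss_le_const hs _

lemma setIntegral_absorbed_mul_absorbedDeriv {s t : ℝ} (hs : 0 < s) (ht : 0 < t) (x y : E d) :
    ∫ z in M.upper, M.absorbed s x z * M.absorbedDeriv t z y = M.absorbedDeriv (s + t) x y := by
  rw [M.setIntegral_absorbed_mul hs x (M.absorbedDeriv_refl_left t · y)]
  · simp only [absorbedDeriv, mul_sub, mul_neg]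
    have h : Integrable fun z => -(M.gauss s (x - z) * M.gaussDeriv t M.beta (z - y)) :=
      (M.integrable_gauss_mul_gaussDeriv hs ht _ x y).neg
    rw [integral_sub h (M.integrable_gauss_mul_gaussDeriv hs ht _ x _), integral_neg,
      M.integral_gauss_mul_gaussDeriv hs ht, M.integral_gauss_mul_gaussDeriv hs ht]
  · exact ((M.integrable_gaussDeriv ht _).comp_sub_right y).neg.sub
      ((M.integrable_gaussDeriv ht _).comp_sub_right _)

lemma hasDerivAt_absorbed_right (t : ℝ) (x z : E d) (τ : ℝ) :
    HasDerivAt (fun τ : ℝ => M.absorbed t x (z + τ • M.beta))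
      (M.absorbedDeriv t x (z + τ • M.beta)) τ := by
  have h1 := M.hasDerivAt_gauss_line t (x - z) (-M.beta) τ
  have h2 := M.hasDerivAt_gauss_line t (x - M.refl z) (M.N - M.α) τ
  refine ((h1.sub h2).congr_deriv ?_).congr_of_eventuallyEq (Eventually.of_forall fun τ => ?_)
  · rw [absorbedDeriv, gaussDeriv_neg_dir, refl_add, refl_smul, refl_beta]
    congr 3 <;> module
  · simp only [absorbed, refl_add, refl_smul, refl_beta, Pi.sub_apply]
    congr 2 <;> module

/-- Moving both points along β leaves the direct Gaussian unchanged. In the image term the reflected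
β is -(N - α), so the two motions add up to 2N, whence twice the passage density. -/
lemma hasDerivAt_absorbed_left (t : ℝ) (x z : E d) (τ : ℝ) :
    HasDerivAt (fun τ : ℝ => M.absorbed t (x + τ • M.beta) z)
      (2 * M.passage t (x + τ • M.beta - M.refl z) - M.absorbedDeriv t (x + τ • M.beta) z) τ := by
  have h1 := M.hasDerivAt_gauss_line t (x - z) M.beta τ
  have h2 := M.hasDerivAt_gauss_line t (x - M.refl z) M.beta τ
  refine ((h1.sub h2).congr_deriv ?_).congr_of_eventuallyEq (Eventually.of_forall fun τ => ?_)
  · rw [absorbedDeriv, passage_eq_neg_gaussDeriv, gaussDeriv_sub_dir,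
      show x + τ • M.beta - M.refl z = x - M.refl z + τ • M.beta by abel,
      show x + τ • M.beta - z = x - z + τ • M.beta by abel, beta, gaussDeriv_add_dir,
      gaussDeriv_add_dir]
    ring
  · simp only [absorbed, Pi.sub_apply]
    congr 2 <;> abel

/-- A shift of the starting point by τβ changes the domain of the θ-integral from (0, ∞) to (τ, ∞).
-/
lemma hasDerivAt_oblique {t : ℝ} (ht : 0 < t) (v : E d) (τ : ℝ) :
    HasDerivAt (fun τ : ℝ => M.oblique t (v + τ • M.beta)) (-M.passage t (v + τ • M.beta)) τ := by
  have hi := M.integrable_passage_line ht v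
  have e : ∀ τ : ℝ, M.oblique t (v + τ • M.beta) = (∫ θ in Set.Ioi (0 : ℝ),
      M.passage t (v + θ • M.beta)) - ∫ θ in (0 : ℝ)..τ, M.passage t (v + θ • M.beta) := by
    intro τ
    have h1 : M.oblique t (v + τ • M.beta) =
        ∫ θ in Set.Ioi τ, M.passage t (v + θ • M.beta) := by
      have := (measurePreserving_add_right (volume : Measure ℝ) τ).setIntegral_preimage_emb
        (measurableEmbedding_addRight τ) (fun θ : ℝ => M.passage t (v + θ • M.beta)) (Set.Ioi τ)
      rw [Set.preimage_add_const_Ioi, sub_self] at this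
      rw [← this, oblique]
      congr 1; ext θ; congr 1; module
    rw [h1, intervalIntegral.integral_Ioi_sub_Ioi' hi.integrableOn hi.integrableOn |>.symm]
    ring
  have h2 : HasDerivAt (fun τ : ℝ => ∫ θ in (0 : ℝ)..τ, M.passage t (v + θ • M.beta))
      (M.passage t (v + τ • M.beta)) τ :=
    intervalIntegral.integral_hasDerivAt_right (hi.intervalIntegrable)
      (Continuous.stronglyMeasurableAtFilter (by fun_prop) _ _)
      (Continuous.continuousAt (by fun_prop))
  refine ((h2.const_sub _)).congr_of_eventuallyEq (Eventually.of_forall e)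

/-- The factor 2 in `reflected` is the one for which the passage terms cancel. What is left is the
partner needed for integration by parts. -/
lemma hasDerivAt_reflected_left {t : ℝ} (ht : 0 < t) (x z : E d) (τ : ℝ) :
    HasDerivAt (fun τ : ℝ => M.reflected t (x + τ • M.beta) z)
      (-M.absorbedDeriv t (x + τ • M.beta) z) τ := by
  have h1 := M.hasDerivAt_absorbed_left t x z τ
  have h2 := (M.hasDerivAt_oblique ht (x - M.refl z) τ).const_mul 2
  refine ((h1.add h2).congr_deriv ?_).congr_of_eventuallyEq (Eventually.of_forall fun τ => ?_)
  · rw [show x + τ • M.beta - M.refl z = x - M.refl z + τ • M.beta by abel]; ring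
  · simp only [reflected, Pi.add_apply]
    rw [show x + τ • M.beta - M.refl z = x - M.refl z + τ • M.beta by abel]

lemma integrable_gaussDeriv_line {t : ℝ} (ht : 0 < t) (w v : E d) :
    Integrable (fun θ : ℝ => M.gaussDeriv t w (v + θ • M.beta)) := by
  obtain ⟨C, -, ε, hε, h⟩ := M.exists_gaussDeriv_le ht w
  have := integrable_superposition (μ := (volume : Measure ℝ)) (ξ := fun θ : ℝ => -(θ • M.beta))
    (w := fun _ => 1) (C₀ := 1) (by fun_prop) measurable_const (by simp)
    (fun ε hε => M.integrable_exp_smul_beta hε) (M.continuous_gaussDeriv t w) hε h v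
  simpa using this

lemma integrable_absorbedDeriv_line {t : ℝ} (ht : 0 < t) (x z : E d) :
    Integrable (fun θ : ℝ => M.absorbedDeriv t (x + θ • M.beta) z) := by
  have h1 := M.integrable_gaussDeriv_line ht M.beta (x - z)
  have h2 := M.integrable_gaussDeriv_line ht (M.N - M.α) (x - M.refl z)
  refine (h1.neg.sub h2).congr (ae_of_all _ fun θ => ?_)
  simp only [absorbedDeriv, Pi.sub_apply, Pi.neg_apply]
  rw [show x + θ • M.beta - M.refl z = x - M.refl z + θ • M.beta by abel,
      show x + θ • M.beta - z = x - z + θ • M.beta by abel]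

/-- `hasDerivAt_absorbed_left` integrated along the ray from x in direction β, at whose end the
absorbed density vanishes. -/
lemma reflected_eq_integral {t : ℝ} (ht : 0 < t) (x z : E d) :
    M.reflected t x z = ∫ θ in Set.Ioi (0 : ℝ), M.absorbedDeriv t (x + θ • M.beta) z := by
  have hlim : Tendsto (fun τ : ℝ => M.absorbed t (x + τ • M.beta) z) atTop (𝓝 0) := by
    have h1 := (M.tendsto_gauss_line ht (x - z)).sub (M.tendsto_gauss_line ht (x - M.refl z))
    rw [sub_zero] at h1
    refine h1.congr fun τ => ?_
    simp only [absorbed]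
    congr 2 <;> abel
  have hp : Integrable fun θ : ℝ => M.passage t (x + θ • M.beta - M.refl z) := by
    refine (M.integrable_passage_line ht (x - M.refl z)).congr (ae_of_all _ fun θ => ?_)
    simp only
    congr 1; abel
  have hi := M.integrable_absorbedDeriv_line ht x z
  have h := integral_Ioi_of_hasDerivAt_of_tendsto' (a := 0)
    (fun τ _ => M.hasDerivAt_absorbed_left t x z τ)
    ((hp.const_mul 2).sub hi).integrableOn hlim
  rw [integral_sub (hp.const_mul 2).integrableOn hi.integrableOn, integral_const_mul, zero_smul,
    add_zero, zero_sub] at h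
  have ho : M.oblique t (x - M.refl z) =
      ∫ θ in Set.Ioi (0 : ℝ), M.passage t (x + θ • M.beta - M.refl z) := by
    rw [oblique]; congr 1; ext θ; congr 1; abel
  rw [reflected, ho]
  linarith

/-- The same problem with total reflection. -/
def total : Setup d := { M with q := 1, abs_q_le := by simp }

/-- Identifies the obliquely reflected density with the case q = 1, so that positivity and the
Gaussian bound of the kernel become available for it. -/
lemma reflected_eq_kernel {z y : E d} (hz : 0 ≤ ⟪z, M.ν⟫) (hy : 0 < ⟪y, M.ν⟫) (t : ℝ) :
    M.reflected t z y = M.total.kernel t z y := by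
  have h1 : M.total.fold z = z := M.fold_of_nonneg hz
  have h2 : M.total.foldNeg y = M.refl y := M.foldNeg_of_nonneg hy.le
  rw [kernel, h1, h2]
  change _ = M.gauss t (y - z) - M.gauss t (z - M.refl y) +
    (1 * Real.sign ⟪y, M.ν⟫ + 1) * M.oblique t (z - M.refl y)
  rw [Real.sign_of_pos hy, reflected, absorbed, gauss_sub_comm]
  ring

lemma exists_reflected_le {t : ℝ} (ht : 0 < t) {y : E d} (hy : 0 < ⟪y, M.ν⟫) :
    ∃ C > 0, ∃ ε > 0, ∀ z : E d, 0 ≤ ⟪z, M.ν⟫ →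
      |M.reflected t z y| ≤ C * Real.exp (-ε * ‖z - y‖ ^ 2) := by
  obtain ⟨C, hC, c, hc, h⟩ := M.total.exists_kernel_le
  refine ⟨C * (√t ^ d)⁻¹, by positivity, c / t, by positivity, fun z hz => ?_⟩
  rw [M.reflected_eq_kernel hz hy, abs_of_nonneg (M.total.kernel_nonneg ht z y), norm_sub_rev]
  exact h t ht z y

lemma exists_absorbedDeriv_le {s : ℝ} (hs : 0 < s) : ∃ C > 0, ∃ ε > 0, ∀ x z : E d,
    |M.absorbedDeriv s x z| ≤ C * (Real.exp (-ε * ‖x - z‖ ^ 2) +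
      Real.exp (-ε * ‖x - M.refl z‖ ^ 2)) := by
  obtain ⟨C₁, hC₁, ε₁, hε₁, h₁⟩ := M.exists_gaussDeriv_le hs M.beta
  obtain ⟨C₂, hC₂, ε₂, hε₂, h₂⟩ := M.exists_gaussDeriv_le hs (M.N - M.α)
  refine ⟨max C₁ C₂, by positivity, min ε₁ ε₂, by positivity, fun x z => ?_⟩
  rw [absorbedDeriv, mul_add]
  refine (abs_sub _ _).trans (add_le_add ?_ ?_)
  · rw [abs_neg]
    refine (h₁ _).trans ?_
    gcongr
    · exact le_max_left _ _
    · exact min_le_left _ _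
  · refine (h₂ _).trans ?_
    gcongr
    · exact le_max_right _ _
    · exact min_le_right _ _

lemma continuous_reflected {t : ℝ} (ht : 0 < t) (y : E d) :
    Continuous fun z => M.reflected t z y := by
  have h := M.continuous_oblique ht
  have h' : Continuous fun z => M.oblique t (z - M.refl y) := h.comp (by fun_prop)
  unfold reflected absorbed
  fun_prop

lemma abs_absorbed_le {s : ℝ} (hs : 0 < s) (x z : E d) :
    |M.absorbed s x z| ≤ M.gauss s (x - z) + M.gauss s (x - M.refl z) := by
  refine (abs_sub _ _).trans_eq ?_
  rw [abs_of_pos (M.gauss_pos hs _), abs_of_pos (M.gauss_pos hs _)]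

lemma integrable_absorbed {s : ℝ} (hs : 0 < s) (x : E d) : Integrable (M.absorbed s x) :=
  ((M.integrable_gauss hs).comp_sub_left x).sub
    (M.integrable_comp_refl ((M.integrable_gauss hs).comp_sub_left x))

lemma integrable_absorbedDeriv {s : ℝ} (hs : 0 < s) (x : E d) :
    Integrable (M.absorbedDeriv s x) :=
  ((M.integrable_gaussDeriv hs _).comp_sub_left x).neg.sub
    (M.integrable_comp_refl ((M.integrable_gaussDeriv hs _).comp_sub_left x))

lemma exists_abs_reflected_le {t : ℝ} (ht : 0 < t) {y : E d} (hy : 0 < ⟪y, M.ν⟫) :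
    ∃ C > 0, ∀ z : E d, 0 ≤ ⟪z, M.ν⟫ → |M.reflected t z y| ≤ C := by
  obtain ⟨C, hC, ε, hε, h⟩ := M.exists_reflected_le ht hy
  refine ⟨C, hC, fun z hz => (h z hz).trans (mul_le_of_le_one_right hC.le ?_)⟩
  rw [Real.exp_le_one_iff]
  nlinarith [sq_nonneg ‖z - y‖]

/-- Integration by parts on the half-space. -/
lemma setIntegral_absorbedDeriv_mul_reflected {s t : ℝ} (hs : 0 < s) (ht : 0 < t) (x : E d)
    {y : E d} (hy : 0 < ⟪y, M.ν⟫) :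
    ∫ z in M.upper, M.absorbedDeriv s x z * M.reflected t z y =
      ∫ z in M.upper, M.absorbed s x z * M.absorbedDeriv t z y := by
  obtain ⟨C, hC, hR⟩ := M.exists_abs_reflected_le ht hy
  have hmem : ∀ᵐ z ∂(volume.restrict M.upper), z ∈ M.upper := ae_restrict_mem M.measurableSet_upper
  have i1 : IntegrableOn (fun z => M.absorbedDeriv s x z * M.reflected t z y) M.upper := by
    refine (M.integrable_absorbedDeriv hs x).integrableOn.mul_bdd (c := C)
      (M.continuous_reflected ht y).aestronglyMeasurable ?_
    filter_upwards [hmem] with z hz using hR z (le_of_lt hz)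
  have i2 : IntegrableOn (fun z => M.absorbed s x z * M.absorbedDeriv t z y) M.upper := by
    obtain ⟨C', hC', ε, hε, hD⟩ := M.exists_absorbedDeriv_le ht
    refine ((M.integrable_absorbed hs x).mul_bdd (c := C' * 2)
      (Continuous.aestronglyMeasurable (by unfold absorbedDeriv; fun_prop))
      (ae_of_all _ fun z => (hD z y).trans ?_)).integrableOn
    have e1 : Real.exp (-ε * ‖z - y‖ ^ 2) ≤ 1 := by
      rw [Real.exp_le_one_iff]; nlinarith [sq_nonneg ‖z - y‖]
    have e2 : Real.exp (-ε * ‖z - M.refl y‖ ^ 2) ≤ 1 := by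
      rw [Real.exp_le_one_iff]; nlinarith [sq_nonneg ‖z - M.refl y‖]
    exact mul_le_mul_of_nonneg_left (by linarith) hC'.le
  rw [← sub_eq_zero, ← integral_sub i1 i2]
  -- The derivative of this product along β is the difference of the two integrands. There is no
  -- boundary term because `absorbed` vanishes for z on the membrane; at infinity it decays while
  -- `reflected` stays bounded.
  refine M.setIntegral_upper_deriv_eq_zero (F := fun z => M.absorbed s x z * M.reflected t z y)
    (fun z τ => ?_) (fun z hz => ?_) (fun z hz => ?_) (i1.sub i2)
  · refine ((M.hasDerivAt_absorbed_right s x z τ).mul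
      (M.hasDerivAt_reflected_left ht z y τ)).congr_deriv ?_
    ring
  · simp [absorbed, M.refl_of_tangent hz]
  · have h1 : Tendsto (fun τ : ℝ => C * (M.gauss s ((z - x) + τ • M.beta) +
        M.gauss s ((z - M.refl x) + τ • M.beta))) atTop (𝓝 0) := by
      have := ((M.tendsto_gauss_line hs (z - x)).add
        (M.tendsto_gauss_line hs (z - M.refl x))).const_mul C
      simpa using this
    refine squeeze_zero_norm' ?_ h1
    filter_upwards [eventually_ge_atTop 0] with τ hτ
    have hp : 0 ≤ ⟪z + τ • M.beta, M.ν⟫ := by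
      rw [inner_add_left, hz, real_inner_smul_left, inner_beta, zero_add]
      exact mul_nonneg hτ M.sig_pos'.le
    rw [norm_mul, mul_comm]
    refine mul_le_mul (hR _ hp) ((M.abs_absorbed_le hs x _).trans_eq ?_) (norm_nonneg _) hC.le
    rw [M.gauss_sub_comm s x (z + τ • M.beta), ← M.gauss_refl s (x - M.refl (z + τ • M.beta)),
      refl_sub, refl_refl, M.gauss_sub_comm s (M.refl x)]
    congr 2 <;> abel

lemma integrable_exp_line {ε : ℝ} (hε : 0 < ε) (v : E d) :
    Integrable fun θ : ℝ => Real.exp (-ε * ‖v + θ • M.beta‖ ^ 2) := by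
  refine ((M.integrable_exp_smul_beta (half_pos hε)).const_mul (Real.exp (ε * ‖v‖ ^ 2))).mono'
    (by fun_prop) (ae_of_all _ fun θ => ?_)
  rw [Real.norm_of_nonneg (Real.exp_nonneg _)]
  simpa using exp_neg_mul_sq_norm_sub_le (ξ := -(θ • M.beta)) hε (le_refl ‖v‖)

/-- Justifies the interchange of z and θ. The direct term decays in x + θβ - z only, so decay in θ
must be borrowed from the factor in z - y; the image term decays in z - x and θ separately by the
folding estimate. -/
lemma integrable_absorbedDeriv_mul_reflected {s t : ℝ} (hs : 0 < s) (ht : 0 < t) {x y : E d}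
    (hx : 0 ≤ ⟪x, M.ν⟫) (hy : 0 < ⟪y, M.ν⟫) :
    Integrable (fun p : E d × ℝ => M.absorbedDeriv s (x + p.2 • M.beta) p.1 *
      M.reflected t p.1 y) ((volume.restrict M.upper).prod (volume.restrict (Set.Ioi 0))) := by
  obtain ⟨C₁, hC₁, ε₁, hε₁, h₁⟩ := M.exists_absorbedDeriv_le hs
  obtain ⟨C₂, hC₂, ε₂, hε₂, h₂⟩ := M.exists_reflected_le ht hy
  obtain ⟨c, hc, h₃⟩ := M.exists_exp_fold_le
  set m := min ε₁ ε₂ with hm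
  have hm0 : 0 < m := lt_min hε₁ hε₂
  have hcε : 0 < c * ε₁ := by positivity
  have I1 : Integrable (fun p : E d × ℝ => Real.exp (-(m / 2) * ‖p.1 - y‖ ^ 2) *
      Real.exp (-(m / 4) * ‖x - y + p.2 • M.beta‖ ^ 2))
      ((volume.restrict M.upper).prod (volume.restrict (Set.Ioi 0))) :=
    (((integrable_exp_neg_mul_sq_norm (half_pos hm0)).comp_sub_right y).restrict).mul_prod
      (M.integrable_exp_line (by positivity) (x - y)).restrict
  have I2 : Integrable (fun p : E d × ℝ => Real.exp (-(c * ε₁) * ‖p.1 - x‖ ^ 2) *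
      Real.exp (-(c * ε₁) * p.2 ^ 2))
      ((volume.restrict M.upper).prod (volume.restrict (Set.Ioi 0))) :=
    (((integrable_exp_neg_mul_sq_norm hcε).comp_sub_right x).restrict).mul_prod
      (integrable_exp_neg_mul_sq hcε).restrict
  refine ((I1.add I2).const_mul (C₁ * C₂)).mono' ?_ ?_
  · have hr : Continuous fun p : E d × ℝ => M.reflected t p.1 y :=
      (M.continuous_reflected ht y).comp continuous_fst
    have hd : Continuous fun p : E d × ℝ => M.absorbedDeriv s (x + p.2 • M.beta) p.1 := by
      unfold absorbedDeriv; fun_prop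
    exact (hd.mul hr).aestronglyMeasurable
  have a1 : ∀ᵐ p ∂((volume.restrict M.upper).prod (volume.restrict (Set.Ioi (0 : ℝ)))),
      p.1 ∈ M.upper :=
    Measure.quasiMeasurePreserving_fst.ae (ae_restrict_mem M.measurableSet_upper)
  have a2 : ∀ᵐ p ∂((volume.restrict M.upper).prod (volume.restrict (Set.Ioi (0 : ℝ)))),
      p.2 ∈ Set.Ioi (0 : ℝ) :=
    Measure.quasiMeasurePreserving_snd.ae (ae_restrict_mem measurableSet_Ioi)
  filter_upwards [a1, a2] with p hp1 hp2
  obtain ⟨z, θ⟩ := p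
  have hz : 0 < ⟪z, M.ν⟫ := hp1
  have hθ : 0 < θ := hp2
  simp only [Pi.add_apply]
  have hR := h₂ z hz.le
  have hD := h₁ (x + θ • M.beta) z
  rw [norm_mul, Real.norm_eq_abs, Real.norm_eq_abs]
  -- With A and B as below, ‖x - y + θβ‖² ≤ 2A² + 2B², so m/4 of it and m/2 of B² fit into m(A² +
  -- B²).
  have b1 : Real.exp (-ε₁ * ‖x + θ • M.beta - z‖ ^ 2) * Real.exp (-ε₂ * ‖z - y‖ ^ 2) ≤
      Real.exp (-(m / 2) * ‖z - y‖ ^ 2) * Real.exp (-(m / 4) * ‖x - y + θ • M.beta‖ ^ 2) := by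
    rw [← Real.exp_add, ← Real.exp_add, Real.exp_le_exp]
    set A := ‖x + θ • M.beta - z‖
    set B := ‖z - y‖
    have hAB : ‖x - y + θ • M.beta‖ ≤ A + B := by
      rw [show x - y + θ • M.beta = (x + θ • M.beta - z) + (z - y) by abel]
      exact norm_add_le _ _
    have h5 : ‖x - y + θ • M.beta‖ ^ 2 ≤ (A + B) ^ 2 := pow_le_pow_left₀ (norm_nonneg _) hAB 2
    have h6 : m * A ^ 2 ≤ ε₁ * A ^ 2 := by gcongr; exact min_le_left _ _
    have h7 : m * B ^ 2 ≤ ε₂ * B ^ 2 := by gcongr; exact min_le_right _ _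
    nlinarith [sq_nonneg (A - B)]
  have b2 : Real.exp (-ε₁ * ‖x + θ • M.beta - M.refl z‖ ^ 2) * Real.exp (-ε₂ * ‖z - y‖ ^ 2) ≤
      Real.exp (-(c * ε₁) * ‖z - x‖ ^ 2) * Real.exp (-(c * ε₁) * θ ^ 2) := by
    have h5 := h₃ ε₁ hε₁.le x z θ hθ.le
    rw [M.fold_of_nonneg hx, M.foldNeg_of_nonneg hz.le, sub_add_eq_add_sub] at h5
    refine (mul_le_of_le_one_right (Real.exp_nonneg _) ?_).trans h5
    rw [Real.exp_le_one_iff]; nlinarith [sq_nonneg ‖z - y‖]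
  calc |M.absorbedDeriv s (x + θ • M.beta) z| * |M.reflected t z y|
      ≤ (C₁ * (Real.exp (-ε₁ * ‖x + θ • M.beta - z‖ ^ 2) +
          Real.exp (-ε₁ * ‖x + θ • M.beta - M.refl z‖ ^ 2))) *
          (C₂ * Real.exp (-ε₂ * ‖z - y‖ ^ 2)) :=
        mul_le_mul hD hR (abs_nonneg _) (by positivity)
    _ = C₁ * C₂ * (Real.exp (-ε₁ * ‖x + θ • M.beta - z‖ ^ 2) * Real.exp (-ε₂ * ‖z - y‖ ^ 2) +
          Real.exp (-ε₁ * ‖x + θ • M.beta - M.refl z‖ ^ 2) * Real.exp (-ε₂ * ‖z - y‖ ^ 2)) := by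
        ring
    _ ≤ _ := mul_le_mul_of_nonneg_left (add_le_add b1 b2) (by positivity)

/-- The semigroup property of the obliquely reflected density. -/
lemma setIntegral_reflected_mul_reflected {s t : ℝ} (hs : 0 < s) (ht : 0 < t) {x y : E d}
    (hx : 0 ≤ ⟪x, M.ν⟫) (hy : 0 < ⟪y, M.ν⟫) :
    ∫ z in M.upper, M.reflected s x z * M.reflected t z y = M.reflected (s + t) x y := by
  -- Only the first factor is expanded into its θ-integral. After the interchange, integration by
  -- parts replaces the pair by absorbed times `absorbedDeriv`, which reproduces `absorbedDeriv` at
  -- time s + t, and the θ-integral reassembles.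
  have h1 : ∀ z, M.reflected s x z * M.reflected t z y =
      ∫ θ in Set.Ioi (0 : ℝ), M.absorbedDeriv s (x + θ • M.beta) z * M.reflected t z y := by
    intro z
    rw [M.reflected_eq_integral hs x z, integral_mul_const]
  simp only [h1]
  rw [integral_integral_swap (M.integrable_absorbedDeriv_mul_reflected hs ht hx hy),
    M.reflected_eq_integral (by positivity) x y]
  refine integral_congr_ae (ae_of_all _ fun θ => ?_)
  simp only
  rw [M.setIntegral_absorbedDeriv_mul_reflected hs ht _ hy,
    M.setIntegral_absorbed_mul_absorbedDeriv hs ht]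

lemma inner_fold_nonneg (x : E d) : 0 ≤ ⟪M.fold x, M.ν⟫ := by
  rw [inner_fold]; exact abs_nonneg _

lemma fold_refl_of_mem_upper {z : E d} (hz : z ∈ M.upper) : M.fold (M.refl z) = z := by
  rw [M.fold_of_nonpos, refl_refl]
  rw [inner_refl]
  exact neg_nonpos.2 (le_of_lt hz)

lemma kernel_eq_of_same_side {x y : E d} (h : (0 ≤ ⟪x, M.ν⟫ ∧ 0 ≤ ⟪y, M.ν⟫) ∨
    (⟪x, M.ν⟫ ≤ 0 ∧ ⟪y, M.ν⟫ ≤ 0)) (t : ℝ) :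
    M.kernel t x y = M.absorbed t (M.fold x) (M.fold y) +
      (M.q * Real.sign ⟪y, M.ν⟫ + 1) * M.oblique t (M.fold x - M.refl (M.fold y)) := by
  rw [kernel, absorbed, refl_fold]
  congr 2
  rcases h with ⟨hx, hy⟩ | ⟨hx, hy⟩
  · rw [M.fold_of_nonneg hx, M.fold_of_nonneg hy, gauss_sub_comm]
  · rw [M.fold_of_nonpos hx, M.fold_of_nonpos hy, ← refl_sub, gauss_refl, gauss_sub_comm]

/-- Across the membrane folding acts on the difference as the identity or the reflection, so the
free and image Gaussians coincide and only the passage term remains. -/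
lemma kernel_eq_of_opposite_side {x y : E d} (h : (0 ≤ ⟪x, M.ν⟫ ∧ ⟪y, M.ν⟫ ≤ 0) ∨
    (⟪x, M.ν⟫ ≤ 0 ∧ 0 ≤ ⟪y, M.ν⟫)) (t : ℝ) :
    M.kernel t x y =
      (M.q * Real.sign ⟪y, M.ν⟫ + 1) * M.oblique t (M.fold x - M.refl (M.fold y)) := by
  rw [kernel, refl_fold]
  rw [add_eq_right, sub_eq_zero]
  rcases h with ⟨hx, hy⟩ | ⟨hx, hy⟩
  · rw [M.fold_of_nonneg hx, M.foldNeg_of_nonpos hy, gauss_sub_comm]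
  · rw [M.fold_of_nonpos hx, M.foldNeg_of_nonneg hy, ← refl_sub, gauss_refl, gauss_sub_comm]

lemma exists_kernel_le_const {t : ℝ} (ht : 0 < t) : ∃ C > 0, ∀ x y : E d,
    ‖M.kernel t x y‖ ≤ C := by
  obtain ⟨C, hC, c, hc, h⟩ := M.exists_kernel_le
  refine ⟨C * (√t ^ d)⁻¹, by positivity, fun x y => ?_⟩
  rw [Real.norm_of_nonneg (M.kernel_nonneg ht x y)]
  refine (h t ht x y).trans (mul_le_of_le_one_right (by positivity) ?_)
  rw [Real.exp_le_one_iff]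
  have : 0 ≤ c / t * ‖y - x‖ ^ 2 := by positivity
  linarith

lemma integrable_kernel_mul_kernel {s t : ℝ} (hs : 0 < s) (ht : 0 < t) (x y : E d) :
    Integrable fun z => M.kernel s x z * M.kernel t z y := by
  obtain ⟨C, -, h⟩ := M.exists_kernel_le_const ht
  exact (M.integrable_kernel hs x).mul_bdd (c := C)
    ((M.measurable_kernel ht).comp measurable_prodMk_right).aestronglyMeasurable
    (ae_of_all _ fun z => h z y)

lemma integrableOn_absorbed_mul_absorbed {s t : ℝ} (hs : 0 < s) (ht : 0 < t) (x y : E d) :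
    Integrable (fun z => M.absorbed s x z * M.absorbed t z y) := by
  refine (M.integrable_absorbed hs x).mul_bdd
    (c := M.gaussConst * (√t ^ d)⁻¹ + M.gaussConst * (√t ^ d)⁻¹)
    (Continuous.aestronglyMeasurable ?_) (ae_of_all _ fun z => ?_)
  · have := M.continuous_gauss t
    unfold absorbed; fun_prop
  · exact (M.abs_absorbed_le ht z y).trans (add_le_add (M.gauss_le_const ht _)
      (M.gauss_le_const ht _))

lemma integrableOn_reflected_mul_reflected {s t : ℝ} (hs : 0 < s) (ht : 0 < t) {x y : E d}
    (hx : 0 ≤ ⟪x, M.ν⟫) (hy : 0 < ⟪y, M.ν⟫) :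
    IntegrableOn (fun z => M.reflected s x z * M.reflected t z y) M.upper := by
  refine (M.total.integrable_kernel_mul_kernel hs ht x y).integrableOn.congr_fun
    (fun z hz => ?_) M.measurableSet_upper
  simp only
  rw [M.reflected_eq_kernel hx hz, M.reflected_eq_kernel (le_of_lt hz) hy]

/-- The Chapman–Kolmogorov equation for the densities. -/
lemma integral_kernel_mul_kernel {s t : ℝ} (hs : 0 < s) (ht : 0 < t) (x : E d) {y : E d}
    (hy : ⟪y, M.ν⟫ ≠ 0) :
    ∫ z, M.kernel s x z * M.kernel t z y = M.kernel (s + t) x y := by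
  rw [M.integral_eq_setIntegral_upper (M.integrable_kernel_mul_kernel hs ht x y)]
  have hX := M.inner_fold_nonneg x
  have hY : 0 < ⟪M.fold y, M.ν⟫ := by rw [inner_fold]; exact abs_pos.2 hy
  set X := M.fold x with hXd
  set Y := M.fold y with hYd
  have hD := M.setIntegral_absorbed_mul_absorbed hs ht X Y
  have hR := M.setIntegral_reflected_mul_reflected hs ht hX hY
  have iD := (M.integrableOn_absorbed_mul_absorbed hs ht X Y).integrableOn (s := M.upper)
  have iR := M.integrableOn_reflected_mul_reflected hs ht hX hY
  -- Here e is 1 if x and y are on the same side and 0 otherwise. In each case 2 `oblique` is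
  -- `reflected - absorbed` and the weights of z and its reflection sum to 2, so everything reduces
  -- to the two half-space semigroups.
  have key : ∀ e : ℝ, (∀ z ∈ M.upper, M.kernel s x z * M.kernel t z y +
        M.kernel s x (M.refl z) * M.kernel t (M.refl z) y =
        e * (M.absorbed s X z * M.absorbed t z Y) + (M.q * Real.sign ⟪y, M.ν⟫ + 1) / 2 *
          (M.reflected s X z * M.reflected t z Y - M.absorbed s X z * M.absorbed t z Y)) →
      M.kernel (s + t) x y = e * M.absorbed (s + t) X Y +
        (M.q * Real.sign ⟪y, M.ν⟫ + 1) * M.oblique (s + t) (X - M.refl Y) →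
      ∫ z in M.upper, (M.kernel s x z * M.kernel t z y +
        M.kernel s x (M.refl z) * M.kernel t (M.refl z) y) = M.kernel (s + t) x y := by
    intro e h1 h2
    have iRD : IntegrableOn (fun z => (M.q * Real.sign ⟪y, M.ν⟫ + 1) / 2 *
        (M.reflected s X z * M.reflected t z Y - M.absorbed s X z * M.absorbed t z Y))
        M.upper := (iR.sub iD).const_mul _
    rw [setIntegral_congr_fun M.measurableSet_upper h1, integral_add (iD.const_mul _)
      iRD, integral_const_mul, integral_const_mul, integral_sub iR iD,
      hD, hR, h2, reflected]
    ring
  rcases le_total 0 ⟪x, M.ν⟫ with hx | hx <;> rcases lt_or_gt_of_ne hy with hy' | hy'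
  · refine key 0 (fun z hz => ?_) ?_
    · have hz' : 0 ≤ ⟪z, M.ν⟫ := le_of_lt hz
      have hz'' : ⟪M.refl z, M.ν⟫ ≤ 0 := by rw [inner_refl]; linarith
      rw [M.kernel_eq_of_same_side (.inl ⟨hx, hz'⟩), M.kernel_eq_of_opposite_side
        (.inl ⟨hz', hy'.le⟩), M.kernel_eq_of_opposite_side (.inl ⟨hx, hz''⟩),
        M.kernel_eq_of_same_side (.inr ⟨hz'', hy'.le⟩), M.fold_of_nonneg hz',
        M.fold_refl_of_mem_upper hz, inner_refl, ← hXd, ← hYd, reflected, reflected,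
        Real.sign_of_neg (neg_neg_of_pos hz), M.sign_of_mem_upper hz, Real.sign_of_neg hy']
      ring
    · rw [M.kernel_eq_of_opposite_side (.inl ⟨hx, hy'.le⟩)]; ring
  · refine key 1 (fun z hz => ?_) ?_
    · have hz' : 0 ≤ ⟪z, M.ν⟫ := le_of_lt hz
      have hz'' : ⟪M.refl z, M.ν⟫ ≤ 0 := by rw [inner_refl]; linarith
      rw [M.kernel_eq_of_same_side (.inl ⟨hx, hz'⟩), M.kernel_eq_of_same_side
        (.inl ⟨hz', hy'.le⟩), M.kernel_eq_of_opposite_side (.inl ⟨hx, hz''⟩),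
        M.kernel_eq_of_opposite_side (.inr ⟨hz'', hy'.le⟩), M.fold_of_nonneg hz',
        M.fold_refl_of_mem_upper hz, inner_refl, ← hXd, ← hYd, reflected, reflected,
        Real.sign_of_neg (neg_neg_of_pos hz), M.sign_of_mem_upper hz, Real.sign_of_pos hy']
      ring
    · rw [M.kernel_eq_of_same_side (.inl ⟨hx, hy'.le⟩)]; ring
  · refine key 1 (fun z hz => ?_) ?_
    · have hz' : 0 ≤ ⟪z, M.ν⟫ := le_of_lt hz
      have hz'' : ⟪M.refl z, M.ν⟫ ≤ 0 := by rw [inner_refl]; linarith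
      rw [M.kernel_eq_of_opposite_side (.inr ⟨hx, hz'⟩), M.kernel_eq_of_opposite_side
        (.inl ⟨hz', hy'.le⟩), M.kernel_eq_of_same_side (.inr ⟨hx, hz''⟩),
        M.kernel_eq_of_same_side (.inr ⟨hz'', hy'.le⟩), M.fold_of_nonneg hz',
        M.fold_refl_of_mem_upper hz, inner_refl, ← hXd, ← hYd, reflected, reflected,
        Real.sign_of_neg (neg_neg_of_pos hz), M.sign_of_mem_upper hz, Real.sign_of_neg hy']
      ring
    · rw [M.kernel_eq_of_same_side (.inr ⟨hx, hy'.le⟩)]; ring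
  · refine key 0 (fun z hz => ?_) ?_
    · have hz' : 0 ≤ ⟪z, M.ν⟫ := le_of_lt hz
      have hz'' : ⟪M.refl z, M.ν⟫ ≤ 0 := by rw [inner_refl]; linarith
      rw [M.kernel_eq_of_opposite_side (.inr ⟨hx, hz'⟩), M.kernel_eq_of_same_side
        (.inl ⟨hz', hy'.le⟩), M.kernel_eq_of_same_side (.inr ⟨hx, hz''⟩),
        M.kernel_eq_of_opposite_side (.inr ⟨hz'', hy'.le⟩), M.fold_of_nonneg hz',
        M.fold_refl_of_mem_upper hz, inner_refl, ← hXd, ← hYd, reflected, reflected,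
        Real.sign_of_neg (neg_neg_of_pos hz), M.sign_of_mem_upper hz, Real.sign_of_pos hy']
      ring
    · rw [M.kernel_eq_of_opposite_side (.inr ⟨hx, hy'.le⟩)]; ring

lemma integrable_kernel_mul_kernel_prod {s t : ℝ} (hs : 0 < s) (ht : 0 < t) (x : E d)
    (A : Set (E d)) :
    Integrable (fun p : E d × E d => M.kernel s x p.1 * M.kernel t p.1 p.2)
      ((volume : Measure (E d)).prod (volume.restrict A)) := by
  have hm : AEStronglyMeasurable (fun p : E d × E d => M.kernel s x p.1 * M.kernel t p.1 p.2)
      ((volume : Measure (E d)).prod (volume.restrict A)) :=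
    (((M.measurable_kernel hs).comp (measurable_const.prodMk measurable_fst)).mul
      (M.measurable_kernel ht)).aestronglyMeasurable
  rw [integrable_prod_iff hm]
  refine ⟨ae_of_all _ fun z => (M.integrable_kernel ht z).restrict.const_mul (M.kernel s x z), ?_⟩
  refine (M.integrable_kernel hs x).mono' hm.norm.integral_prod_right' (ae_of_all _ fun z => ?_)
  simp only [norm_mul, Real.norm_of_nonneg (M.kernel_nonneg hs _ _),
    Real.norm_of_nonneg (M.kernel_nonneg ht _ _)]
  rw [integral_const_mul]
  have h0 : 0 ≤ ∫ y in A, M.kernel t z y := integral_nonneg fun y => M.kernel_nonneg ht z y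
  rw [Real.norm_of_nonneg (mul_nonneg (M.kernel_nonneg hs _ _) h0)]
  refine mul_le_of_le_one_right (M.kernel_nonneg hs _ _) ?_
  rw [← M.integral_kernel ht z]
  exact setIntegral_le_integral (M.integrable_kernel ht z) (ae_of_all _ (M.kernel_nonneg ht z))

lemma isTransitionDensity_kernel : IsTransitionDensity M.kernel where
  measurable _ ht := M.measurable_kernel ht
  nonneg _ ht := M.kernel_nonneg ht
  integrable _ ht := M.integrable_kernel ht
  integral_eq_one _ ht := M.integral_kernel ht
  chapman_kolmogorov s t hs ht x A hA := by
    simp only [← integral_const_mul]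
    rw [integral_integral_swap (M.integrable_kernel_mul_kernel_prod hs ht x A)]
    refine integral_congr_ae (ae_restrict_of_ae ?_)
    -- The pointwise identity was proved only for y off the membrane, which is enough after
    -- integration over y.
    filter_upwards [M.ae_inner_ne_zero] with y hy
    exact M.integral_kernel_mul_kernel hs ht x hy

end Setup

/-! ### Gaussian determinants and the identification of G with the kernel -/

/-- The Gaussian integral of a positive definite symmetric operator. -/
lemma integral_exp_neg_inner_apply {V : Type*} [NormedAddCommGroup V] [InnerProductSpace ℝ V]
    [FiniteDimensional ℝ V] [MeasurableSpace V] [BorelSpace V] {T : V →ₗ[ℝ] V}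
    (hT : T.IsSymmetric) (hpos : ∀ v, v ≠ 0 → 0 < ⟪T v, v⟫) :
    0 < LinearMap.det T ∧ ∫ v : V, Real.exp (-(⟪T v, v⟫ / 2)) =
      √((2 * Real.pi) ^ Module.finrank ℝ V / LinearMap.det T) := by
  set n := Module.finrank ℝ V with hn
  set e := hT.eigenvectorBasis hn.symm
  set lam := hT.eigenvalues hn.symm
  have hlam : ∀ i, 0 < lam i := by
    intro i
    have h0 := hpos (e i) (norm_ne_zero_iff.1 (by rw [e.norm_eq_one]; exact one_ne_zero))
    rw [hT.apply_eigenvectorBasis hn.symm i, real_inner_smul_left,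
      real_inner_self_eq_norm_sq, e.norm_eq_one] at h0
    simpa using h0
  have hdet : LinearMap.det T = ∏ i, lam i := by
    simpa using hT.det_eq_prod_eigenvalues hn.symm
  have hin : ∀ w : Fin n → ℝ, ⟪T (e.repr.symm (WithLp.toLp 2 w)), e.repr.symm (WithLp.toLp 2 w)⟫ =
      ∑ i, lam i * w i ^ 2 := by
    intro w
    rw [← e.repr.inner_map_map, LinearIsometryEquiv.apply_symm_apply, PiLp.inner_apply]
    refine Finset.sum_congr rfl fun i _ => ?_
    rw [hT.eigenvectorBasis_apply_self_apply hn.symm]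
    simp [e, lam]
    ring
  refine ⟨hdet ▸ Finset.prod_pos fun i _ => hlam i, ?_⟩
  -- Coordinates in an orthonormal eigenbasis preserve volume, and the integral becomes a product of
  -- one-dimensional Gaussian integrals.
  rw [← e.measurePreserving_repr_symm.integral_comp e.repr.symm.toHomeomorph.measurableEmbedding,
    ← (PiLp.volume_preserving_toLp (Fin n)).integral_comp (MeasurableEquiv.toLp 2 _).measurableEmbedding]
  have h1 : ∀ w : Fin n → ℝ, Real.exp (-(⟪T (e.repr.symm (WithLp.toLp 2 w)),
      e.repr.symm (WithLp.toLp 2 w)⟫ / 2)) = ∏ i, Real.exp (-(lam i / 2) * w i ^ 2) := by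
    intro w
    rw [hin, ← Real.exp_sum]
    congr 1
    rw [Finset.sum_div, ← Finset.sum_neg_distrib]
    exact Finset.sum_congr rfl fun i _ => by ring
  simp only [h1]
  rw [integral_fintype_prod_volume_eq_prod (fun i (r : ℝ) => Real.exp (-(lam i / 2) * r ^ 2))]
  simp only [integral_gaussian]
  rw [← Real.sqrt_prod _ fun i _ => by have := hlam i; positivity, hdet]
  congr 1
  rw [show (2 * Real.pi) ^ n = ∏ _i : Fin n, (2 * Real.pi) by simp, ← Finset.prod_div_distrib]
  refine Finset.prod_congr rfl fun i _ => ?_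
  have := hlam i
  field_simp

/-- The quadratic form attains a positive minimum on the compact unit sphere and is homogeneous of
degree two. An empty sphere means that the space is trivial. -/
lemma exists_pos_mul_sq_norm_le {d : ℕ} (T : E d →L[ℝ] E d) (hT : ∀ v, v ≠ 0 → 0 < ⟪T v, v⟫) :
    ∃ c > 0, ∀ v, c * ‖v‖ ^ 2 ≤ ⟪T v, v⟫ := by
  rcases (Metric.sphere (0 : E d) 1).eq_empty_or_nonempty with h | h
  · refine ⟨1, one_pos, fun v => ?_⟩
    have hv : v = 0 := by
      by_contra hv
      have : ‖v‖⁻¹ • v ∈ Metric.sphere (0 : E d) 1 := by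
        simp [norm_smul, norm_ne_zero_iff.2 hv]
      rw [h] at this
      exact this
    simp [hv]
  · obtain ⟨w, hw, hmin⟩ := (isCompact_sphere (0 : E d) 1).exists_isMinOn h
      (f := fun v => ⟪T v, v⟫) (by fun_prop)
    have hw1 : ‖w‖ = 1 := by simpa using hw
    refine ⟨⟪T w, w⟫, hT w (norm_ne_zero_iff.1 (by rw [hw1]; exact one_ne_zero)), fun v => ?_⟩
    rcases eq_or_ne v 0 with rfl | hv
    · simp
    have hv' := norm_ne_zero_iff.2 hv
    have h2 := isMinOn_iff.1 hmin (‖v‖⁻¹ • v) (by simp [norm_smul, hv'])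
    simp only [map_smul, real_inner_smul_left, real_inner_smul_right] at h2
    calc ⟪T w, w⟫ * ‖v‖ ^ 2 ≤ (‖v‖⁻¹ * (‖v‖⁻¹ * ⟪T v, v⟫)) * ‖v‖ ^ 2 :=
          mul_le_mul_of_nonneg_right h2 (by positivity)
      _ = ⟪T v, v⟫ := by field_simp

/-- Fubini's theorem for the decomposition of the space along a unit vector. -/
lemma integral_eq_integral_line_add {d : ℕ} {ν : E d} (hν : ‖ν‖ = 1) {f : E d → ℝ}
    (hf : Integrable f) :
    ∫ x, f x = ∫ r : ℝ, ∫ s : S ν, f (r • ν + s) := by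
  set e₁ := (ℝ ∙ ν).orthogonalDecomposition
  have m1 : MeasurePreserving e₁.symm := e₁.symm.measurePreserving
  have m2 := (WithLp.volume_preserving_toLp (ℝ ∙ ν) (S ν))
  have m3 : MeasurePreserving (LinearIsometryEquiv.toSpanUnitSingleton (𝕜 := ℝ) ν hν) :=
    (LinearIsometryEquiv.toSpanUnitSingleton (𝕜 := ℝ) ν hν).measurePreserving
  have m4 := m3.prod (MeasurePreserving.id (volume : Measure (S ν)))
  have m := m1.comp (m2.comp m4)
  have hval : ∀ p : ℝ × S ν, (e₁.symm ∘ (WithLp.toLp 2 ∘ Prod.map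
      (LinearIsometryEquiv.toSpanUnitSingleton (𝕜 := ℝ) ν hν) id)) p = p.1 • ν + (p.2 : E d) := by
    exact fun p => rfl
  have emb : MeasurableEmbedding (e₁.symm ∘ (WithLp.toLp 2 ∘ Prod.map
      (LinearIsometryEquiv.toSpanUnitSingleton (𝕜 := ℝ) ν hν) id)) :=
    e₁.symm.toHomeomorph.measurableEmbedding.comp
      ((MeasurableEquiv.toLp 2 _).measurableEmbedding.comp
        ((LinearIsometryEquiv.toSpanUnitSingleton (𝕜 := ℝ) ν hν).toHomeomorph.measurableEmbedding.prodMap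
          MeasurableEmbedding.id))
  rw [← m.integral_comp emb, integral_prod _ ?_]
  · simp only [hval]
  · exact m.integrable_comp_of_integrable hf

section OfMatrix

variable {d : ℕ} {B : Matrix (Fin d) (Fin d) ℝ} {ν : E d}

lemma inner_toEuclideanLin_pos {C : Matrix (Fin d) (Fin d) ℝ} (hC : C.PosDef) {v : E d}
    (hv : v ≠ 0) : 0 < ⟪C.toEuclideanLin v, v⟫ := by
  have h := hC.dotProduct_mulVec_pos (x := WithLp.ofLp v) (by simpa using hv)
  rw [EuclideanSpace.inner_eq_star_dotProduct]
  simpa [Matrix.toLpLin_apply] using h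

lemma toEuclideanLin_inv_apply (hB : B.PosDef) (v : E d) : B⁻¹.toEuclideanLin (B.toEuclideanLin v) = v := by
  have := B.isUnit_iff_isUnit_det.1 hB.isUnit
  simp [Matrix.toLpLin_apply, Matrix.mulVec_mulVec, Matrix.nonsing_inv_mul _ this]

lemma toEuclideanLin_apply_inv (hB : B.PosDef) (v : E d) : B.toEuclideanLin (B⁻¹.toEuclideanLin v) = v := by
  have := B.isUnit_iff_isUnit_det.1 hB.isUnit
  simp [Matrix.toLpLin_apply, Matrix.mulVec_mulVec, Matrix.mul_nonsing_inv _ this]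

lemma exists_coercive_inv (hB : B.PosDef) :
    ∃ c > 0, ∀ v : E d, c * ‖v‖ ^ 2 ≤ ⟪B⁻¹.toEuclideanLin v, v⟫ :=
  exists_pos_mul_sq_norm_le (LinearMap.toContinuousLinearMap B⁻¹.toEuclideanLin)
    fun _ hv => inner_toEuclideanLin_pos hB.inv hv

variable {q : ℝ} {α : E d} (hB : B.PosDef) (hν : ‖ν‖ = 1) (hq : |q| ≤ 1) (hα : α ∈ S ν)

/-- The data of the membrane process with diffusion matrix `B`. -/
def ofMatrix : Setup d where
  A := LinearMap.toContinuousLinearMap B⁻¹.toEuclideanLin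
  symm := Matrix.isSymmetric_toEuclideanLin_iff.2 hB.inv.isHermitian
  lam := (exists_coercive_inv hB).choose
  lam_pos := (exists_coercive_inv hB).choose_spec.1
  coercive := (exists_coercive_inv hB).choose_spec.2
  ν := ν
  N := conormal B ν
  A_N := toEuclideanLin_inv_apply hB ν
  sig_pos := inner_toEuclideanLin_pos hB (norm_ne_zero_iff.1 (by rw [hν]; exact one_ne_zero))
  α := α
  α_tangent := Submodule.mem_orthogonal_singleton_iff_inner_left.1 hα
  q := q
  abs_q_le := hq

lemma inner_compressedInv_left (z w : S ν) :
    ⟪compressedInv B ν z, w⟫ = ⟪B⁻¹.toEuclideanLin (z : E d), (w : E d)⟫ := by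
  rw [real_inner_comm, real_inner_comm (w : E d)]
  exact (S ν).inner_orthogonalProjectionOnto_eq_of_mem_left w _

lemma compressedInv_isSymmetric (hB : B.PosDef) : (compressedInv B ν).IsSymmetric := by
  intro z w
  rw [inner_compressedInv_left, real_inner_comm (compressedInv B ν w) z,
    inner_compressedInv_left, real_inner_comm (z : E d)]
  exact Matrix.isSymmetric_toEuclideanLin_iff.2 hB.inv.isHermitian _ _

lemma inner_compressedInv_pos (hB : B.PosDef) (z : S ν) (hz : z ≠ 0) :
    0 < ⟪compressedInv B ν z, z⟫ := by
  rw [inner_compressedInv_left]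
  exact inner_toEuclideanLin_pos hB.inv (by simpa using hz)

lemma coe_proj (hν : ‖ν‖ = 1) (v : E d) : (proj ν v : E d) = v - ⟪v, ν⟫ • ν := by
  have h := (ℝ ∙ ν).starProjection_orthogonal_val v
  rw [Submodule.starProjection_unit_singleton ℝ hν, real_inner_comm] at h
  exact h

lemma inner_of_mem_S {z : E d} (hz : z ∈ S ν) : ⟪z, ν⟫ = 0 :=
  Submodule.mem_orthogonal_singleton_iff_inner_left.1 hz

/-- Since N = b + σ²ν, the projection onto S along N is v_S - (v_ν/σ²) b, which is the vector z in
the definition of `gS`. -/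
lemma ofMatrix_tang (v : E d) : (ofMatrix hB hν hq hα).tang v =
    ((proj ν v - (⟪v, ν⟫ / sigmaSq B ν) • tangentPart B ν : S ν) : E d) := by
  have h0 : sigmaSq B ν ≠ 0 := (ofMatrix hB hν hq hα).sig_pos.ne'
  rw [Submodule.coe_sub, Submodule.coe_smul, tangentPart, coe_proj hν, coe_proj hν, smul_sub,
    smul_smul]
  change v - (⟪v, ν⟫ / sigmaSq B ν) • conormal B ν = v - ⟪v, ν⟫ • ν -
    ((⟪v, ν⟫ / sigmaSq B ν) • conormal B ν - (⟪v, ν⟫ / sigmaSq B ν * sigmaSq B ν) • ν)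
  rw [div_mul_cancel₀ _ h0]
  abel

lemma ofMatrix_quad_tang (v : E d) :
    (ofMatrix hB hν hq hα).quad ((ofMatrix hB hν hq hα).tang v) =
      ⟪compressedInv B ν (proj ν v - (⟪v, ν⟫ / sigmaSq B ν) • tangentPart B ν),
        proj ν v - (⟪v, ν⟫ / sigmaSq B ν) • tangentPart B ν⟫ := by
  rw [ofMatrix_tang, inner_compressedInv_left]
  rfl

/-- Fubini along ν: at height r the tangential factor is a Gaussian centred at (r/σ²) b, whose
integral does not depend on r. The constant is thus the product of a normal and a tangential one. -/
lemma ofMatrix_gaussConst : (ofMatrix hB hν hq hα).gaussConst =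
    (√(2 * Real.pi * sigmaSq B ν) * √((2 * Real.pi) ^ Module.finrank ℝ (S ν) /
      LinearMap.det (compressedInv B ν)))⁻¹ := by
  set M := ofMatrix hB hν hq hα with hM
  have hs : 0 < sigmaSq B ν := M.sig_pos
  have key := (integral_exp_neg_inner_apply (compressedInv_isSymmetric hB)
    (inner_compressedInv_pos (ν := ν) hB)).2
  rw [Setup.gaussConst, integral_eq_integral_line_add hν (M.integrable_exp_quad two_pos)]
  congr 1
  have h1 : ∀ (r : ℝ) (s : S ν), Real.exp (-(M.quad (r • ν + s) / 2)) =
      Real.exp (-(1 / (2 * sigmaSq B ν)) * r ^ 2) *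
        Real.exp (-(⟪compressedInv B ν (s - (r / sigmaSq B ν) • tangentPart B ν),
          s - (r / sigmaSq B ν) • tangentPart B ν⟫ / 2)) := by
    intro r s
    have hr : ⟪r • ν + (s : E d), ν⟫ = r := by
      rw [inner_add_left, inner_of_mem_S s.2, real_inner_smul_left, real_inner_self_eq_norm_sq,
        hν]; ring
    have hp : proj ν (r • ν + (s : E d)) = s := by
      ext1
      rw [coe_proj hν, hr]; abel
    rw [M.quad_eq_tang, ofMatrix_quad_tang, hp, hr, ← Real.exp_add]
    congr 1
    change -((⟪r • ν + (s : E d), ν⟫ ^ 2 / sigmaSq B ν + _) / 2) = _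
    rw [hr]
    field_simp
    ring
  simp only [h1, integral_const_mul]
  have h2 : ∀ r : ℝ, ∫ s : S ν, Real.exp (-(⟪compressedInv B ν
      (s - (r / sigmaSq B ν) • tangentPart B ν), s - (r / sigmaSq B ν) • tangentPart B ν⟫ / 2)) =
      √((2 * Real.pi) ^ Module.finrank ℝ (S ν) / LinearMap.det (compressedInv B ν)) := by
    intro r
    rw [← key]
    exact integral_sub_right_eq_self (fun s : S ν => Real.exp (-(⟪compressedInv B ν s, s⟫ / 2))) _
  simp only [h2, integral_mul_const, integral_gaussian]
  congr 2
  field_simp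

lemma isUnit_compressedInv (hB : B.PosDef) : IsUnit (compressedInv B ν) :=
  (LinearMap.isUnit_iff_isUnit_det _).2 (integral_exp_neg_inner_apply
    (compressedInv_isSymmetric hB) (inner_compressedInv_pos (ν := ν) hB)).1.ne'.isUnit

lemma inverse_BS (hB : B.PosDef) : Ring.inverse (BS B ν) = compressedInv B ν := by
  obtain ⟨c, hc⟩ := isUnit_compressedInv (ν := ν) hB
  rw [BS, ← hc, Ring.inverse_unit, Ring.inverse_unit, inv_inv]

lemma det_smul_BS (hB : B.PosDef) (c : ℝ) : LinearMap.det (c • BS B ν) =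
    c ^ Module.finrank ℝ (S ν) / LinearMap.det (compressedInv B ν) := by
  obtain ⟨u, hu⟩ := isUnit_compressedInv (ν := ν) hB
  have h0 := (integral_exp_neg_inner_apply
    (compressedInv_isSymmetric hB) (inner_compressedInv_pos (ν := ν) hB)).1.ne'
  rw [LinearMap.det_smul, eq_div_iff h0, mul_assoc, ← map_mul, BS, ← hu, Ring.inverse_unit,
    Units.inv_mul, map_one, mul_one]

lemma finrank_S (hν : ‖ν‖ = 1) : Module.finrank ℝ (S ν) + 1 = d := by
  have h := (ℝ ∙ ν).finrank_add_finrank_orthogonal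
  rw [finrank_span_singleton (norm_ne_zero_iff.1 (by rw [hν]; exact one_ne_zero)),
    finrank_euclideanSpace, Fintype.card_fin] at h
  exact (add_comm _ _).trans h

/-- The factorization of the Gaussian density of the free process. -/
lemma exp_mul_gS_eq_gauss {t : ℝ} (ht : 0 < t) {x y v : E d} {r : ℝ} (hr : ⟪v, ν⟫ = r)
    (hv : (ofMatrix hB hν hq hα).quad ((ofMatrix hB hν hq hα).tang v) =
      (ofMatrix hB hν hq hα).quad ((ofMatrix hB hν hq hα).tang (y - x))) :
    1 / √(2 * Real.pi * t * sigmaSq B ν) * Real.exp (-(r ^ 2 / (2 * t * sigmaSq B ν))) *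
      gS B ν t x y = (ofMatrix hB hν hq hα).gauss t v := by
  set M := ofMatrix hB hν hq hα with hM
  have hs : 0 < sigmaSq B ν := M.sig_pos
  have hdet := (integral_exp_neg_inner_apply
    (compressedInv_isSymmetric hB) (inner_compressedInv_pos (ν := ν) hB)).1
  set D := LinearMap.det (compressedInv B ν)
  set n := Module.finrank ℝ (S ν) with hn
  have hd : √t ^ d = √t ^ n * √t := by rw [← pow_succ, hn, finrank_S hν]
  have h1 : √(2 * Real.pi * t * sigmaSq B ν) = √(2 * Real.pi * sigmaSq B ν) * √t := by
    rw [← Real.sqrt_mul (by positivity)]; congr 1; ring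
  have h2 : √((2 * Real.pi * t) ^ n / D) = √((2 * Real.pi) ^ n / D) * √t ^ n := by
    rw [show (2 * Real.pi * t) ^ n / D = (2 * Real.pi) ^ n / D * (√t ^ n) ^ 2 by
        rw [← pow_mul, mul_comm n 2, pow_mul, Real.sq_sqrt ht.le, mul_pow]; ring,
      Real.sqrt_mul (by positivity), Real.sqrt_sq (by positivity)]
  have hz : proj ν y - proj ν x - ((⟪y, ν⟫ - ⟪x, ν⟫) / sigmaSq B ν) • tangentPart B ν =
      proj ν (y - x) - (⟪y - x, ν⟫ / sigmaSq B ν) • tangentPart B ν := by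
    rw [map_sub, inner_sub_left]
  rw [M.gauss_eq_tang, hv, ofMatrix_quad_tang, ofMatrix_gaussConst, gS]
  simp only [det_smul_BS hB, inverse_BS hB, hz]
  set Q := ⟪compressedInv B ν (proj ν (y - x) - (⟪y - x, ν⟫ / sigmaSq B ν) • tangentPart B ν),
    proj ν (y - x) - (⟪y - x, ν⟫ / sigmaSq B ν) • tangentPart B ν⟫
  change _ = _ * _ * Real.exp (-((⟪v, ν⟫ ^ 2 / sigmaSq B ν + Q) / (2 * t)))
  rw [hr, h1, h2, hd, show -((r ^ 2 / sigmaSq B ν + Q) / (2 * t)) =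
    -(r ^ 2 / (2 * t * sigmaSq B ν)) + -(1 / (2 * t)) * Q by field_simp; ring, Real.exp_add]
  simp only [mul_inv, one_div]
  ring

lemma ofMatrix_quad_tang_neg {v w : E d} (h : (ofMatrix hB hν hq hα).tang v =
    -(ofMatrix hB hν hq hα).tang w) :
    (ofMatrix hB hν hq hα).quad ((ofMatrix hB hν hq hα).tang v) =
      (ofMatrix hB hν hq hα).quad ((ofMatrix hB hν hq hα).tang w) := by
  rw [h, Setup.quad_neg]

/-- The vector `fold x - foldNeg y + θβ` has the normal component of the numerator, and its
tangential part is minus that of y - (x + θα). The sign does not matter to the quadratic form. -/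
lemma passageIntegrand_eq {t : ℝ} (ht : 0 < t) (x y : E d) (θ : ℝ) :
    passageIntegrand B ν q α t x y θ = (q * Real.sign ⟪y, ν⟫ + 1) *
      (ofMatrix hB hν hq hα).passage t ((ofMatrix hB hν hq hα).fold x -
        (ofMatrix hB hν hq hα).foldNeg y + θ • (ofMatrix hB hν hq hα).beta) := by
  set M := ofMatrix hB hν hq hα with hM
  have hs : 0 < sigmaSq B ν := M.sig_pos
  set v := M.fold x - M.foldNeg y + θ • M.beta with hvd
  have hr : ⟪v, ν⟫ = sigmaSq B ν * θ + |⟪x, ν⟫| + |⟪y, ν⟫| := by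
    have : ⟪v, ν⟫ = |⟪x, ν⟫| + |⟪y, ν⟫| + sigmaSq B ν * θ := M.inner_fold_sub_foldNeg_add x y θ
    rw [this]; ring
  have hα0 : M.tang α = α := by
    have : ⟪α, M.ν⟫ = 0 := M.α_tangent
    rw [Setup.tang, this, zero_div, zero_smul, sub_zero]
  have ht' : M.tang v = -M.tang (y - (x + θ • α)) := by
    rw [hvd, M.tang_add, M.tang_sub, M.tang_fold, M.tang_foldNeg, M.tang_smul, Setup.beta,
      M.tang_add, M.tang_N, zero_add, M.tang_sub, M.tang_add, M.tang_smul]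
    change M.tang x - M.tang y + θ • M.tang α = _
    abel
  have key := exp_mul_gS_eq_gauss hB hν hq hα ht (x := x + θ • α) (y := y) hr
    (ofMatrix_quad_tang_neg hB hν hq hα ht')
  have h3 : √(2 * Real.pi * t ^ 3 * sigmaSq B ν) = √(2 * Real.pi * t * sigmaSq B ν) * t := by
    rw [show 2 * Real.pi * t ^ 3 * sigmaSq B ν = 2 * Real.pi * t * sigmaSq B ν * t ^ 2 by ring,
      Real.sqrt_mul (by positivity), Real.sqrt_sq ht.le]
  rw [passageIntegrand, Setup.passage, hM, ← key, h3]
  change _ = _ * (⟪v, ν⟫ / t * _)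
  rw [hr]
  field_simp

lemma integrableOn_passageIntegrand (hB : B.PosDef) (hν : ‖ν‖ = 1) (hq : |q| ≤ 1)
    (hα : α ∈ S ν) {t : ℝ} (ht : 0 < t) (x y : E d) :
    IntegrableOn (passageIntegrand B ν q α t x y) (Set.Ioi 0) := by
  rw [funext (passageIntegrand_eq hB hν hq hα ht x y)]
  exact (((ofMatrix hB hν hq hα).integrable_passage_line ht _).const_mul _).integrableOn

lemma G_eq_kernel {t : ℝ} (ht : 0 < t) (x y : E d) :
    G B ν q α t x y = (ofMatrix hB hν hq hα).kernel t x y := by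
  set M := ofMatrix hB hν hq hα with hM
  have h1 := exp_mul_gS_eq_gauss hB hν hq hα ht (x := x) (y := y) (v := y - x)
    (inner_sub_left _ _ _) rfl
  have hr : ⟪M.fold x - M.foldNeg y, ν⟫ = |⟪y, ν⟫| + |⟪x, ν⟫| := by
    have h := M.inner_fold_sub_foldNeg_add x y 0
    rw [zero_smul, add_zero, mul_zero, add_zero, add_comm] at h
    exact h
  have h2 := exp_mul_gS_eq_gauss hB hν hq hα ht (x := x) (y := y) hr
    (ofMatrix_quad_tang_neg hB hν hq hα (by
      rw [← hM, M.tang_sub, M.tang_fold, M.tang_foldNeg, M.tang_sub]; abel))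
  rw [G, Setup.kernel, hM, ← h1, ← h2,
    funext (passageIntegrand_eq hB hν hq hα ht x y),
    integral_const_mul]
  rw [mul_sub, sub_mul]
  rfl

end OfMatrix

/-! ### Smooth extensions from the half-spaces and the conjugation problem -/

lemma hessian_add {d : ℕ} {f g : E d → ℝ} (hf : ContDiff ℝ 2 f) (hg : ContDiff ℝ 2 g) (x : E d) :
    hessian (fun z => f z + g z) x = hessian f x + hessian g x := by
  have h1 : ∀ {f : E d → ℝ}, ContDiff ℝ 2 f → ∀ e : E d,
      DifferentiableAt ℝ (fun z => fderiv ℝ f z e) x := fun hf e =>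
    ((hf.fderiv_right (m := 1) (by norm_num)).differentiable (by norm_num)
      |>.clm_apply (differentiable_const e)).differentiableAt
  have h2 : ∀ e : E d, (fun z => fderiv ℝ (fun z => f z + g z) z e) =
      fun z => fderiv ℝ f z e + fderiv ℝ g z e := by
    intro e; ext z
    rw [fderiv_fun_add (hf.differentiable (by norm_num)).differentiableAt
      (hg.differentiable (by norm_num)).differentiableAt, _root_.add_apply]
  ext i j
  simp only [hessian, Matrix.of_apply, Matrix.add_apply]
  rw [h2, fderiv_fun_add (h1 hf _) (h1 hg _), _root_.add_apply]

lemma hessian_congr {d : ℕ} {f g : E d → ℝ} {x : E d} (h : f =ᶠ[𝓝 x] g) :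
    hessian f x = hessian g x := by
  ext i j
  simp only [hessian, Matrix.of_apply]
  have : (fun z => fderiv ℝ f z (EuclideanSpace.single j 1)) =ᶠ[𝓝 x]
      fun z => fderiv ℝ g z (EuclideanSpace.single j 1) :=
    (h.fderiv (𝕜 := ℝ)).mono fun z hz => by simp only [hz]
  rw [this.fderiv_eq]

namespace Setup

variable {d : ℕ} (M : Setup d) (φ : E d →ᵇ ℝ)

/-- The potential of the free Gaussian density. -/
def freePotential (t : ℝ) (x : E d) : ℝ := ∫ y, φ y * M.mix 1 0 t (x - y)

/-- The potential of the mirrored Gaussian density. -/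
def imagePotential (t : ℝ) (x : E d) : ℝ := ∫ y, -φ y * M.mix 1 0 t (x - M.foldNeg y)

/-- The potential of the oblique passage density. -/
def obliquePotential (t : ℝ) (x : E d) : ℝ :=
  ∫ η, (φ η.1 * (M.q * Real.sign ⟪η.1, M.ν⟫ + 1)) *
    M.mix 0 1 t (x - (M.foldNeg η.1 - η.2 • M.beta)) ∂(pairMeasure d)

/-- The smooth extension of the solution from the half-space `0 ≤ (x, ν)`. -/
def halfSolution (t : ℝ) (x : E d) : ℝ :=
  M.freePotential φ t x + M.imagePotential φ t x + M.obliquePotential φ t x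

lemma abs_obliqueWeight_le (η : E d × ℝ) :
    |φ η.1 * (M.q * Real.sign ⟪η.1, M.ν⟫ + 1)| ≤ ‖φ‖ * 2 := by
  rw [abs_mul, abs_of_nonneg (M.weight_nonneg _)]
  exact mul_le_mul (φ.norm_coe_le_norm _) (M.weight_le _) (M.weight_nonneg _) (norm_nonneg _)

lemma measurable_obliqueWeight :
    Measurable fun η : E d × ℝ => φ η.1 * (M.q * Real.sign ⟪η.1, M.ν⟫ + 1) := by
  have h1 : Measurable fun η : E d × ℝ => φ η.1 :=
    φ.continuous.measurable.comp measurable_fst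
  have h2 : Measurable fun η : E d × ℝ => Real.sign ⟪η.1, M.ν⟫ :=
    measurable_sign.comp (Continuous.measurable (by fun_prop))
  exact h1.mul ((h2.const_mul _).add_const _)

lemma measurable_obliqueShift :
    Measurable fun η : E d × ℝ => M.foldNeg η.1 - η.2 • M.beta := by
  have := M.continuous_foldNeg
  exact Continuous.measurable (by fun_prop)

lemma contDiff_halfSolution {t : ℝ} (ht : 0 < t) :
    ContDiff ℝ 2 (M.freePotential φ t) ∧ ContDiff ℝ 2 (M.imagePotential φ t) ∧
      ContDiff ℝ 2 (M.obliquePotential φ t) :=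
  ⟨M.contDiff_mix_superposition 1 0 (ξ := fun y => y) measurable_id φ.continuous.measurable
      φ.norm_coe_le_norm (fun _ hε => integrable_exp_neg_mul_sq_norm hε) ht,
    M.contDiff_mix_superposition 1 0 M.continuous_foldNeg.measurable φ.continuous.measurable.neg
      (fun y => (abs_neg _).trans_le (φ.norm_coe_le_norm y))
      (fun _ hε => M.integrable_exp_foldNeg hε) ht,
    M.contDiff_mix_superposition 0 1 M.measurable_obliqueShift (M.measurable_obliqueWeight φ)
      (M.abs_obliqueWeight_le φ) (fun _ hε => M.integrable_exp_foldNeg_pair hε) ht⟩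

lemma contDiff_two_halfSolution {t : ℝ} (ht : 0 < t) : ContDiff ℝ 2 (M.halfSolution φ t) :=
  ((M.contDiff_halfSolution φ ht).1.add (M.contDiff_halfSolution φ ht).2.1).add
    (M.contDiff_halfSolution φ ht).2.2

lemma hasDerivAt_halfSolution (B : Matrix (Fin d) (Fin d) ℝ)
    (hBA : ∀ v, B.toEuclideanLin (M.A v) = v) {t : ℝ} (ht : 0 < t) (x : E d) :
    HasDerivAt (fun s => M.halfSolution φ s x)
      (1 / 2 * (B * hessian (M.halfSolution φ t) x).trace) t := by
  obtain ⟨c1, c2, c3⟩ := M.contDiff_halfSolution φ ht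
  have h1 := M.hasDerivAt_mix_superposition_time 1 0 (ξ := fun y => y) measurable_id
    φ.continuous.measurable φ.norm_coe_le_norm
    (fun _ hε => integrable_exp_neg_mul_sq_norm hε) ht x
  have h2 := M.hasDerivAt_mix_superposition_time 1 0 M.continuous_foldNeg.measurable
    φ.continuous.measurable.neg (fun y => (abs_neg _).trans_le (φ.norm_coe_le_norm y))
    (fun _ hε => M.integrable_exp_foldNeg hε) ht x
  have h3 := M.hasDerivAt_mix_superposition_time 0 1 M.measurable_obliqueShift
    (M.measurable_obliqueWeight φ) (M.abs_obliqueWeight_le φ)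
    (fun _ hε => M.integrable_exp_foldNeg_pair hε) ht x
  rw [← M.trace_hessian_mix_superposition 1 0 B hBA (ξ := fun y => y) measurable_id
    φ.continuous.measurable φ.norm_coe_le_norm
    (fun _ hε => integrable_exp_neg_mul_sq_norm hε) ht x] at h1
  rw [← M.trace_hessian_mix_superposition 1 0 B hBA M.continuous_foldNeg.measurable
    φ.continuous.measurable.neg (fun y => (abs_neg _).trans_le (φ.norm_coe_le_norm y))
    (fun _ hε => M.integrable_exp_foldNeg hε) ht x] at h2
  rw [← M.trace_hessian_mix_superposition 0 1 B hBA M.measurable_obliqueShift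
    (M.measurable_obliqueWeight φ) (M.abs_obliqueWeight_le φ)
    (fun _ hε => M.integrable_exp_foldNeg_pair hε) ht x] at h3
  have h4 : hessian (M.halfSolution φ t) x = hessian (M.freePotential φ t) x +
      hessian (M.imagePotential φ t) x + hessian (M.obliquePotential φ t) x :=
    (hessian_add (c1.add c2) c3 x).trans (by rw [← hessian_add c1 c2 x])
  refine ((h1.add h2).add h3).congr_deriv ?_
  rw [h4, Matrix.mul_add, Matrix.mul_add, Matrix.trace_add, Matrix.trace_add, mul_add, mul_add]
  rfl

lemma halfSolution_eq_integral {t : ℝ} (ht : 0 < t) (x : E d) :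
    M.halfSolution φ t x = ∫ y, φ y * M.halfKernel t x y := by
  have i1 := M.integrable_mix_superposition 1 0 (ξ := fun y => y) measurable_id
    φ.continuous.measurable φ.norm_coe_le_norm
    (fun _ hε => integrable_exp_neg_mul_sq_norm hε) ht x
  have i2 : Integrable fun y => -φ y * M.mix 1 0 t (x - M.foldNeg y) :=
    M.integrable_mix_superposition 1 0 M.continuous_foldNeg.measurable
    φ.continuous.measurable.neg (fun y => (abs_neg _).trans_le (φ.norm_coe_le_norm y))
    (fun _ hε => M.integrable_exp_foldNeg hε) ht x
  have i3 := M.integrable_mix_superposition 0 1 M.measurable_obliqueShift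
    (M.measurable_obliqueWeight φ) (M.abs_obliqueWeight_le φ)
    (fun _ hε => M.integrable_exp_foldNeg_pair hε) ht x
  have e3 : M.obliquePotential φ t x = ∫ y, (φ y * (M.q * Real.sign ⟪y, M.ν⟫ + 1)) *
      M.oblique t (x - M.foldNeg y) := by
    rw [obliquePotential, pairMeasure, integral_prod _ i3]
    congr 1; ext y
    simp only
    rw [integral_const_mul, oblique, mix_zero_one]
    congr 2; ext θ; congr 1; abel
  have i3' : Integrable fun y => (φ y * (M.q * Real.sign ⟪y, M.ν⟫ + 1)) *
      M.oblique t (x - M.foldNeg y) := by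
    refine i3.integral_prod_left.congr (ae_of_all _ fun y => ?_)
    simp only
    rw [integral_const_mul, oblique, mix_zero_one]
    congr 2; ext θ; congr 1; abel
  rw [halfSolution, e3, freePotential, imagePotential, ← integral_add i1 i2,
    ← integral_add (f := fun y => φ y * M.mix 1 0 t (x - y) +
      -φ y * M.mix 1 0 t (x - M.foldNeg y)) (i1.add i2) i3']
  congr 1; ext y
  simp only [mix_one_zero, halfKernel]
  ring

/-- The solution as an integral against the transition density. -/
def solution (t : ℝ) (x : E d) : ℝ := ∫ y, φ y * M.kernel t x y

/-- The closed half-space is essential: up to and on the membrane the solution is the restriction of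
a function that is C² on the whole space, so one-sided limits of values and gradients are its
ordinary values. -/
lemma solution_eq_half {t : ℝ} (ht : 0 < t) {x : E d} (hx : 0 ≤ ⟪x, M.ν⟫) :
    M.solution φ t x = M.halfSolution φ t x := by
  simp only [solution, M.halfSolution_eq_integral φ ht, M.kernel_eq_halfKernel hx]

lemma solution_eq_flip_half {t : ℝ} (ht : 0 < t) {x : E d} (hx : ⟪x, M.ν⟫ ≤ 0) :
    M.solution φ t x = M.flip.halfSolution φ t x := by
  simp only [solution, M.flip.halfSolution_eq_integral φ ht, M.kernel_eq_flip_halfKernel hx]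

lemma solution_eventuallyEq_half {t : ℝ} (ht : 0 < t) {x : E d} (hx : 0 < ⟪x, M.ν⟫) :
    M.solution φ t =ᶠ[𝓝 x] M.halfSolution φ t := by
  have : ∀ᶠ z in 𝓝 x, 0 < ⟪z, M.ν⟫ :=
    (Continuous.tendsto (f := fun z : E d => ⟪z, M.ν⟫) (by fun_prop) x).eventually
      (lt_mem_nhds hx)
  filter_upwards [this] with z hz using M.solution_eq_half φ ht hz.le

lemma solution_eventuallyEq_flip_half {t : ℝ} (ht : 0 < t) {x : E d} (hx : ⟪x, M.ν⟫ < 0) :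
    M.solution φ t =ᶠ[𝓝 x] M.flip.halfSolution φ t := by
  have : ∀ᶠ z in 𝓝 x, ⟪z, M.ν⟫ < 0 :=
    (Continuous.tendsto (f := fun z : E d => ⟪z, M.ν⟫) (by fun_prop) x).eventually
      (gt_mem_nhds hx)
  filter_upwards [this] with z hz using M.solution_eq_flip_half φ ht hz.le

lemma solution_heat (B : Matrix (Fin d) (Fin d) ℝ) (hBA : ∀ v, B.toEuclideanLin (M.A v) = v)
    {t : ℝ} (ht : 0 < t) {x : E d} (hx : ⟪x, M.ν⟫ ≠ 0) :
    ContDiffAt ℝ 2 (M.solution φ t) x ∧ HasDerivAt (fun s => M.solution φ s x)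
      (1 / 2 * (B * hessian (M.solution φ t) x).trace) t := by
  have hpos : ∀ᶠ s in 𝓝 t, 0 < s := lt_mem_nhds ht
  rcases lt_or_gt_of_ne hx with h | h
  · have he := M.solution_eventuallyEq_flip_half φ ht h
    refine ⟨(M.flip.contDiff_two_halfSolution φ ht).contDiffAt.congr_of_eventuallyEq he, ?_⟩
    rw [hessian_congr he]
    refine (M.flip.hasDerivAt_halfSolution φ B hBA ht x).congr_of_eventuallyEq ?_
    filter_upwards [hpos] with s hs using M.solution_eq_flip_half φ hs h.le
  · have he := M.solution_eventuallyEq_half φ ht h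
    refine ⟨(M.contDiff_two_halfSolution φ ht).contDiffAt.congr_of_eventuallyEq he, ?_⟩
    rw [hessian_congr he]
    refine (M.hasDerivAt_halfSolution φ B hBA ht x).congr_of_eventuallyEq ?_
    filter_upwards [hpos] with s hs using M.solution_eq_half φ hs h.le

lemma nu_ne_zero : M.ν ≠ 0 := by
  intro h
  have := M.sig_pos
  rw [h, inner_zero_right] at this
  exact lt_irrefl _ this

lemma inner_add_smul_nu {x : E d} (hx : ⟪x, M.ν⟫ = 0) (ε : ℝ) :
    ⟪x + ε • M.ν, M.ν⟫ = ε * ‖M.ν‖ ^ 2 := by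
  rw [inner_add_left, hx, real_inner_smul_left, real_inner_self_eq_norm_sq, zero_add]

lemma inner_sub_smul_nu {x : E d} (hx : ⟪x, M.ν⟫ = 0) (ε : ℝ) :
    ⟪x - ε • M.ν, M.ν⟫ = -(ε * ‖M.ν‖ ^ 2) := by
  rw [inner_sub_left, hx, real_inner_smul_left, real_inner_self_eq_norm_sq, zero_sub]

lemma tendsto_add_smul_nu (x : E d) : Tendsto (fun ε : ℝ => x + ε • M.ν) (𝓝[>] 0) (𝓝 x) := by
  have : Tendsto (fun ε : ℝ => x + ε • M.ν) (𝓝 0) (𝓝 (x + (0 : ℝ) • M.ν)) :=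
    Continuous.tendsto (by fun_prop) 0
  rw [zero_smul, add_zero] at this
  exact this.mono_left nhdsWithin_le_nhds

lemma tendsto_sub_smul_nu (x : E d) : Tendsto (fun ε : ℝ => x - ε • M.ν) (𝓝[>] 0) (𝓝 x) := by
  have : Tendsto (fun ε : ℝ => x - ε • M.ν) (𝓝 0) (𝓝 (x - (0 : ℝ) • M.ν)) :=
    Continuous.tendsto (by fun_prop) 0
  rw [zero_smul, sub_zero] at this
  exact this.mono_left nhdsWithin_le_nhds

lemma solution_continuity {t : ℝ} (ht : 0 < t) {x : E d} (hx : ⟪x, M.ν⟫ = 0) :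
    Tendsto (fun ε : ℝ => M.solution φ t (x + ε • M.ν)) (𝓝[>] 0) (𝓝 (M.solution φ t x)) ∧
    Tendsto (fun ε : ℝ => M.solution φ t (x - ε • M.ν)) (𝓝[>] 0) (𝓝 (M.solution φ t x)) := by
  constructor
  · rw [M.solution_eq_half φ ht hx.ge]
    refine (((M.contDiff_two_halfSolution φ ht).continuous.tendsto x).comp
      (M.tendsto_add_smul_nu x)).congr' ?_
    filter_upwards [self_mem_nhdsWithin] with ε hε
    have hε' : 0 < ε := hε
    exact (M.solution_eq_half φ ht (by rw [M.inner_add_smul_nu hx]; positivity)).symm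
  · rw [M.solution_eq_flip_half φ ht hx.le]
    refine (((M.flip.contDiff_two_halfSolution φ ht).continuous.tendsto x).comp
      (M.tendsto_sub_smul_nu x)).congr' ?_
    filter_upwards [self_mem_nhdsWithin] with ε hε
    have hε' : 0 < ε := hε
    refine (M.solution_eq_flip_half φ ht ?_).symm
    rw [M.inner_sub_smul_nu hx, neg_nonpos]; positivity

lemma continuous_gradient_halfSolution {t : ℝ} (ht : 0 < t) :
    Continuous (gradient (M.halfSolution φ t)) :=
  (InnerProductSpace.toDual ℝ (E d)).symm.continuous.comp
    ((M.contDiff_two_halfSolution φ ht).continuous_fderiv (by norm_num))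

lemma tendsto_gradient_solution {t : ℝ} (ht : 0 < t) {x : E d} (hx : ⟪x, M.ν⟫ = 0) :
    Tendsto (fun ε : ℝ => gradient (M.solution φ t) (x + ε • M.ν)) (𝓝[>] 0)
      (𝓝 (gradient (M.halfSolution φ t) x)) ∧
    Tendsto (fun ε : ℝ => gradient (M.solution φ t) (x - ε • M.ν)) (𝓝[>] 0)
      (𝓝 (gradient (M.flip.halfSolution φ t) x)) := by
  have hν : 0 < ‖M.ν‖ := norm_pos_iff.2 M.nu_ne_zero
  constructor
  · refine (((M.continuous_gradient_halfSolution φ ht).tendsto x).comp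
      (M.tendsto_add_smul_nu x)).congr' ?_
    filter_upwards [self_mem_nhdsWithin] with ε hε
    have hε' : 0 < ε := hε
    have := M.solution_eventuallyEq_half φ ht (x := x + ε • M.ν)
      (by rw [M.inner_add_smul_nu hx]; positivity)
    simp only [gradient, Function.comp, this.fderiv_eq]
  · refine (((M.flip.continuous_gradient_halfSolution φ ht).tendsto x).comp
      (M.tendsto_sub_smul_nu x)).congr' ?_
    filter_upwards [self_mem_nhdsWithin] with ε hε
    have hε' : 0 < ε := hε
    have := M.solution_eventuallyEq_flip_half φ ht (x := x - ε • M.ν)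
      (by rw [M.inner_sub_smul_nu hx, neg_lt_zero]; positivity)
    simp only [gradient, Function.comp, this.fderiv_eq]

lemma inner_gradient_eq {f : E d → ℝ} (x e : E d) : ⟪e, gradient f x⟫ = fderiv ℝ f x e := by
  rw [real_inner_comm, gradient, InnerProductSpace.toDual_symm_apply]

/-- The line through x along α stays in the membrane, where both smooth extensions agree with the
solution. By uniqueness this forces their derivatives along α to be equal. -/
lemma hasLineDerivAt_solution {t : ℝ} (ht : 0 < t) {x : E d} (hx : ⟪x, M.ν⟫ = 0) :
    HasLineDerivAt ℝ (M.solution φ t) (fderiv ℝ (M.halfSolution φ t) x M.α) x M.α ∧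
    HasLineDerivAt ℝ (M.solution φ t) (fderiv ℝ (M.flip.halfSolution φ t) x M.α) x M.α := by
  have h0 : ∀ τ : ℝ, ⟪x + τ • M.α, M.ν⟫ = 0 := fun τ => by
    rw [inner_add_left, hx, real_inner_smul_left, M.α_tangent, mul_zero, zero_add]
  constructor
  · refine HasDerivAt.congr_of_eventuallyEq (((M.contDiff_two_halfSolution φ ht).differentiable
      (by norm_num) x).hasFDerivAt.hasLineDerivAt M.α) (Eventually.of_forall fun τ => ?_)
    exact M.solution_eq_half φ ht (h0 τ).ge
  · refine HasDerivAt.congr_of_eventuallyEq (((M.flip.contDiff_two_halfSolution φ ht).differentiable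
      (by norm_num) x).hasFDerivAt.hasLineDerivAt M.α) (Eventually.of_forall fun τ => ?_)
    exact M.solution_eq_flip_half φ ht (h0 τ).le

/-- The derivative of the passage density along the direction of the ray telescopes. It is the
reason why the oblique derivative of the solution is free of θ-integrals. -/
lemma integral_mixD_line {t : ℝ} (ht : 0 < t) (v : E d) :
    ∫ θ in Set.Ioi (0 : ℝ), M.mixD 0 1 t (v + θ • M.beta) M.beta = -M.passage t v := by
  obtain ⟨C, hC, ε, hε, hb⟩ := M.exists_mix_bounds 0 1 ht ht M.beta
  have hint : Integrable fun θ : ℝ => M.mixD 0 1 t (v + θ • M.beta) M.beta := by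
    have := integrable_superposition (μ := (volume : Measure ℝ))
      (ξ := fun θ : ℝ => -(θ • M.beta)) (w := fun _ => 1) (C₀ := 1) (by fun_prop)
      measurable_const (by simp) (fun ε hε => M.integrable_exp_smul_beta hε)
      (p := fun v => M.mixD 0 1 t v M.beta) ((M.continuous_mixD 0 1 t).clm_apply continuous_const)
      hε (fun v => (hb t le_rfl le_rfl v).2.2.1) v
    simpa using this
  have hlim : Tendsto (fun θ : ℝ => M.passage t (v + θ • M.beta)) atTop (𝓝 0) := by
    have h1 : Tendsto (fun θ : ℝ => C * Real.exp (-ε * ‖v + θ • M.beta‖ ^ 2)) atTop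
        (𝓝 (C * 0)) := by
      refine (Real.tendsto_exp_atBot.comp ?_).const_mul C
      exact (((tendsto_pow_atTop two_ne_zero).comp (M.tendsto_norm_add_smul_beta v)).const_mul_atTop_of_neg
        (neg_lt_zero.2 hε))
    rw [mul_zero] at h1
    refine squeeze_zero_norm (fun θ => ?_) h1
    rw [← mix_zero_one]
    exact (hb t le_rfl le_rfl _).1
  have hder : ∀ θ : ℝ, HasDerivAt (fun θ : ℝ => M.passage t (v + θ • M.beta))
      (M.mixD 0 1 t (v + θ • M.beta) M.beta) θ := by
    intro θ
    rw [← mix_zero_one]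
    have h1 : HasDerivAt (fun θ : ℝ => v + θ • M.beta) M.beta θ := by
      simpa using ((hasDerivAt_id θ).smul_const M.beta).const_add v
    exact (M.hasFDerivAt_mix 0 1 t (v + θ • M.beta)).comp_hasDerivAt θ h1
  have := integral_Ioi_of_hasDerivAt_of_tendsto' (a := 0) (fun θ _ => hder θ) hint.integrableOn hlim
  rw [this, zero_smul, add_zero, zero_sub]

lemma integrable_gaussDeriv_superposition {ξ : E d → E d} (hξ : Measurable ξ) {w : E d → ℝ}
    (hw : Measurable w) {C₀ : ℝ} (hwb : ∀ y, |w y| ≤ C₀)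
    (hint : ∀ ε > 0, Integrable (fun y => Real.exp (-ε * ‖ξ y‖ ^ 2))) {t : ℝ} (ht : 0 < t)
    (e x : E d) : Integrable fun y => w y * M.gaussDeriv t e (x - ξ y) := by
  obtain ⟨C, -, ε, hε, h⟩ := M.exists_gaussDeriv_le ht e
  exact integrable_superposition hξ hw hwb hint (M.continuous_gaussDeriv t e) hε h x

/-- The oblique derivative of the solution at the membrane. -/
lemma fderiv_halfSolution_beta {t : ℝ} (ht : 0 < t) {x : E d} (hx : ⟪x, M.ν⟫ = 0) :
    fderiv ℝ (M.halfSolution φ t) x M.beta =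
      (1 - M.q) * ∫ y, φ y * M.gaussDeriv t M.N (x - y) := by
  obtain ⟨c1, c2, c3⟩ := M.contDiff_halfSolution φ ht
  have hφ := φ.continuous.measurable
  have hφb : ∀ y, |φ y| ≤ ‖φ‖ := φ.norm_coe_le_norm
  have hφb' : ∀ y, |-φ y| ≤ ‖φ‖ := fun y => (abs_neg _).trans_le (φ.norm_coe_le_norm y)
  have hfold := M.continuous_foldNeg.measurable
  have d1 : fderiv ℝ (M.freePotential φ t) x M.beta = ∫ y, φ y * M.gaussDeriv t M.beta (x - y) := by
    simp only [← mixD_one_zero]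
    exact M.fderiv_mix_superposition_apply 1 0 (ξ := fun y => y) measurable_id hφ hφb
      (fun _ hε => integrable_exp_neg_mul_sq_norm hε) ht x M.beta
  have d2 : fderiv ℝ (M.imagePotential φ t) x M.beta =
      ∫ y, -φ y * M.gaussDeriv t M.beta (x - M.foldNeg y) := by
    simp only [← mixD_one_zero]
    exact M.fderiv_mix_superposition_apply 1 0 hfold hφ.neg hφb'
      (fun _ hε => M.integrable_exp_foldNeg hε) ht x M.beta
  have d3 : fderiv ℝ (M.obliquePotential φ t) x M.beta =
      ∫ y, (φ y * (M.q * Real.sign ⟪y, M.ν⟫ + 1)) * M.gaussDeriv t M.N (x - M.foldNeg y) := by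
    have h := M.fderiv_mix_superposition_apply 0 1 M.measurable_obliqueShift
      (M.measurable_obliqueWeight φ) (M.abs_obliqueWeight_le φ)
      (fun _ hε => M.integrable_exp_foldNeg_pair hε) ht x M.beta
    obtain ⟨C, hC, ε, hε, hb⟩ := M.exists_mix_bounds 0 1 ht ht M.beta
    have hi := integrable_superposition (μ := pairMeasure d) M.measurable_obliqueShift
      (M.measurable_obliqueWeight φ) (M.abs_obliqueWeight_le φ)
      (fun _ hε => M.integrable_exp_foldNeg_pair hε) (p := fun v => M.mixD 0 1 t v M.beta)
      ((M.continuous_mixD 0 1 t).clm_apply continuous_const)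
      hε (fun v => (hb t le_rfl le_rfl v).2.2.1) x
    refine h.trans ?_
    simp only [smul_eq_mul] at hi
    rw [pairMeasure, integral_prod _ hi]
    congr 1; ext y
    simp only
    rw [integral_const_mul, ← neg_neg (M.gaussDeriv t M.N _), ← passage_eq_neg_gaussDeriv,
      ← M.integral_mixD_line ht]
    congr 2; ext θ; congr 2; abel
  have i1 := M.integrable_gaussDeriv_superposition (ξ := fun y => y) measurable_id hφ hφb
    (fun _ hε => integrable_exp_neg_mul_sq_norm hε) ht M.beta x
  have i2 : Integrable fun y => -φ y * M.gaussDeriv t M.beta (x - M.foldNeg y) :=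
    M.integrable_gaussDeriv_superposition hfold hφ.neg hφb'
    (fun _ hε => M.integrable_exp_foldNeg hε) ht M.beta x
  have i3 := M.integrable_gaussDeriv_superposition hfold
    (w := fun y => φ y * (M.q * Real.sign ⟪y, M.ν⟫ + 1))
    ((M.measurable_obliqueWeight φ).comp (measurable_id.prodMk (measurable_const (a := (0 : ℝ)))))
    (fun y => M.abs_obliqueWeight_le φ (y, 0))
    (fun _ hε => M.integrable_exp_foldNeg hε) ht M.N x
  have hsum : fderiv ℝ (M.halfSolution φ t) x = fderiv ℝ (M.freePotential φ t) x +
      fderiv ℝ (M.imagePotential φ t) x + fderiv ℝ (M.obliquePotential φ t) x := by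
    have e1 := (c1.differentiable (by norm_num) x).hasFDerivAt
    have e2 := (c2.differentiable (by norm_num) x).hasFDerivAt
    have e3 := (c3.differentiable (by norm_num) x).hasFDerivAt
    exact ((e1.add e2).add e3).fderiv
  rw [hsum, _root_.add_apply, _root_.add_apply, d1, d2, d3, ← integral_add i1 i2,
    ← integral_add (f := fun y => φ y * M.gaussDeriv t M.beta (x - y) +
      -φ y * M.gaussDeriv t M.beta (x - M.foldNeg y)) (i1.add i2) i3, ← integral_const_mul]
  refine integral_congr_ae ?_
  filter_upwards [M.ae_inner_ne_zero] with y hy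
  rcases lt_or_gt_of_ne hy with h | h
  -- For y below, the image coincides with y: the first two terms cancel and the weight 1 - q is
  -- left.
  · rw [M.foldNeg_of_nonpos h.le, Real.sign_of_neg h]; ring
  -- For y above, x lies on the membrane and is fixed by the reflection, so all derivatives can be
  -- moved to x - y. The total is ∂_{N+α} - ∂_{-N+α} - (1 + q)∂_N = (1 - q)∂_N.
  · have hxr : x - M.refl y = M.refl (x - y) := by rw [refl_sub, M.refl_of_tangent hx]
    rw [M.foldNeg_of_nonneg h.le, Real.sign_of_pos h, hxr, gaussDeriv_refl, gaussDeriv_refl,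
      refl_N, refl_beta, gaussDeriv_neg_dir, gaussDeriv_neg_dir, gaussDeriv_sub_dir, beta,
      gaussDeriv_add_dir]
    ring

/-- The oblique derivatives from the two sides are (1 - q)I and -(1 + q)I with the same integral I,
because the flipped problem replaces N and q by their negatives. -/
lemma solution_conjugation {t : ℝ} (ht : 0 < t) {x : E d} (hx : ⟪x, M.ν⟫ = 0) :
    ∃ (gp gm : E d) (a : ℝ),
      Tendsto (fun ε : ℝ => gradient (M.solution φ t) (x + ε • M.ν)) (𝓝[>] 0) (𝓝 gp) ∧
      Tendsto (fun ε : ℝ => gradient (M.solution φ t) (x - ε • M.ν)) (𝓝[>] 0) (𝓝 gm) ∧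
      HasLineDerivAt ℝ (M.solution φ t) a x M.α ∧ ⟪M.α, gp⟫ = a ∧ ⟪M.α, gm⟫ = a ∧
      (1 + M.q) / 2 * ⟪M.N, gp⟫ - (1 - M.q) / 2 * ⟪M.N, gm⟫ + a = 0 := by
  obtain ⟨g1, g2⟩ := M.tendsto_gradient_solution φ ht hx
  obtain ⟨l1, l2⟩ := M.hasLineDerivAt_solution φ ht hx
  have hl : fderiv ℝ (M.flip.halfSolution φ t) x M.α = fderiv ℝ (M.halfSolution φ t) x M.α :=
    l2.unique l1
  refine ⟨_, _, _, g1, g2, l1, inner_gradient_eq _ _, (inner_gradient_eq _ _).trans hl, ?_⟩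
  have h1 := M.fderiv_halfSolution_beta φ ht hx
  have h2 := M.flip.fderiv_halfSolution_beta φ ht (x := x)
    (by change ⟪x, -M.ν⟫ = 0; rw [inner_neg_right, hx, neg_zero])
  rw [beta, map_add] at h1 h2
  have h3 : ∀ y, M.flip.gaussDeriv t M.flip.N (x - y) = -M.gaussDeriv t M.N (x - y) := fun y =>
    M.gaussDeriv_neg_dir t M.N (x - y)
  simp only [h3, mul_neg, integral_neg] at h2
  change fderiv ℝ (M.flip.halfSolution φ t) x (-M.N) + fderiv ℝ (M.flip.halfSolution φ t) x M.α
    = -((1 - (-M.q)) * _) at h2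
  rw [map_neg, hl] at h2
  rw [inner_gradient_eq, inner_gradient_eq]
  -- These weights sum to 1, which collects the α-derivatives with coefficient one, and they cancel
  -- I.
  linear_combination (1 + M.q) / 2 * h1 + (1 - M.q) / 2 * h2

/-! ### Scaling and the initial condition -/

lemma integral_eq_scaled {t : ℝ} (ht : 0 < t) (f : E d → ℝ) (x : E d) :
    ∫ y, f y = ∫ v, √t ^ d * f (x + √t • v) := by
  have h := Measure.integral_comp_smul (volume : Measure (E d)) (fun v => f (x + v)) √t
  rw [finrank_euclideanSpace, Fintype.card_fin, integral_add_left_eq_self f x,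
    abs_of_pos (by positivity), smul_eq_mul] at h
  rw [integral_const_mul, h, ← mul_assoc, mul_inv_cancel₀ (by positivity), one_mul]

lemma exists_scaled_kernel_le : ∃ C > 0, ∃ c > 0, ∀ t : ℝ, 0 < t → ∀ x v : E d,
    √t ^ d * M.kernel t x (x + √t • v) ≤ C * Real.exp (-c * ‖v‖ ^ 2) := by
  obtain ⟨C, hC, c, hc, h⟩ := M.exists_kernel_le
  refine ⟨C, hC, c, hc, fun t ht x v => ?_⟩
  have h1 := h t ht x (x + √t • v)
  rw [add_sub_cancel_left, norm_smul, Real.norm_of_nonneg (Real.sqrt_nonneg t), mul_pow,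
    Real.sq_sqrt ht.le, show -(c / t) * (t * ‖v‖ ^ 2) = -c * ‖v‖ ^ 2 by field_simp] at h1
  have hp : 0 < √t ^ d := by positivity
  calc √t ^ d * M.kernel t x (x + √t • v)
      ≤ √t ^ d * (C * (√t ^ d)⁻¹ * Real.exp (-c * ‖v‖ ^ 2)) :=
        mul_le_mul_of_nonneg_left h1 hp.le
    _ = C * Real.exp (-c * ‖v‖ ^ 2) := by field_simp

/-- After y = x + √t v the scaled density has a Gaussian bound independent of t, so dominated
convergence applies to φ(x + √t v) - φ(x). Convergence of the scaled density itself is not needed,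
only its boundedness and unit mass. -/
lemma solution_initial (x : E d) :
    Tendsto (fun t => M.solution φ t x) (𝓝[>] 0) (𝓝 (φ x)) := by
  obtain ⟨C, hC, c, hc, h⟩ := M.exists_scaled_kernel_le
  have hdom : Tendsto (fun t => ∫ v, (φ (x + √t • v) - φ x) *
      (√t ^ d * M.kernel t x (x + √t • v))) (𝓝[>] 0) (𝓝 (∫ _ : E d, 0)) := by
    refine tendsto_integral_filter_of_dominated_convergence
      (fun v => 2 * ‖φ‖ * (C * Real.exp (-c * ‖v‖ ^ 2))) ?_ ?_ ?_ ?_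
    · filter_upwards [self_mem_nhdsWithin] with t ht
      have ht' : 0 < t := ht
      have hv : Measurable fun v : E d => x + √t • v := by fun_prop
      have hk : Measurable fun v : E d => M.kernel t x (x + √t • v) :=
        ((M.measurable_kernel ht').comp measurable_prodMk_left).comp hv
      have hφ : Measurable fun v : E d => φ (x + √t • v) - φ x :=
        (φ.continuous.measurable.comp hv).sub_const _
      exact (hφ.mul (hk.const_mul _)).aestronglyMeasurable
    · filter_upwards [self_mem_nhdsWithin] with t ht
      have ht' : 0 < t := ht
      refine ae_of_all _ fun v => ?_
      have h0 : 0 ≤ √t ^ d * M.kernel t x (x + √t • v) :=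
        mul_nonneg (by positivity) (M.kernel_nonneg ht' x _)
      rw [norm_mul, Real.norm_of_nonneg h0]
      refine mul_le_mul ?_ (h t ht' x v) h0 (by positivity)
      rw [two_mul]
      exact (norm_sub_le _ _).trans (add_le_add (φ.norm_coe_le_norm _) (φ.norm_coe_le_norm _))
    · exact ((integrable_exp_neg_mul_sq_norm hc).const_mul _).const_mul _
    · refine ae_of_all _ fun v => ?_
      have h1 : Tendsto (fun t : ℝ => |φ (x + √t • v) - φ x| * C) (𝓝[>] 0) (𝓝 0) := by
        have : Tendsto (fun t : ℝ => |φ (x + √t • v) - φ x| * C) (𝓝 0)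
            (𝓝 (|φ (x + √0 • v) - φ x| * C)) := Continuous.tendsto (by fun_prop) 0
        rw [Real.sqrt_zero, zero_smul, add_zero, sub_self, abs_zero, zero_mul] at this
        exact this.mono_left nhdsWithin_le_nhds
      refine squeeze_zero_norm' ?_ h1
      filter_upwards [self_mem_nhdsWithin] with t ht
      have ht' : 0 < t := ht
      have h0 : 0 ≤ √t ^ d * M.kernel t x (x + √t • v) :=
        mul_nonneg (by positivity) (M.kernel_nonneg ht' x _)
      rw [norm_mul, Real.norm_eq_abs, Real.norm_of_nonneg h0]
      refine mul_le_mul_of_nonneg_left ((h t ht' x v).trans ?_) (abs_nonneg _)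
      refine mul_le_of_le_one_right hC.le (Real.exp_le_one_iff.2 ?_)
      nlinarith [sq_nonneg ‖v‖]
  rw [integral_zero] at hdom
  have hfin := hdom.add_const (φ x)
  rw [zero_add] at hfin
  refine hfin.congr' ?_
  filter_upwards [self_mem_nhdsWithin] with t ht
  have ht' : 0 < t := ht
  have hi : Integrable fun y => φ y * M.kernel t x y :=
    (M.integrable_kernel ht' x).bdd_mul (c := ‖φ‖) φ.continuous.aestronglyMeasurable
      (ae_of_all _ φ.norm_coe_le_norm)
  have e1 : ∫ v, (φ (x + √t • v) - φ x) * (√t ^ d * M.kernel t x (x + √t • v)) =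
      ∫ y, (φ y - φ x) * M.kernel t x y := by
    rw [integral_eq_scaled ht' (fun y => (φ y - φ x) * M.kernel t x y) x]
    congr 1; ext v; ring
  rw [e1, solution]
  simp only [sub_mul]
  rw [integral_sub hi ((M.integrable_kernel ht' x).const_mul _), integral_const_mul,
    M.integral_kernel ht']
  ring

lemma solution_solves (B : Matrix (Fin d) (Fin d) ℝ) (hBA : ∀ v, B.toEuclideanLin (M.A v) = v)
    (hN : conormal B M.ν = M.N) :
    SolvesConjugationProblem B M.ν M.q M.α φ (M.solution φ) where
  heat _ ht x hx := M.solution_heat φ B hBA ht (fun h => hx ((M.mem_S_iff x).2 h))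
  initial := M.solution_initial φ
  continuity _ ht x hx := M.solution_continuity φ ht ((M.mem_S_iff x).1 hx)
  conjugation _ ht x hx := by
    rw [hN]
    exact M.solution_conjugation φ ht ((M.mem_S_iff x).1 hx)

end Setup

/-! ### Markov chains -/

section Chain

open Preorder

variable {X : Type*} [MeasurableSpace X]

/-- The transition kernel at time `n` of a Markov chain, as a kernel from the past. -/
def chainStep (K : ℕ → Kernel X X) (n : ℕ) : Kernel (Finset.Iic n → X) X :=
  (K n).comap (fun u => u ⟨n, Finset.mem_Iic.2 le_rfl⟩) (measurable_pi_apply _)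

instance (K : ℕ → Kernel X X) [∀ n, IsMarkovKernel (K n)] (n : ℕ) :
    IsMarkovKernel (chainStep K n) := by
  unfold chainStep; infer_instance

/-- The law of the Markov chain with transition kernels `K n`, as a kernel from the initial
position. -/
def chain (K : ℕ → Kernel X X) [∀ n, IsMarkovKernel (K n)] : Kernel X (ℕ → X) :=
  (Kernel.traj (X := fun _ => X) (chainStep K) 0).comap (fun x _ => x) (by fun_prop)

instance (K : ℕ → Kernel X X) [∀ n, IsMarkovKernel (K n)] : IsMarkovKernel (chain K) := by
  unfold chain; infer_instance

/-- `m` is the law of a Markov chain with transition kernels `K n`. -/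
def IsChainLaw (K : ℕ → Kernel X X) (m : Measure (ℕ → X)) : Prop :=
  ∀ l, m.map (fun ξ => (frestrictLe (π := fun _ => X) l ξ, ξ (l + 1))) =
    m.map (frestrictLe (π := fun _ => X) l) ⊗ₘ chainStep K l

lemma isChainLaw_chain (K : ℕ → Kernel X X) [∀ n, IsMarkovKernel (K n)] (x : X) :
    IsChainLaw K (chain K x) := by
  intro l
  have h := Kernel.partialTraj_compProd_eq_map_traj (X := fun _ => X) (κ := chainStep K)
    (a := 0) (b := l) (Nat.zero_le l) (x₀ := fun _ => x)
  rw [← Kernel.traj_map_frestrictLe_apply] at h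
  exact h.symm

lemma chain_start [MeasurableSingletonClass X] (K : ℕ → Kernel X X) [∀ n, IsMarkovKernel (K n)]
    (x : X) : ∀ᵐ ξ ∂(chain K x), ξ 0 = x := by
  have h := Kernel.traj_map_frestrictLe_apply (X := fun _ => X) (κ := chainStep K) 0 0
    (fun _ => x)
  rw [Kernel.partialTraj_self, Kernel.id_apply] at h
  have h1 : ∀ᵐ u ∂(Measure.dirac (fun _ => x : Finset.Iic 0 → X)),
      u ⟨0, Finset.mem_Iic.2 le_rfl⟩ = x := by
    rw [ae_dirac_iff]
    exact (measurableSet_singleton x).preimage (measurable_pi_apply (X := fun _ => X)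
      (⟨0, Finset.mem_Iic.2 le_rfl⟩ : Finset.Iic 0))
  rw [← h] at h1
  exact ae_of_ae_map (Measurable.aemeasurable (by fun_prop)) h1

variable {K : ℕ → Kernel X X} {m : Measure (ℕ → X)}

lemma IsChainLaw.lintegral_eq [∀ n, IsMarkovKernel (K n)] [SFinite m] (hm : IsChainLaw K m) (l : ℕ)
    {h : (Finset.Iic l → X) × X → ENNReal} (hh : Measurable h) :
    ∫⁻ ξ, h (frestrictLe (π := fun _ => X) l ξ, ξ (l + 1)) ∂m =
      ∫⁻ ξ, ∫⁻ y, h (frestrictLe (π := fun _ => X) l ξ, y) ∂(K l (ξ l)) ∂m := by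
  have h1 : Measurable fun ξ : ℕ → X => (frestrictLe (π := fun _ => X) l ξ, ξ (l + 1)) := by
    fun_prop
  rw [← lintegral_map hh h1, hm l, Measure.lintegral_compProd hh, lintegral_map]
  · rfl
  · exact hh.lintegral_kernel_prod_right'
  · fun_prop

lemma map_frestrictLe_succ (m : Measure (ℕ → X)) (l : ℕ) :
    m.map (frestrictLe (π := fun _ => X) (l + 1)) =
      (m.map (fun ξ => (frestrictLe (π := fun _ => X) l ξ, ξ (l + 1)))).map
        (fun p i => if h : i.1 ≤ l then p.1 ⟨i.1, Finset.mem_Iic.2 h⟩ else p.2) := by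
  rw [Measure.map_map]
  · congr 1
    ext ξ i
    simp only [Function.comp, frestrictLe_apply]
    split_ifs with h
    · rfl
    · have : i.1 = l + 1 := le_antisymm (Finset.mem_Iic.1 i.2) (by omega)
      rw [this]
  · refine measurable_pi_iff.2 fun i => ?_
    by_cases h : i.1 ≤ l
    · simp only [h, dite_true]; fun_prop
    · simp only [h, dite_false]; fun_prop
  · fun_prop

/-- The initial law and the one-step kernels determine the law of each initial segment by induction,
and these determine the law on sequences as a projective limit. -/
lemma IsChainLaw.unique [IsFiniteMeasure m] {m' : Measure (ℕ → X)} [IsFiniteMeasure m']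
    (hm : IsChainLaw K m) (hm' : IsChainLaw K m')
    (h0 : m.map (fun ξ => ξ 0) = m'.map (fun ξ => ξ 0)) : m = m' := by
  have key : ∀ l, m.map (frestrictLe (π := fun _ => X) l) =
      m'.map (frestrictLe (π := fun _ => X) l) := by
    intro l
    induction l with
    | zero =>
      have e : (frestrictLe (π := fun _ => X) 0) = (fun (x : X) (_ : Finset.Iic 0) => x) ∘
          fun ξ : ℕ → X => ξ 0 := by
        ext ξ i
        have : i.1 = 0 := Nat.le_zero.1 (Finset.mem_Iic.1 i.2)
        simp [frestrictLe_apply, this]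
      rw [e, ← Measure.map_map (by fun_prop) (by fun_prop),
        ← Measure.map_map (by fun_prop) (by fun_prop), h0]
    | succ l ih => rw [map_frestrictLe_succ, map_frestrictLe_succ, hm l, hm' l, ih]
  have hp : IsProjectiveLimit m' (fun I : Finset ℕ => m'.map (I.restrict)) := fun I => rfl
  refine IsProjectiveLimit.unique ?_ hp
  refine (isProjectiveLimit_nat_iff (fun I J hJI => ?_) m).2 key
  rw [Measure.map_map (Finset.measurable_restrict₂ (X := fun _ => X) hJI) (by fun_prop)]
  rfl

/-- Dropping the odd times merges two steps into one. The integral is reduced first from time 2l + 2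
to 2l + 1, then to 2l, with the merged past depending on even times only. -/
lemma IsChainLaw.subsample [SFinite m] {L L' : Kernel X X} [IsMarkovKernel L] [IsMarkovKernel L']
    (hm : IsChainLaw (fun _ => L) m) (hL : L' = L ∘ₖ L) :
    IsChainLaw (fun _ => L') (m.map fun ξ k => ξ (2 * k)) := by
  intro l
  have hr : Measurable fun (ξ : ℕ → X) (k : ℕ) => ξ (2 * k) := by fun_prop
  have hs : ∀ n, 2 * l ≤ n → ∃ s : (Finset.Iic n → X) → (Finset.Iic l → X), Measurable s ∧
      ∀ ξ : ℕ → X, s (frestrictLe (π := fun _ => X) n ξ) =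
        frestrictLe (π := fun _ => X) l (fun k => ξ (2 * k)) := by
    intro n hn
    have hi : ∀ i : Finset.Iic l, 2 * i.1 ∈ Finset.Iic n := fun i => by
      have := Finset.mem_Iic.1 i.2
      exact Finset.mem_Iic.2 (by omega)
    exact ⟨fun u i => u ⟨2 * i.1, hi i⟩, by fun_prop, fun ξ => rfl⟩
  obtain ⟨s, ms, es⟩ := hs (2 * l + 1) (by omega)
  obtain ⟨s', ms', es'⟩ := hs (2 * l) le_rfl
  refine Measure.ext_of_lintegral _ fun h hh => ?_
  have hf : Measurable fun ξ : ℕ → X => (frestrictLe (π := fun _ => X) l ξ, ξ (l + 1)) := by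
    fun_prop
  have hf' : Measurable (frestrictLe (π := fun _ => X) l) := by fun_prop
  rw [Measure.lintegral_compProd hh, Measure.map_map hf hr, Measure.map_map hf' hr,
    lintegral_map hh (hf.comp hr), lintegral_map hh.lintegral_kernel_prod_right' (hf'.comp hr)]
  have e1 := hm.lintegral_eq (2 * l + 1) (h := fun p => h (s p.1, p.2)) (by fun_prop)
  have e2 := hm.lintegral_eq (2 * l) (h := fun p => ∫⁻ y, h (s' p.1, y) ∂(L p.2)) (by
    have : Measurable fun p : ((Finset.Iic (2 * l) → X) × X) × X => h (s' p.1.1, p.2) := by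
      fun_prop
    exact Measurable.lintegral_kernel_prod_right' (κ := L.comap Prod.snd measurable_snd) this)
  simp only [es] at e1
  simp only [es'] at e2
  simp only [chainStep, Kernel.comap_apply]
  calc _ = _ := e1
    _ = _ := e2
    _ = _ := by
      refine lintegral_congr fun ξ => ?_
      simp only [hL, Function.comp]
      rw [Kernel.lintegral_comp _ _ _ (by fun_prop)]
      rfl

/-- The Markov property of a homogeneous chain over several steps. -/
lemma IsChainLaw.map_pair [SFinite m] {L : Kernel X X} [IsMarkovKernel L]
    (hm : IsChainLaw (fun _ => L) m) {Q : ℕ → Kernel X X} [∀ j, IsSFiniteKernel (Q j)]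
    (hQ1 : Q 1 = L) (hQ : ∀ j, 1 ≤ j → Q (j + 1) = L ∘ₖ Q j) (k : ℕ) {j : ℕ} (hj : 1 ≤ j) :
    m.map (fun ξ => (frestrictLe (π := fun _ => X) k ξ, ξ (k + j))) =
      m.map (frestrictLe (π := fun _ => X) k) ⊗ₘ
        (Q j).comap (fun u => u ⟨k, Finset.mem_Iic.2 le_rfl⟩) (measurable_pi_apply _) := by
  have key : ∀ h : (Finset.Iic k → X) × X → ENNReal, Measurable h →
      ∫⁻ ξ, h (frestrictLe (π := fun _ => X) k ξ, ξ (k + j)) ∂m =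
        ∫⁻ ξ, ∫⁻ y, h (frestrictLe (π := fun _ => X) k ξ, y) ∂(Q j (ξ k)) ∂m := by
    induction j, hj using Nat.le_induction with
    | base =>
      intro h hh
      rw [hQ1]
      exact hm.lintegral_eq k hh
    | succ j hj ih =>
      intro h hh
      have h1 := hm.lintegral_eq (k + j) (h := fun p => h (fun i => p.1 ⟨i.1,
        Finset.mem_Iic.2 ((Finset.mem_Iic.1 i.2).trans (Nat.le_add_right k j))⟩, p.2))
        (by fun_prop)
      have h2 := ih (fun p => ∫⁻ y, h (p.1, y) ∂(L p.2)) (by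
        have : Measurable fun p : ((Finset.Iic k → X) × X) × X => h (p.1.1, p.2) := by
          fun_prop
        exact Measurable.lintegral_kernel_prod_right' (κ := L.comap Prod.snd measurable_snd) this)
      refine (h1.trans h2).trans (lintegral_congr fun ξ => ?_)
      have hy : Measurable fun y => h (frestrictLe (π := fun _ => X) k ξ, y) := by fun_prop
      rw [hQ j hj, Kernel.lintegral_comp _ _ _ hy]
  refine Measure.ext_of_lintegral _ fun h hh => ?_
  rw [lintegral_map hh (by fun_prop), Measure.lintegral_compProd hh,
    lintegral_map hh.lintegral_kernel_prod_right' (by fun_prop), key h hh]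
  rfl

lemma IsChainLaw.integral_mul [IsFiniteMeasure m] {L : Kernel X X} [IsMarkovKernel L]
    (hm : IsChainLaw (fun _ => L) m) {Q : ℕ → Kernel X X} [∀ j, IsFiniteKernel (Q j)]
    (hQ1 : Q 1 = L) (hQ : ∀ j, 1 ≤ j → Q (j + 1) = L ∘ₖ Q j) (k : ℕ) {j : ℕ} (hj : 1 ≤ j)
    {g : (Finset.Iic k → X) → ℝ} (hg : Measurable g) {Cg : ℝ} (hgb : ∀ u, ‖g u‖ ≤ Cg)
    {f : X → ℝ} (hf : Measurable f) {Cf : ℝ} (hfb : ∀ y, ‖f y‖ ≤ Cf) :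
    ∫ ξ, g (frestrictLe (π := fun _ => X) k ξ) * f (ξ (k + j)) ∂m =
      ∫ ξ, g (frestrictLe (π := fun _ => X) k ξ) * ∫ y, f y ∂(Q j (ξ k)) ∂m := by
  have h := hm.map_pair hQ1 hQ k hj
  have hF : Measurable fun p : (Finset.Iic k → X) × X => g p.1 * f p.2 := by fun_prop
  have hr : Measurable fun ξ : ℕ → X => (frestrictLe (π := fun _ => X) k ξ, ξ (k + j)) := by
    fun_prop
  have h1 : ∫ ξ, g (frestrictLe (π := fun _ => X) k ξ) * f (ξ (k + j)) ∂m =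
      ∫ p, g p.1 * f p.2 ∂(m.map (fun ξ => (frestrictLe (π := fun _ => X) k ξ, ξ (k + j)))) :=
    (integral_map hr.aemeasurable hF.aestronglyMeasurable).symm
  rw [h1, h, Measure.integral_compProd]
  · simp only [integral_const_mul]
    rw [integral_map (Measurable.aemeasurable (by fun_prop))]
    · rfl
    · refine (hg.mul ?_).aestronglyMeasurable
      exact (hf.stronglyMeasurable.integral_kernel
        (κ := (Q j).comap (fun u : Finset.Iic k → X => u ⟨k, Finset.mem_Iic.2 le_rfl⟩)
          (measurable_pi_apply _))).measurable
  · refine Integrable.of_bound hF.aestronglyMeasurable (Cg * Cf) (ae_of_all _ fun p => ?_)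
    rw [norm_mul]
    exact mul_le_mul (hgb _) (hfb _) (norm_nonneg _) ((norm_nonneg _).trans (hgb p.1))

end Chain

/-! ### Successive refinement of the time grid -/

section Refinement

variable {X : Type*} [MeasurableSpace X]

/-- Observation at even times. -/
def evens (ξ : ℕ → X) (k : ℕ) : X := ξ (2 * k)

lemma measurable_evens : Measurable (evens : (ℕ → X) → ℕ → X) := by
  unfold evens; fun_prop

lemma map_eval_zero_of_ae_eq {m : Measure (ℕ → X)} [IsProbabilityMeasure m] {x : X}
    (h : ∀ᵐ ξ ∂m, ξ 0 = x) : m.map (fun ξ => ξ 0) = Measure.dirac x := by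
  rw [Measure.map_congr (g := fun _ => x) h, Measure.map_const, measure_univ, one_smul]

variable [StandardBorelSpace X] (Q : ℕ → Kernel X X) [∀ n, IsMarkovKernel (Q n)]

/-- The law of the chain observed on the `n`-th grid. -/
def level (n : ℕ) : Kernel X (ℕ → X) := chain fun _ => Q n

instance (n : ℕ) : IsMarkovKernel (level Q n) := by unfold level; infer_instance

lemma level_start (n : ℕ) (x : X) : ∀ᵐ ξ ∂(level Q n x), ξ 0 = x := chain_start _ x

/-- Both sides are chain laws for the same step kernel and the same starting point, so uniqueness
applies. This is the consistency of the grids. -/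
lemma level_map_evens (hQ : ∀ n, Q n = Q (n + 1) ∘ₖ Q (n + 1)) (n : ℕ) (x : X) :
    (level Q (n + 1) x).map evens = level Q n x := by
  have : IsProbabilityMeasure ((level Q (n + 1) x).map evens) :=
    Measure.isProbabilityMeasure_map measurable_evens.aemeasurable
  refine IsChainLaw.unique (K := fun _ => Q n)
    ((isChainLaw_chain (fun _ => Q (n + 1)) x).subsample (hQ n)) (isChainLaw_chain _ x) ?_
  rw [map_eval_zero_of_ae_eq (level_start Q n x), map_eval_zero_of_ae_eq]
  exact (ae_map_iff measurable_evens.aemeasurable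
    ((measurableSet_singleton x).preimage (measurable_pi_apply 0))).2 (level_start Q (n + 1) x)

variable [Nonempty X]

/-- The joint law of the chains observed on two successive grids. -/
def pairLaw (n : ℕ) : Kernel X ((ℕ → X) × (ℕ → X)) :=
  (level Q (n + 1)).map fun ξ => (evens ξ, ξ)

instance (n : ℕ) : IsMarkovKernel (pairLaw Q n) :=
  Kernel.IsMarkovKernel.map _ (measurable_evens.prodMk measurable_id)

/-- The conditional law of the chain on the grid `n + 1` given the chain on the grid `n`. -/
def refinement (n : ℕ) : Kernel (ℕ → X) (ℕ → X) :=
  (pairLaw Q n).condKernel.comap (fun ξ => (ξ 0, ξ)) (by fun_prop)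

instance (n : ℕ) : IsMarkovKernel (refinement Q n) := by unfold refinement; infer_instance

/-- Disintegration of the joint law on two successive grids. The starting point is a parameter of
the conditional kernel; reading it off as ξ 0 removes the parameter, almost surely without change.
-/
lemma level_compProd_refinement (hQ : ∀ n, Q n = Q (n + 1) ∘ₖ Q (n + 1)) (n : ℕ) (x : X) :
    level Q n x ⊗ₘ refinement Q n = (level Q (n + 1) x).map fun ξ => (evens ξ, ξ) := by
  have hm : Measurable fun ξ : ℕ → X => (evens ξ, ξ) := measurable_evens.prodMk measurable_id
  have hfst : (pairLaw Q n).fst x = level Q n x := by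
    rw [Kernel.fst_apply, pairLaw, Kernel.map_apply _ hm, Measure.map_map measurable_fst hm,
      ← level_map_evens Q hQ n]
    rfl
  have hd : ((pairLaw Q n).fst ⊗ₖ (pairLaw Q n).condKernel) x =
      (level Q (n + 1) x).map fun ξ => (evens ξ, ξ) := by
    rw [(pairLaw Q n).disintegrate (pairLaw Q n).condKernel, pairLaw, Kernel.map_apply _ hm]
  rw [← hd]
  refine Measure.ext_of_lintegral _ fun h hh => ?_
  rw [Measure.lintegral_compProd hh, Kernel.lintegral_compProd _ _ _ hh, hfst]
  refine lintegral_congr_ae ?_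
  filter_upwards [level_start Q n x] with ξ hξ
  rw [refinement, Kernel.comap_apply, hξ]

/-- The joint law of the chains on all grids, as a kernel from the initial position. -/
def gridLaw : Kernel X (ℕ → ℕ → X) := chain (refinement Q) ∘ₖ level Q 0

instance : IsMarkovKernel (gridLaw Q) := by unfold gridLaw; infer_instance

lemma gridLaw_map_pair (n : ℕ) (x : X) :
    (gridLaw Q x).map (fun ω => (ω n, ω (n + 1))) =
      (gridLaw Q x).map (fun ω => ω n) ⊗ₘ refinement Q n := by
  refine Measure.ext_of_lintegral _ fun h hh => ?_
  have hh' : Measurable fun ω : ℕ → ℕ → X => ∫⁻ y, h (ω n, y) ∂(refinement Q n (ω n)) :=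
    (hh.lintegral_kernel_prod_right' (κ := refinement Q n)).comp (measurable_pi_apply n)
  have hh'' : Measurable fun ω : ℕ → ℕ → X => h (ω n, ω (n + 1)) := by fun_prop
  rw [Measure.lintegral_compProd hh, lintegral_map hh (by fun_prop),
    lintegral_map hh.lintegral_kernel_prod_right' (by fun_prop), gridLaw,
    Kernel.lintegral_comp _ _ _ hh', Kernel.lintegral_comp _ _ _ hh'']
  refine lintegral_congr fun ξ => ?_
  exact (isChainLaw_chain (refinement Q) ξ).lintegral_eq n
    (h := fun p => h (p.1 ⟨n, Finset.mem_Iic.2 le_rfl⟩, p.2)) (by fun_prop)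

/-- By induction: refining a chain on grid n with the conditional law gives a chain on grid n + 1.
-/
lemma gridLaw_map (hQ : ∀ n, Q n = Q (n + 1) ∘ₖ Q (n + 1)) (n : ℕ) (x : X) :
    (gridLaw Q x).map (fun ω => ω n) = level Q n x := by
  induction n with
  | zero =>
    refine Measure.ext_of_lintegral _ fun h hh => ?_
    rw [lintegral_map hh (by fun_prop), gridLaw, Kernel.lintegral_comp _ _ _ (by fun_prop)]
    refine lintegral_congr fun ξ => ?_
    rw [lintegral_congr_ae (g := fun _ => h ξ), lintegral_const, measure_univ, mul_one]
    filter_upwards [chain_start (refinement Q) ξ] with ω hω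
    rw [hω]
  | succ n ih =>
    have h1 := gridLaw_map_pair Q n x
    rw [ih, level_compProd_refinement Q hQ] at h1
    have h2 := congrArg (fun m => Measure.map Prod.snd m) h1
    have hm : Measurable fun ξ : ℕ → X => (evens ξ, ξ) := measurable_evens.prodMk measurable_id
    rw [Measure.map_map measurable_snd (by fun_prop), Measure.map_map measurable_snd hm] at h2
    exact h2.trans Measure.map_id

lemma gridLaw_consistent (hQ : ∀ n, Q n = Q (n + 1) ∘ₖ Q (n + 1)) (x : X) :
    ∀ᵐ ω ∂(gridLaw Q x), ∀ n k, ω n k = ω (n + 1) (2 * k) := by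
  refine ae_all_iff.2 fun n => ae_all_iff.2 fun k => ?_
  have h1 := gridLaw_map_pair Q n x
  rw [gridLaw_map Q hQ, level_compProd_refinement Q hQ] at h1
  have hs : MeasurableSet {p : (ℕ → X) × (ℕ → X) | p.1 k = p.2 (2 * k)} :=
    measurableSet_eq_fun (by fun_prop) (by fun_prop)
  have h2 : ∀ᵐ p : (ℕ → X) × (ℕ → X) ∂((gridLaw Q x).map (fun ω => (ω n, ω (n + 1)))), p.1 k = p.2 (2 * k) := by
    rw [h1]
    exact (ae_map_iff (measurable_evens.prodMk measurable_id).aemeasurable hs).2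
      (ae_of_all _ fun ξ => rfl)
  exact ae_of_ae_map (Measurable.aemeasurable (by fun_prop)) h2

end Refinement

/-! ### Interpolation of the grid values -/

section Interpolation

variable {V : Type*} [NormedAddCommGroup V]

/-- The value on the `n`-th grid at the last grid point before `t`. -/
def gridValue {V : Type*} (n : ℕ) (t : ℝ≥0) (ω : ℕ → ℕ → V) : V := ω n ⌊t * 2 ^ n⌋₊

lemma measurable_gridValue {V : Type*} [MeasurableSpace V] (n : ℕ) (t : ℝ≥0) :
    Measurable (gridValue n t : (ℕ → ℕ → V) → V) := by
  unfold gridValue; fun_prop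

/-- Consistent grid values with increments that are locally uniformly geometrically small. -/
def regular : Set (ℕ → ℕ → V) :=
  {ω | (∀ n k, ω n k = ω (n + 1) (2 * k)) ∧ ∀ T : ℕ, ∃ n₀, ∀ n, n₀ ≤ n → ∀ k, k < T * 2 ^ n →
    ‖ω n (k + 1) - ω n k‖ ≤ (9 / 10 : ℝ) ^ n}

lemma floor_mul_two_pow_lt {t : ℝ≥0} {T : ℕ} (ht : t < T) (n : ℕ) :
    ⌊t * 2 ^ n⌋₊ < T * 2 ^ n := by
  rw [Nat.floor_lt (zero_le)]
  push_cast
  exact mul_lt_mul_of_pos_right ht (by positivity)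

/-- The last grid point before t either stays or moves by one step when the grid is halved, so
successive approximations differ by at most one fine increment. -/
lemma floor_mul_two_pow_succ (t : ℝ≥0) (n : ℕ) :
    ⌊t * 2 ^ (n + 1)⌋₊ = 2 * ⌊t * 2 ^ n⌋₊ ∨ ⌊t * 2 ^ (n + 1)⌋₊ = 2 * ⌊t * 2 ^ n⌋₊ + 1 := by
  set k := ⌊t * 2 ^ n⌋₊ with hk
  have h1 : (k : ℝ≥0) ≤ t * 2 ^ n := Nat.floor_le zero_le
  have h2 : t * 2 ^ n < k + 1 := Nat.lt_floor_add_one _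
  have h3 : 2 * k ≤ ⌊t * 2 ^ (n + 1)⌋₊ := by
    rw [Nat.le_floor_iff zero_le, pow_succ, ← mul_assoc, mul_comm]
    push_cast
    exact mul_le_mul_of_nonneg_right h1 zero_le |>.trans_eq' (by ring)
  have h4 : ⌊t * 2 ^ (n + 1)⌋₊ < 2 * k + 2 := by
    rw [Nat.floor_lt zero_le, pow_succ, ← mul_assoc]
    push_cast
    calc t * 2 ^ n * 2 < (k + 1) * 2 := mul_lt_mul_of_pos_right h2 two_pos
      _ = 2 * k + 2 := by ring
  omega

lemma dist_gridValue_succ_le {ω : ℕ → ℕ → V} (hc : ∀ n k, ω n k = ω (n + 1) (2 * k)) {T n₀ : ℕ}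
    (h : ∀ n, n₀ ≤ n → ∀ k, k < T * 2 ^ n → ‖ω n (k + 1) - ω n k‖ ≤ (9 / 10 : ℝ) ^ n)
    {t : ℝ≥0} (ht : t < T) {n : ℕ} (hn : n₀ ≤ n) :
    dist (gridValue n t ω) (gridValue (n + 1) t ω) ≤ (9 / 10 : ℝ) ^ (n + 1) := by
  have h1 := floor_mul_two_pow_lt ht (n + 1)
  rw [gridValue, gridValue, hc]
  rcases floor_mul_two_pow_succ t n with h2 | h2
  · rw [h2, dist_self]; positivity
  · rw [h2, dist_comm, dist_eq_norm]
    exact h (n + 1) (by omega) _ (by omega)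

lemma dist_gridValue_le {ω : ℕ → ℕ → V} {T n₀ : ℕ}
    (h : ∀ n, n₀ ≤ n → ∀ k, k < T * 2 ^ n → ‖ω n (k + 1) - ω n k‖ ≤ (9 / 10 : ℝ) ^ n)
    {s t : ℝ≥0} (hs : s ≤ t) (ht : t < T) {n : ℕ} (hn : n₀ ≤ n) (hst : (t - s : ℝ) * 2 ^ n ≤ 1) :
    dist (gridValue n s ω) (gridValue n t ω) ≤ (9 / 10 : ℝ) ^ n := by
  have h1 : ⌊s * 2 ^ n⌋₊ ≤ ⌊t * 2 ^ n⌋₊ := Nat.floor_mono (mul_le_mul_of_nonneg_right hs zero_le)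
  have h2 : ⌊t * 2 ^ n⌋₊ ≤ ⌊s * 2 ^ n⌋₊ + 1 := by
    rw [← Nat.floor_add_one zero_le]
    refine Nat.floor_mono ?_
    rw [← NNReal.coe_le_coe]
    push_cast
    linarith
  have h3 := floor_mul_two_pow_lt ht n
  rw [gridValue, gridValue]
  rcases h1.eq_or_lt with h4 | h4
  · rw [h4, dist_self]; positivity
  · rw [show ⌊t * 2 ^ n⌋₊ = ⌊s * 2 ^ n⌋₊ + 1 by omega, dist_comm, dist_eq_norm]
    exact h n hn _ (by omega)

variable [CompleteSpace V]

open Classical in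
/-- The path interpolating regular grid values. -/
def path (t : ℝ≥0) (ω : ℕ → ℕ → V) : V :=
  if ω ∈ regular then limUnder atTop (fun n => gridValue n t ω) else 0

lemma tendsto_gridValue {ω : ℕ → ℕ → V} (hω : ω ∈ regular) (t : ℝ≥0) :
    Tendsto (fun n => gridValue n t ω) atTop (𝓝 (path t ω)) := by
  rw [path, if_pos hω]
  obtain ⟨hc, hr⟩ := hω
  obtain ⟨T, hT⟩ := exists_nat_gt t
  obtain ⟨n₀, h⟩ := hr T
  have hcs : CauchySeq fun n => gridValue (n + n₀) t ω := by
    refine cauchySeq_of_le_geometric (9 / 10) ((9 / 10) ^ (n₀ + 1)) (by norm_num) fun n => ?_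
    have := dist_gridValue_succ_le hc h hT (n := n + n₀) (by omega)
    rw [show n + 1 + n₀ = n + n₀ + 1 by ring]
    exact this.trans_eq (by rw [← pow_add]; congr 1; ring)
  obtain ⟨a, ha⟩ := cauchySeq_tendsto_of_complete hcs
  exact tendsto_nhds_limUnder ⟨a, (tendsto_add_atTop_iff_nat n₀).1 ha⟩

lemma dist_gridValue_path_le {ω : ℕ → ℕ → V} (hω : ω ∈ regular) {T n₀ : ℕ}
    (h : ∀ n, n₀ ≤ n → ∀ k, k < T * 2 ^ n → ‖ω n (k + 1) - ω n k‖ ≤ (9 / 10 : ℝ) ^ n)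
    {t : ℝ≥0} (ht : t < T) {n : ℕ} (hn : n₀ ≤ n) :
    dist (gridValue n t ω) (path t ω) ≤ 9 * (9 / 10 : ℝ) ^ n := by
  -- The tail of the geometric series: the sum of (9/10)^m over m > n is 9 (9/10)^n.
  have h1 := dist_le_of_le_geometric_of_tendsto₀ (9 / 10) ((9 / 10) ^ (n + 1))
    (f := fun m => gridValue (m + n) t ω) (by norm_num) (fun m => by
      have := dist_gridValue_succ_le hω.1 h ht (n := m + n) (by omega)
      rw [show m + 1 + n = m + n + 1 by ring]
      exact this.trans_eq (by rw [← pow_add]; congr 1; ring))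
    ((tendsto_add_atTop_iff_nat n).2 (tendsto_gridValue hω t))
  simp only [zero_add] at h1
  refine h1.trans_eq ?_
  rw [pow_succ]; ring

lemma continuous_path (ω : ℕ → ℕ → V) : Continuous fun t => path t ω := by
  by_cases hω : ω ∈ regular
  swap
  · simp only [path, if_neg hω]; exact continuous_const
  rw [Metric.continuous_iff]
  intro t ε hε
  obtain ⟨T, hT⟩ := exists_nat_gt (t + 1)
  obtain ⟨n₀, h⟩ := hω.2 T
  -- 19 = 9 + 1 + 9: two distances from path to grid value and one grid increment, for times at most
  -- 2⁻ⁿ apart.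
  have hlim : Tendsto (fun n : ℕ => 19 * (9 / 10 : ℝ) ^ n) atTop (𝓝 (19 * 0)) :=
    (tendsto_pow_atTop_nhds_zero_of_lt_one (by norm_num) (by norm_num)).const_mul _
  rw [mul_zero] at hlim
  obtain ⟨n, hn0, hn⟩ := ((eventually_ge_atTop n₀).and (hlim.eventually (gt_mem_nhds hε))).exists
  have hpow : (1 : ℝ) ≤ 2 ^ n := one_le_pow₀ (by norm_num)
  refine ⟨(2 ^ n)⁻¹, by positivity, fun s hs => ?_⟩
  rw [NNReal.dist_eq] at hs
  have hs1 : |(s - t : ℝ)| * 2 ^ n ≤ 1 := by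
    have := mul_le_mul_of_nonneg_right hs.le (by positivity : (0 : ℝ) ≤ 2 ^ n)
    rwa [inv_mul_cancel₀ (by positivity)] at this
  have hs2 : |(s - t : ℝ)| ≤ 1 := by nlinarith [abs_nonneg (s - t : ℝ)]
  have hT' : (t : ℝ) + 1 < T := by exact_mod_cast hT
  have htT : t < T := lt_of_le_of_lt (by simp) hT
  have hsT : s < T := by
    rw [← NNReal.coe_lt_coe]
    push_cast
    linarith [(abs_le.1 hs2).2]
  have key : dist (gridValue n s ω) (gridValue n t ω) ≤ (9 / 10 : ℝ) ^ n := by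
    rcases le_total s t with hst | hst
    · refine dist_gridValue_le h hst htT hn0 (le_trans ?_ hs1)
      exact mul_le_mul_of_nonneg_right (by rw [abs_sub_comm]; exact le_abs_self _) (by positivity)
    · rw [dist_comm]
      refine dist_gridValue_le h hst hsT hn0 (le_trans ?_ hs1)
      exact mul_le_mul_of_nonneg_right (le_abs_self _) (by positivity)
  have e1 := dist_gridValue_path_le hω h hsT hn0
  have e2 := dist_gridValue_path_le hω h htT hn0
  calc dist (path s ω) (path t ω)
      ≤ dist (path s ω) (gridValue n s ω) + dist (gridValue n s ω) (gridValue n t ω) +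
          dist (gridValue n t ω) (path t ω) := dist_triangle4 _ _ _ _
    _ ≤ 9 * (9 / 10 : ℝ) ^ n + (9 / 10 : ℝ) ^ n + 9 * (9 / 10 : ℝ) ^ n := by
        rw [dist_comm (path s ω)]; gcongr
    _ < ε := by linarith

lemma path_zero {ω : ℕ → ℕ → V} (hω : ω ∈ regular) : path 0 ω = ω 0 0 := by
  refine tendsto_nhds_unique (tendsto_gridValue hω 0) (tendsto_const_nhds.congr fun n => ?_)
  simp only [gridValue, zero_mul, Nat.floor_zero]
  induction n with
  | zero => rfl
  | succ n ih => rw [ih, hω.1 n 0, mul_zero]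

variable [MeasurableSpace V] [BorelSpace V] [SecondCountableTopology V]

lemma measurableSet_regular : MeasurableSet (regular : Set (ℕ → ℕ → V)) := by
  have h1 : MeasurableSet {ω : ℕ → ℕ → V | ∀ n k, ω n k = ω (n + 1) (2 * k)} := by
    simp only [Set.ofPred_forall]
    exact MeasurableSet.iInter fun n => MeasurableSet.iInter fun k =>
      measurableSet_eq_fun (by fun_prop) (by fun_prop)
  have h2 : MeasurableSet {ω : ℕ → ℕ → V | ∀ T : ℕ, ∃ n₀, ∀ n, n₀ ≤ n → ∀ k, k < T * 2 ^ n →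
      ‖ω n (k + 1) - ω n k‖ ≤ (9 / 10 : ℝ) ^ n} := by
    simp only [Set.ofPred_forall, Set.ofPred_exists]
    exact MeasurableSet.iInter fun T => MeasurableSet.iUnion fun n₀ => MeasurableSet.iInter fun n =>
      MeasurableSet.iInter fun _ => MeasurableSet.iInter fun k => MeasurableSet.iInter fun _ =>
      measurableSet_le (by fun_prop) measurable_const
  exact h1.inter h2

lemma measurable_path (t : ℝ≥0) : Measurable (path t : (ℕ → ℕ → V) → V) := by
  refine measurable_of_tendsto_metrizable (f := fun n => regular.indicator (gridValue n t))
    (fun n => (measurable_gridValue n t).indicator measurableSet_regular) ?_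
  rw [tendsto_pi_nhds]
  intro ω
  by_cases hω : ω ∈ regular
  · simp only [Set.indicator_of_mem hω]
    exact tendsto_gridValue hω t
  · simp only [Set.indicator_of_notMem hω, path, if_neg hω]
    exact tendsto_const_nhds

end Interpolation

/-! ### Regularity of the grid values -/

section Moments

variable {V : Type*} [NormedAddCommGroup V] [MeasurableSpace V] [BorelSpace V]
  [SecondCountableTopology V]
  (Q : ℕ → Kernel V V) [∀ n, IsMarkovKernel (Q n)]

/-- Chebyshev's inequality with the fourth moment: 10000/26244 is (1/4) / (9/10)⁴. -/
lemma level_increment_le {C : ℝ}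
    (hC : ∀ n x, ∫⁻ y, ENNReal.ofReal (‖y - x‖ ^ 4) ∂(Q n x) ≤ ENNReal.ofReal (C * (1 / 4) ^ n))
    (n k : ℕ) (x : V) :
    level Q n x {ξ | (9 / 10 : ℝ) ^ n < ‖ξ (k + 1) - ξ k‖} ≤
      ENNReal.ofReal (C * (10000 / 26244) ^ n) := by
  have h1 : ∫⁻ ξ, ENNReal.ofReal (‖ξ (k + 1) - ξ k‖ ^ 4) ∂(level Q n x) ≤
      ENNReal.ofReal (C * (1 / 4) ^ n) := by
    have h := (isChainLaw_chain (fun _ => Q n) x).lintegral_eq k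
      (h := fun p => ENNReal.ofReal (‖p.2 - p.1 ⟨k, Finset.mem_Iic.2 le_rfl⟩‖ ^ 4)) (by fun_prop)
    refine h.trans_le ((lintegral_mono fun ξ : ℕ → V => hC n (ξ k)).trans_eq ?_)
    rw [lintegral_const, measure_univ, mul_one]
  set r : ℝ := ((9 / 10 : ℝ) ^ n) ^ 4 with hr
  have hr0 : 0 < r := by positivity
  have h2 := mul_meas_ge_le_lintegral (μ := level Q n x)
    (f := fun ξ => ENNReal.ofReal (‖ξ (k + 1) - ξ k‖ ^ 4)) (by fun_prop) (ENNReal.ofReal r)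
  have h3 : level Q n x {ξ | (9 / 10 : ℝ) ^ n < ‖ξ (k + 1) - ξ k‖} ≤
      level Q n x {ξ | ENNReal.ofReal r ≤ ENNReal.ofReal (‖ξ (k + 1) - ξ k‖ ^ 4)} := by
    refine measure_mono fun ξ hξ => ENNReal.ofReal_le_ofReal ?_
    exact pow_le_pow_left₀ (by positivity) (le_of_lt hξ) 4
  refine h3.trans ?_
  have h4 : ENNReal.ofReal r * level Q n x {ξ | ENNReal.ofReal r ≤
      ENNReal.ofReal (‖ξ (k + 1) - ξ k‖ ^ 4)} ≤ ENNReal.ofReal (C * (1 / 4) ^ n) := h2.trans h1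
  rw [mul_comm, ← ENNReal.le_div_iff_mul_le (.inl (by simpa using hr0)) (.inl ENNReal.ofReal_ne_top),
    ← ENNReal.ofReal_div_of_pos hr0] at h4
  refine h4.trans_eq ?_
  congr 1
  rw [hr, ← pow_mul, mul_comm n 4, pow_mul, mul_div_assoc, ← div_pow]
  norm_num

/-- Borel–Cantelli. There are T · 2ⁿ increments before time T, and the doubled ratio 20000/26244 is
still below 1; this is where moments of order t² are needed. -/
lemma ae_regular [CompleteSpace V] (hQ : ∀ n, Q n = Q (n + 1) ∘ₖ Q (n + 1)) {C : ℝ}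
    (hC : ∀ n x, ∫⁻ y, ENNReal.ofReal (‖y - x‖ ^ 4) ∂(Q n x) ≤ ENNReal.ofReal (C * (1 / 4) ^ n))
    (x : V) : ∀ᵐ ω ∂(gridLaw Q x), ω ∈ regular := by
  have key : ∀ T : ℕ, ∀ᵐ ω ∂(gridLaw Q x), ∀ᶠ n in atTop,
      ω ∉ {ω : ℕ → ℕ → V | ∃ k < T * 2 ^ n, (9 / 10 : ℝ) ^ n < ‖ω n (k + 1) - ω n k‖} := by
    intro T
    refine ae_eventually_notMem ?_
    have hb : ∀ n, gridLaw Q x {ω : ℕ → ℕ → V | ∃ k < T * 2 ^ n, (9 / 10 : ℝ) ^ n <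
        ‖ω n (k + 1) - ω n k‖} ≤ ENNReal.ofReal (T * C * (20000 / 26244) ^ n) := by
      intro n
      have e : {ω : ℕ → ℕ → V | ∃ k < T * 2 ^ n, (9 / 10 : ℝ) ^ n < ‖ω n (k + 1) - ω n k‖} =
          ⋃ k ∈ Finset.range (T * 2 ^ n), (fun ω : ℕ → ℕ → V => ω n) ⁻¹'
            {ξ | (9 / 10 : ℝ) ^ n < ‖ξ (k + 1) - ξ k‖} := by
        ext ω; simp
      rw [e]
      refine (measure_biUnion_finset_le _ _).trans ?_
      refine (Finset.sum_le_sum (g := fun _ => ENNReal.ofReal (C * (10000 / 26244) ^ n))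
        fun k _ => ?_).trans ?_
      · rw [← Measure.map_apply (measurable_pi_apply n) (measurableSet_lt (by fun_prop) (by fun_prop)),
          gridLaw_map Q hQ]
        exact level_increment_le Q hC n k x
      · rw [Finset.sum_const, Finset.card_range, nsmul_eq_mul, ← ENNReal.ofReal_natCast,
          ← ENNReal.ofReal_mul (by positivity)]
        refine ENNReal.ofReal_le_ofReal (le_of_eq ?_)
        push_cast
        rw [show (20000 / 26244 : ℝ) = 2 * (10000 / 26244) by norm_num, mul_pow]
        ring
    refine ne_top_of_le_ne_top ?_ (ENNReal.tsum_le_tsum hb)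
    exact (Summable.mul_left _ (summable_geometric_of_lt_one (by norm_num)
      (by norm_num))).tsum_ofReal_ne_top
  filter_upwards [gridLaw_consistent Q hQ x, ae_all_iff.2 key] with ω h1 h2
  refine ⟨h1, fun T => ?_⟩
  obtain ⟨n₀, h⟩ := eventually_atTop.1 (h2 T)
  refine ⟨n₀, fun n hn k hk => ?_⟩
  have := h n hn
  simp only [not_exists, not_and, not_lt] at this
  exact this k hk

end Moments

/-! ### Transition kernels -/

section Transition

variable {d : ℕ} {p : ℝ → E d → E d → ℝ}

/-- The transition kernel with density `p t`. -/
def transKernel (p : ℝ → E d → E d → ℝ) (t : ℝ) : Kernel (E d) (E d) :=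
  (Kernel.const _ volume).withDensity fun x y => ENNReal.ofReal (p t x y)

lemma IsTransitionDensity.measurable_ofReal (hp : IsTransitionDensity p) {t : ℝ} (ht : 0 < t) :
    Measurable (Function.uncurry fun x y => ENNReal.ofReal (p t x y)) :=
  (hp.measurable t ht).ennreal_ofReal

lemma transKernel_apply (hp : IsTransitionDensity p) {t : ℝ} (ht : 0 < t) (x : E d) :
    transKernel p t x = volume.withDensity fun y => ENNReal.ofReal (p t x y) := by
  rw [transKernel, Kernel.withDensity_apply _ (hp.measurable_ofReal ht), Kernel.const_apply]

lemma transKernel_apply_set (hp : IsTransitionDensity p) {t : ℝ} (ht : 0 < t) (x : E d)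
    {A : Set (E d)} (hA : MeasurableSet A) :
    transKernel p t x A = ENNReal.ofReal (∫ y in A, p t x y) := by
  rw [transKernel_apply hp ht, withDensity_apply _ hA,
    ofReal_integral_eq_lintegral_ofReal (hp.integrable t ht x).restrict
      (ae_of_all _ (hp.nonneg t ht x))]

lemma isMarkovKernel_transKernel (hp : IsTransitionDensity p) {t : ℝ} (ht : 0 < t) :
    IsMarkovKernel (transKernel p t) :=
  ⟨fun x => ⟨by rw [transKernel_apply_set hp ht x MeasurableSet.univ, setIntegral_univ,
    hp.integral_eq_one t ht, ENNReal.ofReal_one]⟩⟩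

lemma lintegral_transKernel (hp : IsTransitionDensity p) {t : ℝ} (ht : 0 < t) (x : E d)
    {f : E d → ENNReal} (hf : Measurable f) :
    ∫⁻ y, f y ∂(transKernel p t x) = ∫⁻ y, ENNReal.ofReal (p t x y) * f y := by
  have hm : Measurable fun y => ENNReal.ofReal (p t x y) :=
    (hp.measurable_ofReal ht).comp measurable_prodMk_left
  rw [transKernel_apply hp ht, lintegral_withDensity_eq_lintegral_mul _ hm hf]
  rfl

lemma integral_transKernel (hp : IsTransitionDensity p) {t : ℝ} (ht : 0 < t) (x : E d)
    (f : E d → ℝ) : ∫ y, f y ∂(transKernel p t x) = ∫ y, f y * p t x y := by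
  have hm : Measurable fun y => ENNReal.ofReal (p t x y) :=
    (hp.measurable_ofReal ht).comp measurable_prodMk_left
  rw [transKernel_apply hp ht, integral_withDensity_eq_integral_toReal_smul hm
    (ae_of_all _ fun y => ENNReal.ofReal_lt_top)]
  congr 1; ext y
  rw [smul_eq_mul, mul_comm]
  congr 1
  exact ENNReal.toReal_ofReal (hp.nonneg t ht x y)

lemma transKernel_comp (hp : IsTransitionDensity p) {s t : ℝ} (hs : 0 < s) (ht : 0 < t) :
    transKernel p t ∘ₖ transKernel p s = transKernel p (s + t) := by
  have := isMarkovKernel_transKernel hp ht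
  ext x A hA
  have h0 : ∀ z, 0 ≤ ∫ y in A, p t z y := fun z => integral_nonneg (hp.nonneg t ht z)
  have hm : Measurable fun z => transKernel p t z A := Kernel.measurable_coe _ hA
  have hm' : Measurable fun z => ∫ y in A, p t z y := by
    have h : (fun z => ∫ y in A, p t z y) = fun z => (transKernel p t z A).toReal := by
      ext z
      rw [transKernel_apply_set hp ht z hA, ENNReal.toReal_ofReal (h0 z)]
    rw [h]
    exact hm.ennreal_toReal
  have h1 : ∀ z, ∫ y in A, p t z y ≤ 1 := fun z =>
    (setIntegral_le_integral (hp.integrable t ht z) (ae_of_all _ (hp.nonneg t ht z))).trans_eq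
      (hp.integral_eq_one t ht z)
  rw [Kernel.comp_apply' _ _ _ hA, lintegral_transKernel hp hs x hm,
    transKernel_apply_set hp (add_pos hs ht) x hA, ← hp.chapman_kolmogorov s t hs ht x A hA,
    ofReal_integral_eq_lintegral_ofReal]
  · refine lintegral_congr fun z => ?_
    rw [transKernel_apply_set hp ht z hA, ENNReal.ofReal_mul (hp.nonneg s hs x z)]
  · refine (hp.integrable s hs x).mono' ((hp.integrable s hs x).aestronglyMeasurable.mul
      hm'.aestronglyMeasurable) (ae_of_all _ fun z => ?_)
    rw [Real.norm_eq_abs, abs_of_nonneg (mul_nonneg (hp.nonneg s hs x z) (h0 z))]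
    exact mul_le_of_le_one_right (hp.nonneg s hs x z) (h1 z)
  · exact ae_of_all _ fun z => mul_nonneg (hp.nonneg s hs x z) (h0 z)

end Transition

/-! ### The Markov property of the limiting path -/

section Transition

variable {d : ℕ} {p : ℝ → E d → E d → ℝ}

lemma IsTransitionDensity.measurable_integral_mul (hp : IsTransitionDensity p) {t : ℝ}
    (ht : 0 < t) (g : E d →ᵇ ℝ) : Measurable fun z => ∫ y, g y * p t z y := by
  have := isMarkovKernel_transKernel hp ht
  simp only [← integral_transKernel hp ht]
  exact (g.continuous.stronglyMeasurable.integral_kernel (κ := transKernel p t)).measurable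

lemma IsTransitionDensity.abs_integral_mul_le (hp : IsTransitionDensity p) {t : ℝ}
    (ht : 0 < t) (g : E d →ᵇ ℝ) (z : E d) : |∫ y, g y * p t z y| ≤ ‖g‖ := by
  have := isMarkovKernel_transKernel hp ht
  rw [← integral_transKernel hp ht, ← Real.norm_eq_abs]
  exact (norm_integral_le_of_norm_le_const (ae_of_all _ fun y => g.norm_coe_le_norm y)).trans
    (by simp)

lemma norm_prod_boundedContinuous_le {ι V : Type*} [Fintype ι] [TopologicalSpace V]
    (f : ι → V →ᵇ ℝ) (z : ι → V) : ‖∏ i, f i (z i)‖ ≤ ∏ i, ‖f i‖ := by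
  rw [norm_prod]
  exact Finset.prod_le_prod (fun i _ => norm_nonneg _) fun i _ => (f i).norm_coe_le_norm _

lemma dyadic_comp {Q : ℕ → Kernel (E d) (E d)} (hp : IsTransitionDensity p) (hQ : ∀ n, Q n = transKernel p ((1 / 2) ^ n))
    (n : ℕ) : Q n = Q (n + 1) ∘ₖ Q (n + 1) := by
  rw [hQ n, hQ (n + 1), transKernel_comp hp (by positivity) (by positivity)]
  congr 1
  ring

variable {Q : ℕ → Kernel (E d) (E d)} [∀ n, IsMarkovKernel (Q n)]

/-- The Markov property on the `n`-th grid. -/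
lemma integral_gridValue_eq (hp : IsTransitionDensity p)
    (hQ : ∀ n, Q n = transKernel p ((1 / 2) ^ n)) (x : E d) (n : ℕ) {s t : ℝ≥0}
    (hk : ⌊s * 2 ^ n⌋₊ < ⌊(s + t) * 2 ^ n⌋₊) {J : Finset ℝ≥0} (hJ : ∀ r ∈ J, r ≤ s)
    (f : J → E d →ᵇ ℝ) (g : E d →ᵇ ℝ) :
    ∫ ω, (∏ i, f i (gridValue n i ω)) * g (gridValue n (s + t) ω) ∂(gridLaw Q x) =
      ∫ ω, (∏ i, f i (gridValue n i ω)) *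
        (∫ y, g y * p (((⌊(s + t) * 2 ^ n⌋₊ - ⌊s * 2 ^ n⌋₊ : ℕ) : ℝ) * (1 / 2) ^ n)
          (gridValue n s ω) y) ∂(gridLaw Q x) := by
  obtain ⟨j, hj, hkj⟩ : ∃ j, 1 ≤ j ∧ ⌊(s + t) * 2 ^ n⌋₊ = ⌊s * 2 ^ n⌋₊ + j :=
    ⟨⌊(s + t) * 2 ^ n⌋₊ - ⌊s * 2 ^ n⌋₊, by omega, by omega⟩
  set k := ⌊s * 2 ^ n⌋₊ with hkdef
  have hτ : 0 < (j : ℝ) * (1 / 2) ^ n := by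
    have : (0 : ℝ) < j := by exact_mod_cast hj
    positivity
  -- `max j 1` keeps the time positive, so that R is a Markov kernel for j = 0 as well; only j ≥ 1
  -- is used.
  let R : ℕ → Kernel (E d) (E d) := fun j => transKernel p (((max j 1 : ℕ) : ℝ) * (1 / 2) ^ n)
  have hR : ∀ j, 0 < ((max j 1 : ℕ) : ℝ) * (1 / 2) ^ n := fun j => by
    have : (0 : ℝ) < (max j 1 : ℕ) := by exact_mod_cast lt_of_lt_of_le Nat.one_pos (le_max_right _ _)
    positivity
  have hRM : ∀ j, IsMarkovKernel (R j) := fun j => isMarkovKernel_transKernel hp (hR j)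
  have hR1 : R 1 = Q n := by simp only [R]; rw [hQ]; norm_num
  have hRs : ∀ j, 1 ≤ j → R (j + 1) = Q n ∘ₖ R j := fun j hj => by
    simp only [R]
    rw [hQ, transKernel_comp hp (hR j) (by positivity), max_eq_left hj,
      max_eq_left (by omega : 1 ≤ j + 1)]
    congr 1
    push_cast
    ring
  have hfloor : ∀ i : J, ⌊i.1 * 2 ^ n⌋₊ ≤ k := fun i =>
    Nat.floor_mono (mul_le_mul_of_nonneg_right (hJ i.1 i.2) zero_le)
  have key := (isChainLaw_chain (fun _ => Q n) x).integral_mul hR1 hRs k hj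
    (g := fun w => ∏ i : J, f i (w ⟨⌊i.1 * 2 ^ n⌋₊, Finset.mem_Iic.2 (hfloor i)⟩))
    (Cg := ∏ i, ‖f i‖) (f := g) (Cf := ‖g‖)
    (Finset.measurable_fun_prod _ fun i _ =>
      (f i).continuous.measurable.comp (measurable_pi_apply _))
    (fun w => norm_prod_boundedContinuous_le f _) g.continuous.measurable g.norm_coe_le_norm
  have hRj : ∀ z, ∫ y, g y ∂(R j z) = ∫ y, g y * p ((j : ℝ) * (1 / 2) ^ n) z y := fun z => by
    simp only [R, max_eq_left hj]
    exact integral_transKernel hp hτ z g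
  simp only [hRj] at key
  have hlev : chain (fun _ => Q n) x = (gridLaw Q x).map (fun ω => ω n) :=
    (gridLaw_map Q (dyadic_comp hp hQ) n x).symm
  have hpr : Measurable fun ξ : ℕ → E d => ∏ i : J, f i (ξ ⌊i.1 * 2 ^ n⌋₊) :=
    Finset.measurable_fun_prod _ fun i _ =>
      (f i).continuous.measurable.comp (measurable_pi_apply _)
  have hn : Measurable fun ω : ℕ → ℕ → E d => ω n := measurable_pi_apply n
  rw [hlev, integral_map hn.aemeasurable, integral_map hn.aemeasurable] at key
  · simp only [gridValue, ← hkdef, hkj, Nat.add_sub_cancel_left]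
    exact key
  · exact (hpr.mul ((hp.measurable_integral_mul hτ g).comp
      (measurable_pi_apply k))).aestronglyMeasurable
  · exact (hpr.mul (g.continuous.measurable.comp
      (measurable_pi_apply (k + j)))).aestronglyMeasurable

lemma tendsto_floor_mul_two_pow (s : ℝ≥0) :
    Tendsto (fun n : ℕ => (⌊s * 2 ^ n⌋₊ : ℝ) * (1 / 2) ^ n) atTop (𝓝 s) := by
  have h : Tendsto (fun n : ℕ => (2 : ℝ) ^ n) atTop atTop :=
    tendsto_pow_atTop_atTop_of_one_lt (by norm_num)
  refine ((tendsto_nat_floor_mul_div_atTop s.2).comp h).congr fun n => ?_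
  have h2 : ⌊(s : ℝ) * 2 ^ n⌋₊ = ⌊s * 2 ^ n⌋₊ := by
    exact Nonneg.nat_floor_coe (s * 2 ^ n)
  simp only [Function.comp_apply, NNReal.val_eq_coe, h2, div_eq_mul_inv, one_mul, inv_pow]

lemma tendsto_floor_sub_mul_two_pow (s t : ℝ≥0) :
    Tendsto (fun n : ℕ => ((⌊(s + t) * 2 ^ n⌋₊ - ⌊s * 2 ^ n⌋₊ : ℕ) : ℝ) * (1 / 2) ^ n) atTop
      (𝓝 t) := by
  have h := (tendsto_floor_mul_two_pow (s + t)).sub (tendsto_floor_mul_two_pow s)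
  rw [NNReal.coe_add, add_sub_cancel_left] at h
  refine h.congr fun n => ?_
  rw [Nat.cast_sub (Nat.floor_mono (mul_le_mul_of_nonneg_right le_self_add zero_le)), sub_mul]

/-- Limit of the Markov property on the grids. Elapsed time and current position both vary with n,
hence the need for joint continuity in `hF`; dominated convergence does the rest. -/
lemma integral_path_eq (hp : IsTransitionDensity p)
    (hF : ∀ g : E d →ᵇ ℝ, ∀ t, 0 < t → ∀ z,
      ContinuousAt (fun w : ℝ × E d => ∫ y, g y * p w.1 w.2 y) (t, z))
    (hQ : ∀ n, Q n = transKernel p ((1 / 2) ^ n)) (x : E d)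
    (hreg : ∀ᵐ ω ∂(gridLaw Q x), ω ∈ regular) {s t : ℝ≥0} (ht : 0 < t)
    {J : Finset ℝ≥0} (hJ : ∀ r ∈ J, r ≤ s) (f : J → E d →ᵇ ℝ) (g : E d →ᵇ ℝ) :
    ∫ ω, (∏ i, f i (path i.1 ω)) * g (path (s + t) ω) ∂(gridLaw Q x) =
      ∫ ω, (∏ i, f i (path i.1 ω)) * (∫ y, g y * p t (path s ω) y) ∂(gridLaw Q x) := by
  have hτ := tendsto_floor_sub_mul_two_pow s t
  set τ : ℕ → ℝ := fun n => ((⌊(s + t) * 2 ^ n⌋₊ - ⌊s * 2 ^ n⌋₊ : ℕ) : ℝ) * (1 / 2) ^ n with hτdef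
  have hτpos : ∀ᶠ n in atTop, 0 < τ n := hτ.eventually_const_lt (by exact_mod_cast ht)
  have hfm : ∀ n, Measurable fun ω : ℕ → ℕ → E d => ∏ i : J, f i (gridValue n i ω) := fun n =>
    Finset.measurable_fun_prod _ fun i _ =>
      (f i).continuous.measurable.comp (measurable_gridValue n _)
  have hfl : ∀ ω ∈ regular, Tendsto (fun n => ∏ i : J, f i (gridValue n i ω)) atTop
      (𝓝 (∏ i : J, f i (path i.1 ω))) := fun ω hω => tendsto_finsetProd _ fun i _ =>
    ((f i).continuous.tendsto _).comp (tendsto_gridValue hω i)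
  have h1 : Tendsto (fun n => ∫ ω, (∏ i, f i (gridValue n i ω)) * g (gridValue n (s + t) ω)
      ∂(gridLaw Q x)) atTop
      (𝓝 (∫ ω, (∏ i, f i (path i.1 ω)) * g (path (s + t) ω) ∂(gridLaw Q x))) := by
    refine tendsto_integral_of_dominated_convergence (fun _ => (∏ i, ‖f i‖) * ‖g‖)
      (fun n => ((hfm n).mul (g.continuous.measurable.comp
        (measurable_gridValue n _))).aestronglyMeasurable)
      (integrable_const _) (fun n => ae_of_all _ fun ω => ?_) ?_
    · rw [norm_mul]
      exact mul_le_mul (norm_prod_boundedContinuous_le f _) (g.norm_coe_le_norm _)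
        (norm_nonneg _) (Finset.prod_nonneg fun i _ => norm_nonneg _)
    · filter_upwards [hreg] with ω hω
      exact (hfl ω hω).mul ((g.continuous.tendsto _).comp (tendsto_gridValue hω _))
  have h2 : Tendsto (fun n => ∫ ω, (∏ i, f i (gridValue n i ω)) *
      (∫ y, g y * p (τ n) (gridValue n s ω) y) ∂(gridLaw Q x)) atTop
      (𝓝 (∫ ω, (∏ i, f i (path i.1 ω)) * (∫ y, g y * p t (path s ω) y) ∂(gridLaw Q x))) := by
    refine tendsto_integral_filter_of_dominated_convergence (fun _ => (∏ i, ‖f i‖) * ‖g‖)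
      ?_ ?_ (integrable_const _) ?_
    · filter_upwards [hτpos] with n hn
      exact ((hfm n).mul ((hp.measurable_integral_mul hn g).comp
        (measurable_gridValue n _))).aestronglyMeasurable
    · filter_upwards [hτpos] with n hn
      refine ae_of_all _ fun ω => ?_
      rw [norm_mul]
      exact mul_le_mul (norm_prod_boundedContinuous_le f _) (hp.abs_integral_mul_le hn g _)
        (norm_nonneg _) (Finset.prod_nonneg fun i _ => norm_nonneg _)
    · filter_upwards [hreg] with ω hω
      have h3 : Tendsto (fun n => (τ n, gridValue n s ω)) atTop (𝓝 ((t : ℝ), path s ω)) :=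
        hτ.prodMk_nhds (tendsto_gridValue hω s)
      exact (hfl ω hω).mul ((hF g t (by exact_mod_cast ht) _).tendsto.comp h3)
  refine tendsto_nhds_unique_of_eventuallyEq h1 h2 ?_
  -- A positive grid time means that the two floors differ, so at least one step is made.
  filter_upwards [hτpos] with n hn
  refine integral_gridValue_eq hp hQ x n ?_ hJ f g
  by_contra hcon
  rw [hτdef] at hn
  simp [Nat.sub_eq_zero_of_le (not_lt.1 hcon)] at hn

lemma map_path_eq (hp : IsTransitionDensity p)
    (hF : ∀ g : E d →ᵇ ℝ, ∀ t, 0 < t → ∀ z,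
      ContinuousAt (fun w : ℝ × E d => ∫ y, g y * p w.1 w.2 y) (t, z))
    (hQ : ∀ n, Q n = transKernel p ((1 / 2) ^ n)) (x : E d)
    (hreg : ∀ᵐ ω ∂(gridLaw Q x), ω ∈ regular) {s t : ℝ≥0} (ht : 0 < t)
    {J : Finset ℝ≥0} (hJ : ∀ r ∈ J, r ≤ s) :
    (gridLaw Q x).map (fun ω => ((fun i : J => path i.1 ω), path (s + t) ω)) =
      (gridLaw Q x ⊗ₘ (transKernel p t).comap (path s) (measurable_path s)).map
        (fun w => ((fun i : J => path i.1 w.1), w.2)) := by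
  have ht' : (0 : ℝ) < t := by exact_mod_cast ht
  have := isMarkovKernel_transKernel hp ht'
  have hmp : ∀ r, Measurable (path r : (ℕ → ℕ → E d) → E d) := fun r => measurable_path r
  have hm1 : Measurable fun ω : ℕ → ℕ → E d => ((fun i : J => path i.1 ω), path (s + t) ω) :=
    (measurable_pi_lambda _ fun i => hmp _).prodMk (hmp _)
  have hm2 : Measurable fun w : (ℕ → ℕ → E d) × E d => ((fun i : J => path i.1 w.1), w.2) :=
    (measurable_pi_lambda _ fun i => (hmp _).comp measurable_fst).prodMk measurable_snd
  refine Measure.ext_of_integral_prod_mul_boundedContinuousFunction fun f g => ?_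
  have hc : Measurable fun w : (J → E d) × E d => (∏ i, f i (w.1 i)) * g w.2 := by
    refine Measurable.mul (Finset.measurable_fun_prod _ fun i _ => ?_) ?_
    · exact (f i).continuous.measurable.comp ((measurable_pi_apply i).comp measurable_fst)
    · exact g.continuous.measurable.comp measurable_snd
  rw [integral_map hm1.aemeasurable hc.aestronglyMeasurable,
    integral_map hm2.aemeasurable hc.aestronglyMeasurable, Measure.integral_compProd]
  · simp only [integral_const_mul]
    simp only [Kernel.comap_apply, integral_transKernel hp ht']
    exact integral_path_eq hp hF hQ x hreg ht hJ f g
  · refine Integrable.of_bound (hc.comp hm2).aestronglyMeasurable ((∏ i, ‖f i‖) * ‖g‖)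
      (ae_of_all _ fun w => ?_)
    rw [norm_mul]
    exact mul_le_mul (norm_prod_boundedContinuous_le f _) (g.norm_coe_le_norm _)
      (norm_nonneg _) (Finset.prod_nonneg fun i _ => norm_nonneg _)

lemma past_path_le (s : ℝ≥0) :
    past (path : ℝ≥0 → (ℕ → ℕ → E d) → E d) s ≤ MeasurableSpace.pi :=
  iSup₂_le fun r _ => (measurable_path r).comap_le

/-- Cylinder events at finitely many times up to s form a π-system generating the past, and two
finite measures that agree on it are equal. -/
lemma measure_inter_path_eq (hp : IsTransitionDensity p)
    (hF : ∀ g : E d →ᵇ ℝ, ∀ t, 0 < t → ∀ z,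
      ContinuousAt (fun w : ℝ × E d => ∫ y, g y * p w.1 w.2 y) (t, z))
    (hQ : ∀ n, Q n = transKernel p ((1 / 2) ^ n)) (x : E d)
    (hreg : ∀ᵐ ω ∂(gridLaw Q x), ω ∈ regular) {s t : ℝ≥0} (ht : 0 < t)
    {A : Set (E d)} (hA : MeasurableSet A) {D : Set (ℕ → ℕ → E d)}
    (hD : MeasurableSet[past path s] D) :
    gridLaw Q x (D ∩ path (s + t) ⁻¹' A) =
      ∫⁻ ω in D, transKernel p t (path s ω) A ∂(gridLaw Q x) := by
  have ht' : (0 : ℝ) < t := by exact_mod_cast ht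
  have := isMarkovKernel_transKernel hp ht'
  have hD' : MeasurableSet D := past_path_le s _ hD
  have hmp : ∀ r, Measurable (path r : (ℕ → ℕ → E d) → E d) := fun r => measurable_path r
  have hgen : ∀ J : Finset ℝ≥0, (∀ r ∈ J, r ≤ s) → ∀ U : J → Set (E d),
      (∀ i, MeasurableSet (U i)) →
      gridLaw Q x ((⋂ i : J, path i.1 ⁻¹' U i) ∩ path (s + t) ⁻¹' A) =
        ∫⁻ ω in ⋂ i : J, path i.1 ⁻¹' U i, transKernel p t (path s ω) A ∂(gridLaw Q x) := by
    intro J hJ U hU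
    have h := congrArg (fun m => m ((Set.univ.pi U) ×ˢ A))
      (map_path_eq hp hF hQ x hreg ht hJ)
    have hR : MeasurableSet ((Set.univ.pi U) ×ˢ A) := (MeasurableSet.univ_pi hU).prod hA
    have hm1 : Measurable fun ω : ℕ → ℕ → E d => ((fun i : J => path i.1 ω), path (s + t) ω) :=
      (measurable_pi_lambda _ fun i => hmp _).prodMk (hmp _)
    have hm2 : Measurable fun w : (ℕ → ℕ → E d) × E d => ((fun i : J => path i.1 w.1), w.2) :=
      (measurable_pi_lambda _ fun i => (hmp _).comp measurable_fst).prodMk measurable_snd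
    simp only [Measure.map_apply hm1 hR, Measure.map_apply hm2 hR] at h
    have e1 : (fun ω : ℕ → ℕ → E d => ((fun i : J => path i.1 ω), path (s + t) ω)) ⁻¹'
        ((Set.univ.pi U) ×ˢ A) = (⋂ i : J, path i.1 ⁻¹' U i) ∩ path (s + t) ⁻¹' A := by
      ext ω; simp
    have e2 : (fun w : (ℕ → ℕ → E d) × E d => ((fun i : J => path i.1 w.1), w.2)) ⁻¹'
        ((Set.univ.pi U) ×ˢ A) = (⋂ i : J, path i.1 ⁻¹' U i) ×ˢ A := by
      ext ω; simp
    have hI : MeasurableSet (⋂ i : J, (path i.1 ⁻¹' U i : Set (ℕ → ℕ → E d))) :=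
      MeasurableSet.iInter fun i => measurableSet_preimage (hmp i.1) (hU i)
    rw [e1, e2, Measure.compProd_apply_prod hI hA] at h
    exact h
  have hpast : past (path : ℝ≥0 → (ℕ → ℕ → E d) → E d) s = MeasurableSpace.generateFrom
      (piiUnionInter (fun r => {D | MeasurableSet[MeasurableSpace.comap (path r) inferInstance] D})
        (Set.Iic s)) := (generateFrom_piiUnionInter_measurableSet _ _).symm
  have hpi : IsPiSystem (piiUnionInter (fun r : ℝ≥0 => {D : Set (ℕ → ℕ → E d) |
      MeasurableSet[MeasurableSpace.comap (path r) inferInstance] D}) (Set.Iic s)) :=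
    isPiSystem_piiUnionInter _ (fun r => @MeasurableSpace.isPiSystem_measurableSet _
      (MeasurableSpace.comap (path r) inferInstance)) _
  have hext := ext_on_measurableSpace_of_generate_finite MeasurableSpace.pi
    (μ := (gridLaw Q x).restrict (path (s + t) ⁻¹' A))
    (ν := (gridLaw Q x).withDensity fun ω => transKernel p t (path s ω) A)
    _ ?_ (past_path_le s) hpast hpi ?_ hD
  · rwa [Measure.restrict_apply hD', withDensity_apply _ hD'] at hext
  · rintro _ ⟨J, hJ, f, hf, rfl⟩
    choose! U hU hUf using hf
    have e : ⋂ r ∈ J, f r = ⋂ i : J, path i.1 ⁻¹' U i.1 := by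
      ext ω
      simp only [Set.mem_iInter, Subtype.forall]
      exact forall₂_congr fun r hr => by rw [← hUf r hr]
    have hm : MeasurableSet (⋂ i : J, path i.1 ⁻¹' U i.1) :=
      MeasurableSet.iInter fun i => (hmp i.1) (hU i.1 i.2)
    rw [e, Measure.restrict_apply hm, withDensity_apply _ hm]
    exact hgen J (fun r hr => hJ hr) (fun i => U i.1) fun i => hU i.1 i.2
  · have h := hgen ∅ (by simp) (fun _ => Set.univ) fun _ => MeasurableSet.univ
    simpa using h

/-- A transition density with the Feller property and fourth moments of the increments of order
`t ^ 2` is the transition density of a continuous Markov process. -/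
theorem exists_isContinuousMarkovProcess (hp : IsTransitionDensity p)
    (hF : ∀ g : E d →ᵇ ℝ, ∀ t, 0 < t → ∀ z,
      ContinuousAt (fun w : ℝ × E d => ∫ y, g y * p w.1 w.2 y) (t, z)) {C : ℝ}
    (hC : ∀ t, 0 < t → ∀ z,
      ∫⁻ y, ENNReal.ofReal (p t z y) * ENNReal.ofReal (‖y - z‖ ^ 4) ≤
        ENNReal.ofReal (C * t ^ 2)) :
    ∃ (Ω : Type) (_ : MeasurableSpace Ω) (X : ℝ≥0 → Ω → E d) (P : Kernel (E d) Ω),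
      IsContinuousMarkovProcess X P p := by
  let Q : ℕ → Kernel (E d) (E d) := fun n => transKernel p ((1 / 2) ^ n)
  have hQM : ∀ n, IsMarkovKernel (Q n) := fun n => isMarkovKernel_transKernel hp (by positivity)
  have hQ : ∀ n, Q n = transKernel p ((1 / 2) ^ n) := fun n => rfl
  have hreg : ∀ x, ∀ᵐ ω ∂(gridLaw Q x), ω ∈ regular :=
    ae_regular Q (dyadic_comp hp hQ) (C := C) fun n z => by
      rw [hQ, lintegral_transKernel hp (by positivity) z (by fun_prop)]
      refine (hC _ (by positivity) z).trans_eq ?_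
      rw [← pow_mul, mul_comm n 2, pow_mul]
      norm_num
  refine ⟨ℕ → ℕ → E d, inferInstance, path, gridLaw Q, inferInstance,
    measurable_path, continuous_path, fun x => ?_, fun x s t ht A hA => ?_⟩
  · have h0 : ∀ᵐ ω ∂(gridLaw Q x), ω 0 0 = x := by
      have h := level_start Q 0 x
      rw [← gridLaw_map Q (dyadic_comp hp hQ)] at h
      exact ae_of_ae_map (measurable_pi_apply 0).aemeasurable h
    filter_upwards [hreg x, h0] with ω hω h
    rw [path_zero hω, h]
  · have ht' : (0 : ℝ) < t := by exact_mod_cast ht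
    have := isMarkovKernel_transKernel hp ht'
    have hval : ∀ z, ∫ y in A, p t z y = (transKernel p t z A).toReal := fun z => by
      rw [transKernel_apply_set hp ht' z hA,
        ENNReal.toReal_ofReal (integral_nonneg (hp.nonneg t ht' z))]
    simp only [hval]
    have hκ : Measurable fun z => transKernel p t z A := Kernel.measurable_coe _ hA
    have hpre : MeasurableSet (path (s + t) ⁻¹' A : Set (ℕ → ℕ → E d)) := measurable_path _ hA
    have hps : Measurable[past path s] (path s : (ℕ → ℕ → E d) → E d) :=
      (comap_measurable _).mono (le_iSup₂_of_le s le_rfl le_rfl) le_rfl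
    have hint : Integrable (fun ω => (transKernel p t (path s ω) A).toReal) (gridLaw Q x) :=
      Integrable.of_bound (hκ.ennreal_toReal.comp (measurable_path s)).aestronglyMeasurable 1
        (ae_of_all _ fun ω => by
          rw [Real.norm_of_nonneg ENNReal.toReal_nonneg]
          exact ENNReal.toReal_le_of_le_ofReal zero_le_one (by simpa using prob_le_one))
    refine (ae_eq_condExp_of_forall_setIntegral_eq (past_path_le s)
      ((integrable_const 1).indicator hpre) (fun D _ _ => hint.integrableOn)
      (fun D hD _ => ?_) ?_).symm
    · have hD' : MeasurableSet D := past_path_le s _ hD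
      have hκs : Measurable fun ω : ℕ → ℕ → E d => transKernel p t (path s ω) A :=
        hκ.comp (measurable_path s)
      rw [integral_toReal hκs.aemeasurable (ae_of_all _ fun ω => measure_lt_top _ _),
        ← measure_inter_path_eq hp hF hQ x (hreg x) ht hA hD,
        setIntegral_indicator hpre, setIntegral_const, smul_eq_mul, mul_one, measureReal_def]
    · exact (hκ.ennreal_toReal.comp hps).stronglyMeasurable.aestronglyMeasurable

end Transition

/-! ### The process with a membrane -/

/-- From z²/2 ≤ exp z at z = c r²/(2t), spending half of the exponent. -/
lemma pow_four_mul_exp_neg_le {c t : ℝ} (hc : 0 < c) (ht : 0 < t) (r : ℝ) :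
    r ^ 4 * Real.exp (-(c / t) * r ^ 2) ≤
      8 * t ^ 2 / c ^ 2 * Real.exp (-(c / (2 * t)) * r ^ 2) := by
  have h := Real.quadratic_le_exp_of_nonneg (x := c / (2 * t) * r ^ 2) (by positivity)
  have h0 : 0 ≤ c / (2 * t) * r ^ 2 := by positivity
  have h1 : r ^ 4 = 8 * t ^ 2 / c ^ 2 * ((c / (2 * t) * r ^ 2) ^ 2 / 2) := by
    field_simp; ring
  have h2 : r ^ 4 ≤ 8 * t ^ 2 / c ^ 2 * Real.exp (c / (2 * t) * r ^ 2) := by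
    rw [h1]
    exact mul_le_mul_of_nonneg_left (by linarith) (by positivity)
  refine (mul_le_mul_of_nonneg_right h2 (Real.exp_nonneg _)).trans_eq ?_
  rw [mul_assoc, ← Real.exp_add]
  congr 2
  field_simp; ring

namespace Setup

variable {d : ℕ} (M : Setup d)

/-- The Feller property. -/
lemma continuousAt_integral_mul_kernel (φ : E d →ᵇ ℝ) {t : ℝ} (ht : 0 < t) (x : E d) :
    ContinuousAt (fun w : ℝ × E d => ∫ y, φ y * M.kernel w.1 w.2 y) (t, x) := by
  obtain ⟨C, hC, c, hc, h⟩ := M.exists_kernel_le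
  have hpos : 0 < √(t / 2) ^ d := by positivity
  have hev : ∀ᶠ w : ℝ × E d in 𝓝 (t, x), t / 2 < w.1 ∧ w.1 < 2 * t ∧ ‖w.2‖ < ‖x‖ + 1 :=
    (continuousAt_fst.eventually_const_lt (by simp [ht])).and
      ((continuousAt_fst.eventually_lt_const (by simp; linarith)).and
        (continuousAt_snd.norm.eventually_lt_const (by simp)))
  refine continuousAt_of_dominated (bound := fun y => ‖φ‖ * (C * (√(t / 2) ^ d)⁻¹ *
    (Real.exp (c / (2 * t) * (‖x‖ + 1) ^ 2) * Real.exp (-(c / (2 * t) / 2) * ‖y‖ ^ 2)))) ?_ ?_ ?_ ?_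
  · filter_upwards [hev] with w hw
    have hw0 : 0 < w.1 := (by positivity : (0 : ℝ) < t / 2).trans hw.1
    exact φ.continuous.aestronglyMeasurable.mul
      (M.integrable_kernel hw0 w.2).aestronglyMeasurable
  · filter_upwards [hev] with w hw
    have hw0 : 0 < w.1 := (by positivity : (0 : ℝ) < t / 2).trans hw.1
    refine ae_of_all _ fun y => ?_
    rw [norm_mul, Real.norm_of_nonneg (M.kernel_nonneg hw0 w.2 y)]
    refine mul_le_mul (φ.norm_coe_le_norm y) ((h _ hw0 w.2 y).trans ?_)
      (M.kernel_nonneg hw0 w.2 y) (norm_nonneg _)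
    refine mul_le_mul (mul_le_mul_of_nonneg_left ?_ hC.le) ?_ (Real.exp_nonneg _) (by positivity)
    · exact inv_anti₀ hpos (pow_le_pow_left₀ (Real.sqrt_nonneg _)
        (Real.sqrt_le_sqrt hw.1.le) d)
    · refine le_trans ?_ (exp_neg_mul_sq_norm_sub_le (by positivity) hw.2.2.le)
      rw [norm_sub_rev, Real.exp_le_exp, neg_mul, neg_mul, neg_le_neg_iff]
      exact mul_le_mul_of_nonneg_right (div_le_div_of_nonneg_left hc.le hw0 hw.2.1.le)
        (sq_nonneg _)
  · exact (((integrable_exp_neg_mul_sq_norm (by positivity)).const_mul _).const_mul _).const_mul _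
  · exact ae_of_all _ fun y => continuousAt_const.mul (M.continuousAt_kernel ht x y)

/-- The Gaussian bound absorbs the fourth power at the price of t², and the remaining Gaussian has
mass independent of t after scaling. -/
lemma exists_lintegral_pow_four_le : ∃ C : ℝ, ∀ t, 0 < t → ∀ x : E d,
    ∫⁻ y, ENNReal.ofReal (M.kernel t x y) * ENNReal.ofReal (‖y - x‖ ^ 4) ≤
      ENNReal.ofReal (C * t ^ 2) := by
  obtain ⟨C, hC, c, hc, h⟩ := M.exists_kernel_le
  refine ⟨C * (8 / c ^ 2) * ∫ v : E d, Real.exp (-(c / 2) * ‖v‖ ^ 2), fun t ht x => ?_⟩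
  have hpos : 0 < √t ^ d := by positivity
  set g : E d → ℝ := fun y => C * (√t ^ d)⁻¹ * (8 * t ^ 2 / c ^ 2) *
    Real.exp (-(c / (2 * t)) * ‖y - x‖ ^ 2) with hg
  have hgi : Integrable g := ((integrable_exp_neg_mul_sq_norm (d := d) (ε := c / (2 * t))
    (by positivity)).comp_sub_right x).const_mul _
  have hgv : ∫ y, g y = C * (8 / c ^ 2) * (∫ v : E d, Real.exp (-(c / 2) * ‖v‖ ^ 2)) * t ^ 2 := by
    rw [integral_eq_scaled ht g x, mul_right_comm, ← integral_const_mul]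
    congr 1; ext v
    have e : -(c / (2 * t)) * ‖x + √t • v - x‖ ^ 2 = -(c / 2) * ‖v‖ ^ 2 := by
      rw [add_sub_cancel_left, norm_smul, Real.norm_of_nonneg (Real.sqrt_nonneg t), mul_pow,
        Real.sq_sqrt ht.le]
      field_simp
    simp only [hg, e]
    field_simp
  rw [← hgv, ofReal_integral_eq_lintegral_ofReal hgi (ae_of_all _ fun y => by positivity)]
  refine lintegral_mono fun y => ?_
  rw [← ENNReal.ofReal_mul (M.kernel_nonneg ht x y)]
  refine ENNReal.ofReal_le_ofReal ((mul_le_mul_of_nonneg_right (h t ht x y)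
    (by positivity)).trans ?_)
  rw [mul_right_comm, mul_assoc]
  simp only [hg]
  rw [mul_assoc (C * (√t ^ d)⁻¹)]
  exact mul_le_mul_of_nonneg_left (pow_four_mul_exp_neg_le hc ht _) (by positivity)

theorem exists_process : ∃ (Ω : Type) (_ : MeasurableSpace Ω) (X : ℝ≥0 → Ω → E d)
    (P : Kernel (E d) Ω), IsContinuousMarkovProcess X P M.kernel := by
  obtain ⟨C, hC⟩ := M.exists_lintegral_pow_four_le
  exact exists_isContinuousMarkovProcess M.isTransitionDensity_kernel
    (fun g t ht z => M.continuousAt_integral_mul_kernel g ht z) hC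

end Setup

/-! ### Values at positive times -/

section Congr

variable {d : ℕ} {p p' : ℝ → E d → E d → ℝ}

/-- `G` and `kernel` are identified at positive times only. This lemma and the two analogues below
record that nothing depends on other times. -/
lemma IsTransitionDensity.congr (hp : IsTransitionDensity p) (h : ∀ t, 0 < t → p' t = p t) :
    IsTransitionDensity p' where
  measurable t ht := by rw [h t ht]; exact hp.measurable t ht
  nonneg t ht := by rw [h t ht]; exact hp.nonneg t ht
  integrable t ht := by rw [h t ht]; exact hp.integrable t ht
  integral_eq_one t ht := by rw [h t ht]; exact hp.integral_eq_one t ht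
  chapman_kolmogorov s t hs ht := by
    rw [h s hs, h t ht, h _ (add_pos hs ht)]; exact hp.chapman_kolmogorov s t hs ht

lemma IsContinuousMarkovProcess.congr {Ω : Type} [MeasurableSpace Ω] {X : ℝ≥0 → Ω → E d}
    {P : Kernel (E d) Ω} (hX : IsContinuousMarkovProcess X P p) (h : ∀ t, 0 < t → p' t = p t) :
    IsContinuousMarkovProcess X P p' where
  isMarkovKernel := hX.isMarkovKernel
  measurable := hX.measurable
  continuous_paths := hX.continuous_paths
  start := hX.start
  markov x s t ht := by
    rw [h t (by exact_mod_cast ht)]; exact hX.markov x s t ht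

lemma SolvesConjugationProblem.congr {B : Matrix (Fin d) (Fin d) ℝ} {ν α : E d} {q : ℝ}
    {φ : E d → ℝ} {v v' : ℝ → E d → ℝ} (hv : SolvesConjugationProblem B ν q α φ v)
    (h : ∀ t, 0 < t → v' t = v t) : SolvesConjugationProblem B ν q α φ v' where
  heat t ht x hx := by
    rw [h t ht]
    refine ⟨(hv.heat t ht x hx).1, (hv.heat t ht x hx).2.congr_of_eventuallyEq ?_⟩
    filter_upwards [lt_mem_nhds ht] with s hs
    rw [h s hs]
  initial x := (hv.initial x).congr' (by
    filter_upwards [self_mem_nhdsWithin] with t ht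
    rw [h t ht])
  continuity t ht := by rw [h t ht]; exact hv.continuity t ht
  conjugation t ht := by rw [h t ht]; exact hv.conjugation t ht

end Congr

end Membrane

end

/-! ### Conclusion: transfer from the kernel to G -/

theorem theorem1 (d : ℕ) (B : Matrix (Fin d) (Fin d) ℝ) (hB : B.PosDef)
    (ν : Membrane.E d) (hν : ‖ν‖ = 1) (q : ℝ) (hq : |q| ≤ 1)
    (α : Membrane.E d) (hα : α ∈ Membrane.S ν) :
    (∀ t : ℝ, 0 < t → ∀ x y : Membrane.E d,
      IntegrableOn (Membrane.passageIntegrand B ν q α t x y) (Set.Ioi 0)) ∧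
    Membrane.IsTransitionDensity (Membrane.G B ν q α) ∧
    (∃ (Ω : Type) (_ : MeasurableSpace Ω) (X : ℝ≥0 → Ω → Membrane.E d)
      (P : Kernel (Membrane.E d) Ω),
      Membrane.IsContinuousMarkovProcess X P (Membrane.G B ν q α)) ∧
    ∀ φ : Membrane.E d →ᵇ ℝ,
      Membrane.SolvesConjugationProblem B ν q α φ (Membrane.u B ν q α φ) := by
  have hG : ∀ t, 0 < t → Membrane.G B ν q α t = (Membrane.ofMatrix hB hν hq hα).kernel t :=
    fun t ht => by
      ext x y
      exact Membrane.G_eq_kernel hB hν hq hα ht x y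
  refine ⟨fun t ht => Membrane.integrableOn_passageIntegrand hB hν hq hα ht,
    (Membrane.ofMatrix hB hν hq hα).isTransitionDensity_kernel.congr hG, ?_, fun φ => ?_⟩
  · obtain ⟨Ω, mΩ, X, P, hX⟩ := (Membrane.ofMatrix hB hν hq hα).exists_process
    exact ⟨Ω, mΩ, X, P, hX.congr hG⟩
  · refine ((Membrane.ofMatrix hB hν hq hα).solution_solves φ B
      (Membrane.toEuclideanLin_apply_inv hB) rfl).congr fun t ht => ?_
    ext x
    rw [Membrane.u, hG t ht]
    rfl
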